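/- All matroids are finite. For a matroid $M$, a \emph{cyclic flat} is a flat that is a (possibly empty) union of circuits. Two matroids $M$ and $N$ \emph{have the same configuration} if $|E(M)|=|E(N)|$ and there is an isomorphism from the lattice of cyclic flats of $M$ onto that of $N$ that preserves the size and the rank of each cyclic flat; $M$ is \emph{configuration unique} if every matroid with the same configuration as $M$ is isomorphic to $M$. The \emph{$\mathcal{G}$-invariant} $\mathcal{G}(M)$ records, with multiplicity, for all permutations $(e_1,\dots,e_n)$ of $E(M)$, the vectors $(r_1,\dots,r_n)$ with $r_i=r(\{e_1,\dots,e_i\})-r(\{e_1,\dots,e_{i-1}\})$. For $X\subseteq E(M)$ and $e\notin E(M)$, the principal extension $M+_Xe$, in which $e$ is \emph{added freely} to $X$, is the matroid on $E(M)\cup\{e\}$ in which each $Y\subseteq E(M)$ has rank $r_M(Y)$, while $Y\cup\{e\}$ has rank $r_M(Y)$ if $X\subseteq \mathrm{cl}_M(Y)$ and $r_M(Y)+1$ otherwise. For a matroid $M$ with no loops and a positive integer $m$, the \emph{free $m$-cone} $Q_m(M)$ is formed from $M$ by adding a coloop $a$ and then, by iterated principal extensions, adding, for each $e\in E(M)$,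 $m$ points freely to the line spanned by $a$ and $e$. \textbf{Theorem.} Let $m$ be a positive integer and let $M$ be a matroid with no loops and with $r(M)>2$. Then $Q_m(M)$ is configuration unique. Consequently, if $N$ is a matroid that is not isomorphic to $M$ and satisfies $\mathcal{G}(N)=\mathcal{G}(M)$ (so that $N$ also has no loops and $r(N)=r(M)>2$), then $Q_m(M)$ and $Q_m(N)$ are non-isomorphic configuration-unique matroids with the same $\mathcal{G}$-invariant. -/

import Mathlib

open Set

universe u v w

namespace Matroid

/-! ### Principal extensions -/

section PrincipalExtension

variable {α : Type u}

/-- The independence predicate of the principal extension of `M` in which the new element `e` is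
added freely to `X`. -/
def PrincipalExtIndep (M : Matroid α) (X : Set α) (e : α) (I : Set α) : Prop :=
  M.Indep (I \ {e}) ∧ (e ∈ I → ¬ X ⊆ M.closure (I \ {e}))

theorem principalExtIndep_of_notMem {M : Matroid α} {X I : Set α} {e : α} (h : e ∉ I) :
    PrincipalExtIndep M X e I ↔ M.Indep I := by
  simp [PrincipalExtIndep, h]

theorem principalExtIndep_insert {M : Matroid α} {X I : Set α} {e : α} (h : e ∉ I) :
    PrincipalExtIndep M X e (insert e I) ↔ M.Indep I ∧ ¬ X ⊆ M.closure I := by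
  simp [PrincipalExtIndep, h]

theorem PrincipalExtIndep.subset {M : Matroid α} {X I J : Set α} {e : α}
    (hJ : PrincipalExtIndep M X e J) (hIJ : I ⊆ J) : PrincipalExtIndep M X e I :=
  ⟨hJ.1.subset (sdiff_subset_sdiff_left hIJ), fun he hX => hJ.2 (hIJ he)
    (hX.trans (M.closure_subset_closure (sdiff_subset_sdiff_left hIJ)))⟩

theorem Indep.closure_insert_inter_closure_insert_subset {M : Matroid α} {I : Set α} {x y : α}
    (hI : M.Indep I) (hx : x ∈ M.E) (hxI : x ∉ M.closure I) (hy : y ∈ M.E)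
    (hyI : y ∉ M.closure (insert x I)) :
    M.closure (insert x I) ∩ M.closure (insert y I) ⊆ M.closure I := by
  have h1 : M.Indep (insert x I) := ((hI.notMem_closure_iff hx).1 hxI).1
  have h2 : M.Indep (insert y (insert x I)) := ((h1.notMem_closure_iff hy).1 hyI).1
  have h3 : insert x I ∪ insert y I = insert y (insert x I) := by ext; simp
  have hyx : y ∉ insert x I := fun h => hyI (M.subset_closure _ h1.subset_ground h)
  rw [← Indep.closure_inter_eq_inter_closure (by rwa [h3])]
  apply M.closure_subset_closure
  rintro z ⟨rfl | hz, rfl | hz'⟩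
  · simp at hyx
  all_goals assumption

theorem Indep.exchange_aux {M : Matroid α} {X I B : Set α} {g : α} (hI : M.Indep I)
    (hXI : ¬ X ⊆ M.closure I) (hgI : g ∉ M.closure I)
    (hg : ¬ X ⊆ M.closure (insert g I)) (hBE : B ⊆ M.E)
    (h : ∀ x ∈ B, x ∉ M.closure I → X ⊆ M.closure (insert x I)) :
    g ∉ M.closure B ∧ (B ⊆ M.closure I ∨
      ∃ x, B ⊆ M.closure (insert x I) ∧ X ⊆ M.closure (insert x I) ∧
        g ∉ M.closure (insert x I)) := by
  by_cases hBI : B ⊆ M.closure I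
  · exact ⟨fun hgB => hgI (M.closure_subset_closure_of_subset_closure hBI hgB), .inl hBI⟩
  obtain ⟨x, hxB, hxI⟩ := not_subset.1 hBI
  have hx := h x hxB hxI
  have hgx : g ∉ M.closure (insert x I) := fun hgx =>
    hg (by rwa [closure_insert_congr ⟨hgx, hgI⟩])
  have hBx : B ⊆ M.closure (insert x I) := by
    intro y hyB
    by_contra hyx
    have hyI : y ∉ M.closure I := fun hy =>
      hyx (M.closure_subset_closure (subset_insert x I) hy)
    exact hXI ((subset_inter hx (h y hyB hyI)).trans
      (hI.closure_insert_inter_closure_insert_subset (hBE hxB) hxI (hBE hyB) hyx))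
  exact ⟨fun hgB => hgx (M.closure_subset_closure_of_subset_closure hBx hgB),
    .inr ⟨x, hBx, hx, hgx⟩⟩

theorem PrincipalExtIndep.aug {M : Matroid α} {X I B : Set α} {e : α} (heE : e ∉ M.E)
    (hI : PrincipalExtIndep M X e I) (hImax : ¬ Maximal (PrincipalExtIndep M X e) I)
    (hB : Maximal (PrincipalExtIndep M X e) B) :
    ∃ x ∈ B \ I, PrincipalExtIndep M X e (insert x I) := by
  obtain ⟨g, hgI, hg⟩ := Set.exists_insert_of_not_maximal
    (fun _ _ ht hst => PrincipalExtIndep.subset ht hst) hI hImax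
  have hBmax : ∀ h ∉ B, ¬ PrincipalExtIndep M X e (insert h B) := fun h hh hP =>
    hh (hB.le_of_ge hP (subset_insert h B) (mem_insert h B))
  have hBP := hB.prop
  clear hB hImax
  by_contra! hcon
  by_cases heI : e ∈ I
  · -- the new element lies in `I`
    obtain ⟨I, heI', rfl⟩ : ∃ I', e ∉ I' ∧ I = insert e I' :=
      ⟨I \ {e}, by simp, by simp [insert_eq_of_mem heI]⟩
    rw [principalExtIndep_insert heI'] at hI
    obtain ⟨hge, hgI⟩ : g ≠ e ∧ g ∉ I := by simpa using hgI
    rw [insert_comm, principalExtIndep_insert (by simp [hge.symm, heI'])] at hg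
    have hgE : g ∈ M.E := hg.1.subset_ground (mem_insert _ _)
    have hgcl : g ∉ M.closure I := (hI.1.notMem_closure_iff hgE).2 ⟨hg.1, hgI⟩
    have hloc : ∀ B' ⊆ B, B' ⊆ M.E → ∀ x ∈ B', x ∉ M.closure I →
        X ⊆ M.closure (insert x I) := by
      intro B' hB'B hB'E x hx hxI
      by_contra hX
      have hxe : x ≠ e := fun h => heE (h ▸ hB'E hx)
      have hins := (hI.1.notMem_closure_iff (hB'E hx)).1 hxI
      refine hcon x ⟨hB'B hx, by simp [hxe, hins.2]⟩ ?_
      rw [insert_comm, principalExtIndep_insert (by simp [hxe.symm, heI'])]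
      exact ⟨hins.1, hX⟩
    by_cases heB : e ∈ B
    · obtain ⟨B, heB', rfl⟩ : ∃ B', e ∉ B' ∧ B = insert e B' :=
        ⟨B \ {e}, by simp, by simp [insert_eq_of_mem heB]⟩
      rw [principalExtIndep_insert heB'] at hBP
      have hBE := hBP.1.subset_ground
      have hBX : ∀ h ∈ M.E, h ∉ M.closure B → X ⊆ M.closure (insert h B) := by
        intro h hE hcl
        by_contra hX
        have hins := (hBP.1.notMem_closure_iff hE).1 hcl
        have hhe : h ≠ e := fun h' => heE (h' ▸ hE)
        refine hBmax h (by simp [hhe, hins.2]) ?_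
        rw [insert_comm, principalExtIndep_insert (by simp [hhe.symm, heB'])]
        exact ⟨hins.1, hX⟩
      obtain ⟨hgB, hBI | ⟨x, hBx, hXx, hgx⟩⟩ := hI.1.exchange_aux hI.2 hgcl hg.2 hBE
        (hloc B (subset_insert _ _) hBE)
      · refine hg.2 ((hBX g hgE hgB).trans (M.closure_subset_closure_of_subset_closure ?_))
        exact insert_subset (M.mem_closure_of_mem (mem_insert _ _) hg.1.subset_ground)
          (hBI.trans (M.closure_subset_closure (subset_insert _ _)))
      · have hIx : ¬ I ⊆ M.closure B := by
          intro hIB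
          have hxE : ¬ X ⊆ M.closure B := hBP.2
          by_cases hxB : x ∈ M.closure B
          · exact hxE (hXx.trans (M.closure_subset_closure_of_subset_closure
              (insert_subset hxB hIB)))
          · by_cases hBI' : B ⊆ M.closure I
            · refine hg.2 ((hBX g hgE hgB).trans (M.closure_subset_closure_of_subset_closure ?_))
              exact insert_subset (M.mem_closure_of_mem (mem_insert _ _) hg.1.subset_ground)
                (hBI'.trans (M.closure_subset_closure (subset_insert _ _)))
            · obtain ⟨y, hyB, hyI⟩ := not_subset.1 hBI'
              have hcl := M.closure_insert_congr ⟨hBx hyB, hyI⟩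
              apply hxE
              rw [← hcl] at hXx
              exact hXx.trans (M.closure_subset_closure_of_subset_closure
                (insert_subset (M.mem_closure_of_mem hyB) hIB))
        obtain ⟨w, hwI, hwB⟩ := not_subset.1 hIx
        have hwE : w ∈ M.E := hI.1.subset_ground hwI
        have hsub : M.closure (insert w B) ⊆ M.closure (insert x I) := by
          refine M.closure_subset_closure_of_subset_closure (insert_subset ?_ hBx)
          exact M.closure_subset_closure (subset_insert x I) (M.mem_closure_of_mem hwI)
        exact hBP.2 ((subset_inter (hBX w hwE hwB) (hBX g hgE hgB)).trans
          (hBP.1.closure_insert_inter_closure_insert_subset hwE hwB hgE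
            (fun h => hgx (hsub h))))
    · rw [principalExtIndep_of_notMem heB] at hBP
      have hgB := (hI.1.exchange_aux hI.2 hgcl hg.2 hBP.subset_ground
        (hloc B subset_rfl hBP.subset_ground)).1
      have hins := (hBP.notMem_closure_iff hgE).1 hgB
      refine hBmax g hins.2 ?_
      rw [principalExtIndep_of_notMem (by simp [hge.symm, heB])]
      exact hins.1
  · -- the new element does not lie in `I`
    rw [principalExtIndep_of_notMem heI] at hI
    have hloc : ∀ x ∈ B, x ≠ e → x ∈ M.E → x ∈ M.closure I := by
      intro x hx hxe hxE
      by_contra hxI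
      have hins := (hI.notMem_closure_iff hxE).1 hxI
      refine hcon x ⟨hx, hins.2⟩ ?_
      rw [principalExtIndep_of_notMem (by simp [hxe.symm, heI])]
      exact hins.1
    have hB0 : B \ {e} ⊆ M.closure I := fun x hx =>
      hloc x hx.1 hx.2 (hBP.1.subset_ground hx)
    by_cases heB : e ∈ B
    · have hXI : X ⊆ M.closure I := by
        by_contra hX
        exact hcon e ⟨heB, heI⟩ ((principalExtIndep_insert heI).2 ⟨hI, hX⟩)
      have hge : g ≠ e := by
        rintro rfl
        exact ((principalExtIndep_insert heI).1 hg).2 hXI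
      rw [principalExtIndep_of_notMem (by simp [hge.symm, heI])] at hg
      have hgE : g ∈ M.E := hg.subset_ground (mem_insert _ _)
      have hgcl : g ∉ M.closure I := (hI.notMem_closure_iff hgE).2 ⟨hg, hgI⟩
      have hgB : g ∉ M.closure (B \ {e}) := fun h =>
        hgcl (M.closure_subset_closure_of_subset_closure hB0 h)
      have hins := (hBP.1.notMem_closure_iff hgE).1 hgB
      have hgB' : g ∉ B := fun h => hins.2 ⟨h, hge⟩
      have hX : X ⊆ M.closure (insert g (B \ {e})) := by
        by_contra hX
        refine hBmax g hgB' ⟨?_, fun _ => ?_⟩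
        all_goals rw [insert_sdiff_of_notMem _ (by simpa using hge)]
        · exact hins.1
        · exact hX
      obtain ⟨z, hzX, hzB⟩ := not_subset.1 (hBP.2 heB)
      have hgz := (M.closure_exchange ⟨hX hzX, hzB⟩).1
      exact hgcl (M.closure_subset_closure_of_subset_closure
        (insert_subset (hXI hzX) hB0) hgz)
    · rw [sdiff_singleton_eq_self heB] at hB0
      rw [principalExtIndep_of_notMem heB] at hBP
      have hXB : X ⊆ M.closure B := by
        by_contra hX
        exact hBmax e heB ((principalExtIndep_insert heB).2 ⟨hBP, hX⟩)
      have hXI : X ⊆ M.closure I :=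
        hXB.trans (M.closure_subset_closure_of_subset_closure hB0)
      have hge : g ≠ e := by
        rintro rfl
        exact ((principalExtIndep_insert heI).1 hg).2 hXI
      rw [principalExtIndep_of_notMem (by simp [hge.symm, heI])] at hg
      have hgE : g ∈ M.E := hg.subset_ground (mem_insert _ _)
      have hgcl : g ∉ M.closure I := (hI.notMem_closure_iff hgE).2 ⟨hg, hgI⟩
      have hgB : g ∉ M.closure B := fun h =>
        hgcl (M.closure_subset_closure_of_subset_closure hB0 h)
      have hins := (hBP.notMem_closure_iff hgE).1 hgB
      refine hBmax g hins.2 ?_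
      rw [principalExtIndep_of_notMem (by simp [hge.symm, heB])]
      exact hins.1

theorem PrincipalExtIndep.exists_maximal {M : Matroid α} {X I Y : Set α} {e : α}
    (hY : Y ⊆ insert e M.E) (hI : PrincipalExtIndep M X e I) (hIY : I ⊆ Y) :
    ∃ J, I ⊆ J ∧ Maximal (fun K => PrincipalExtIndep M X e K ∧ K ⊆ Y) J := by
  have hYE : Y \ {e} ⊆ M.E := fun y hy => (hY hy.1).resolve_left hy.2
  have hsub : ∀ {s t : Set α}, (PrincipalExtIndep M X e t ∧ t ⊆ Y) → s ⊆ t →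
      (PrincipalExtIndep M X e s ∧ s ⊆ Y) := fun ht hst => ⟨ht.1.subset hst, hst.trans ht.2⟩
  obtain ⟨J, hJ, hIJ⟩ := hI.1.subset_isBasis_of_subset (sdiff_subset_sdiff_left hIY) hYE
  have heJ : e ∉ J := fun h => (hJ.subset h).2 rfl
  have hJg : ∀ g ∈ Y, g ≠ e → g ∈ M.closure J := fun g hg hge => hJ.subset_closure ⟨hg, hge⟩
  by_cases h1 : e ∈ Y ∧ ¬ X ⊆ M.closure J
  · refine ⟨insert e J, fun x hx => ?_, ?_⟩
    · by_cases hxe : x = e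
      · exact .inl hxe
      · exact .inr (hIJ ⟨hx, hxe⟩)
    rw [Set.maximal_iff_forall_insert (fun _ _ ht hst => hsub ht hst)]
    refine ⟨⟨(principalExtIndep_insert heJ).2 ⟨hJ.indep, h1.2⟩,
      insert_subset h1.1 (hJ.subset.trans sdiff_subset)⟩, fun g hg ⟨hP, hgY⟩ => ?_⟩
    obtain ⟨hge, hgJ⟩ : g ≠ e ∧ g ∉ J := by simpa using hg
    rw [insert_comm, principalExtIndep_insert (by simp [hge.symm, heJ])] at hP
    exact ((hJ.indep.notMem_closure_iff (hP.1.subset_ground (mem_insert _ _))).2 ⟨hP.1, hgJ⟩)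
      (hJg g (hgY (mem_insert _ _)) hge)
  by_cases heI : e ∈ I
  · have heY := hIY heI
    have hXJ : X ⊆ M.closure J := by tauto
    -- remove an element of `J` so that the closure no longer contains `X`
    obtain ⟨f, hfJ, hfI, hfX⟩ : ∃ f ∈ J, f ∉ I ∧ ¬ X ⊆ M.closure (J \ {f}) := by
      by_contra! hcon
      have hne : (J \ I).Nonempty := by
        by_contra hemp
        rw [not_nonempty_iff_eq_empty, sdiff_eq_empty] at hemp
        exact hI.2 heI (hXJ.trans (M.closure_subset_closure
          fun x hx => ⟨hemp hx, fun h => heJ (h ▸ hx)⟩))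
      have : Nonempty (J \ I : Set α) := hne.to_subtype
      have hcl := hJ.indep.closure_iInter_eq_biInter_closure_of_forall_subset
        (Js := fun f : (J \ I : Set α) => J \ {f.1}) (fun _ => sdiff_subset)
      apply hI.2 heI
      have hX : X ⊆ ⋂ f : (J \ I : Set α), M.closure (J \ {f.1}) :=
        subset_iInter fun f => hcon f.1 f.2.1 f.2.2
      rw [← hcl] at hX
      refine hX.trans (M.closure_subset_closure fun x hx => ?_)
      rw [mem_iInter] at hx
      have hxJ : x ∈ J := (hx ⟨_, hne.some_mem⟩).1
      refine ⟨?_, fun h => heJ (h ▸ hxJ)⟩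
      by_contra hxI
      exact (hx ⟨x, hxJ, hxI⟩).2 rfl
    have heJf : e ∉ J \ {f} := fun h => heJ h.1
    refine ⟨insert e (J \ {f}), fun x hx => ?_, ?_⟩
    · by_cases hxe : x = e
      · exact .inl hxe
      · exact .inr ⟨hIJ ⟨hx, hxe⟩, fun h => hfI (h ▸ hx)⟩
    rw [Set.maximal_iff_forall_insert (fun _ _ ht hst => hsub ht hst)]
    refine ⟨⟨(principalExtIndep_insert heJf).2 ⟨hJ.indep.subset sdiff_subset, hfX⟩,
      insert_subset heY (sdiff_subset.trans (hJ.subset.trans sdiff_subset))⟩,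
      fun g hg ⟨hP, hgY⟩ => ?_⟩
    obtain ⟨hge, hgJ⟩ : g ≠ e ∧ g ∉ J \ {f} := by simpa using hg
    rw [insert_comm, principalExtIndep_insert (by simp [hge.symm, heJ])] at hP
    have hgE := hP.1.subset_ground (mem_insert _ _)
    have hgcl := (((hJ.indep.subset sdiff_subset).notMem_closure_iff hgE).2 ⟨hP.1, hgJ⟩)
    have hgJ' := hJg g (hgY (mem_insert _ _)) hge
    have hJf : insert f (J \ {f}) = J := by simp [insert_eq_of_mem hfJ]
    have := M.closure_insert_congr (X := J \ {f}) (f := f) ⟨by rwa [hJf], hgcl⟩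
    rw [hJf] at this
    exact hP.2 (by rwa [this])
  · refine ⟨J, fun x hx => hIJ ⟨hx, fun h => heI (h ▸ hx)⟩, ?_⟩
    rw [Set.maximal_iff_forall_insert (fun _ _ ht hst => hsub ht hst)]
    refine ⟨⟨(principalExtIndep_of_notMem heJ).2 hJ.indep, hJ.subset.trans sdiff_subset⟩,
      fun g hgJ ⟨hP, hgY⟩ => ?_⟩
    by_cases hge : g = e
    · subst hge
      exact h1 ⟨hgY (mem_insert _ _), ((principalExtIndep_insert heJ).1 hP).2⟩
    · rw [principalExtIndep_of_notMem (by simp [Ne.symm hge, heJ])] at hP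
      exact ((hJ.indep.notMem_closure_iff (hP.subset_ground (mem_insert _ _))).2 ⟨hP, hgJ⟩)
        (hJg g (hgY (mem_insert _ _)) hge)

/-- The principal extension `M +_X e`: the matroid on `E(M) ∪ {e}` obtained from `M` by adding the
new element `e` freely to `X`. Its rank function is computed in `eRk_principalExt` and
`eRk_insert_principalExt` below. It is meant for `e ∉ E(M)` and `X ⊆ E(M)`; if `e ∈ E(M)`, then
`e` is deleted first. -/
def principalExt (M : Matroid α) (X : Set α) (e : α) : Matroid α :=
  IndepMatroid.matroid {
    E := insert e M.E
    Indep := PrincipalExtIndep (M ＼ {e}) X e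
    indep_empty := (principalExtIndep_of_notMem (notMem_empty e)).2 (empty_indep _)
    indep_subset := fun _ _ hJ hIJ => hJ.subset hIJ
    indep_aug := fun _ _ hI hImax hB => hI.aug (by simp) hImax hB
    indep_maximal := fun _ hY _ hI hIY => hI.exists_maximal (by simpa using hY) hIY
    subset_ground := fun I hI x hx => by
      by_cases hxe : x = e
      · exact .inl hxe
      · exact .inr (hI.1.subset_ground ⟨hx, hxe⟩).1 }

theorem principalExt_ground (M : Matroid α) (X : Set α) (e : α) :
    (M.principalExt X e).E = insert e M.E := rfl

theorem principalExt_indep_iff {M : Matroid α} {X I : Set α} {e : α} (he : e ∉ M.E) :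
    (M.principalExt X e).Indep I ↔
      M.Indep (I \ {e}) ∧ (e ∈ I → ¬ X ⊆ M.closure (I \ {e})) := by
  have h : M ＼ {e} = M := by simpa using he
  change PrincipalExtIndep (M ＼ {e}) X e I ↔ _
  rw [h, PrincipalExtIndep]

/-- On sets that avoid the new element, the rank is unchanged. -/
theorem eRk_principalExt {M : Matroid α} {X Y : Set α} {e : α} (he : e ∉ M.E) (hY : Y ⊆ M.E) :
    (M.principalExt X e).eRk Y = M.eRk Y := by
  obtain ⟨I, hI⟩ := M.exists_isBasis Y
  have heY : e ∉ Y := fun h => he (hY h)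
  have key : ∀ {J}, J ⊆ Y → ((M.principalExt X e).Indep J ↔ M.Indep J) := fun {J} hJ => by
    have heJ : e ∉ J := fun h => heY (hJ h)
    simp [principalExt_indep_iff he, heJ]
  have hI' : (M.principalExt X e).IsBasis I Y := by
    refine ((key hI.subset).2 hI.indep).isBasis_of_forall_insert hI.subset fun g hg => ?_
    rw [Dep, key (insert_subset hg.1 hI.subset)]
    exact ⟨(hI.insert_dep hg).1, (insert_subset hg.1 hI.subset).trans
      (hY.trans (subset_insert _ _))⟩
  rw [← hI.encard_eq_eRk, ← hI'.encard_eq_eRk]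

open scoped Classical in
/-- The rank of `Y ∪ {e}` is `r(Y)` if `X` is contained in the closure of `Y`, and `r(Y) + 1`
otherwise. -/
theorem eRk_insert_principalExt {M : Matroid α} {X Y : Set α} {e : α} (he : e ∉ M.E)
    (hY : Y ⊆ M.E) :
    (M.principalExt X e).eRk (insert e Y) =
      if X ⊆ M.closure Y then M.eRk Y else M.eRk Y + 1 := by
  obtain ⟨I, hI⟩ := M.exists_isBasis Y
  have heI : e ∉ I := fun h => he (hY (hI.subset h))
  have hIE : I ⊆ insert e M.E := (hI.subset.trans hY).trans (subset_insert _ _)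
  have hYE : insert e Y ⊆ insert e M.E := insert_subset_insert hY
  split_ifs with hX
  · have hI' : (M.principalExt X e).IsBasis I (insert e Y) := by
      refine Indep.isBasis_of_forall_insert ?_ (hI.subset.trans (subset_insert _ _))
        fun g hg => ⟨fun hgI => ?_, insert_subset (hYE hg.1) hIE⟩
      · simpa [principalExt_indep_iff he, heI] using hI.indep
      · rw [principalExt_indep_iff he] at hgI
        by_cases hge : g = e
        · subst hge
          refine hgI.2 (mem_insert _ _) ?_
          rwa [insert_sdiff_self_of_notMem heI, hI.closure_eq_closure]
        · have hgY : g ∈ Y := hg.1.resolve_left hge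
          rw [sdiff_singleton_eq_self (by simp [Ne.symm hge, heI])] at hgI
          exact (hI.insert_dep ⟨hgY, hg.2⟩).1 hgI.1
    rw [← hI.encard_eq_eRk, ← hI'.encard_eq_eRk]
  · have hI' : (M.principalExt X e).IsBasis (insert e I) (insert e Y) := by
      refine Indep.isBasis_of_forall_insert ?_ (insert_subset_insert hI.subset)
        fun g hg => ⟨fun hgI => ?_, insert_subset (hYE hg.1) (insert_subset (mem_insert _ _) hIE)⟩
      · rw [principalExt_indep_iff he, insert_sdiff_self_of_notMem heI, hI.closure_eq_closure]
        exact ⟨hI.indep, fun _ => hX⟩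
      · obtain ⟨hge, hgI'⟩ : g ≠ e ∧ g ∉ I := by simpa using hg.2
        have hgY : g ∈ Y := hg.1.resolve_left hge
        rw [insert_comm, principalExt_indep_iff he,
          insert_sdiff_self_of_notMem (by simp [Ne.symm hge, heI])] at hgI
        exact (hI.insert_dep ⟨hgY, hgI'⟩).1 hgI.1
    rw [← hI.encard_eq_eRk, ← hI'.encard_eq_eRk, encard_insert_of_notMem heI]

end PrincipalExtension

/-! ### Free cones -/

/-- The elements that the free `m`-cone of a matroid on `α` may have: the elements of `α`, the
tip, and `m` further elements for each element of `α`. -/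
inductive FreeConePoint (α : Type u) (m : ℕ) : Type u
  | base : α → FreeConePoint α m
  | tip : FreeConePoint α m
  | pt : α → Fin m → FreeConePoint α m

/-- The inclusion of the elements of `M` into the elements of the free cone. -/
def FreeConePoint.baseEmb (α : Type u) (m : ℕ) : α ↪ FreeConePoint α m :=
  ⟨FreeConePoint.base, fun _ _ h => FreeConePoint.base.inj h⟩

/-- The extension of `M` in which the tip is added as a coloop: the direct sum of `M` and the
free matroid on the tip alone. -/
def coloopExt {α : Type u} (M : Matroid α) (m : ℕ) : Matroid (FreeConePoint α m) :=
  (M.mapEmbedding (FreeConePoint.baseEmb α m)).disjointSum (freeOn {FreeConePoint.tip})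
    (by simp [FreeConePoint.baseEmb])

/-- The free `m`-cone `Q_m(M)` of a (loopless) finite matroid `M`: add the tip `a` as a coloop and
then, by iterated principal extensions, for each element `x` of `M`, add `m` points freely to the
line spanned by `a` and `x`. The extensions are carried out in an arbitrary order, on which the
result does not depend. -/
noncomputable def freeCone {α : Type u} (M : Matroid α) [M.Finite] (m : ℕ) :
    Matroid (FreeConePoint α m) :=
  (M.ground_finite.toFinset ×ˢ (Finset.univ : Finset (Fin m))).toList.foldl
    (fun N p => N.principalExt {FreeConePoint.tip, FreeConePoint.base p.1}
      (FreeConePoint.pt p.1 p.2))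
    (M.coloopExt m)

/-! ### Isomorphism, cyclic flats and configurations -/

/-- `M` and `N` are isomorphic: some bijection between the ground sets preserves independence in
both directions. -/
def IsIsomorphic {α : Type u} {β : Type v} (M : Matroid α) (N : Matroid β) : Prop :=
  ∃ φ : M.E ≃ N.E, ∀ I : Set M.E,
    M.Indep (Subtype.val '' I) ↔ N.Indep (Subtype.val '' (φ '' I))

/-- A cyclic flat is a flat that is a (possibly empty) union of circuits. -/
def IsCyclicFlat {α : Type u} (M : Matroid α) (F : Set α) : Prop :=
  M.IsFlat F ∧ ∃ 𝒞 : Set (Set α), (∀ C ∈ 𝒞, M.IsCircuit C) ∧ F = ⋃₀ 𝒞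

/-- `M` and `N` have the same configuration: their ground sets have the same size, and some
isomorphism between their lattices of cyclic flats preserves the size and the rank of each cyclic
flat. -/
def SameConfiguration {α : Type u} {β : Type v} (M : Matroid α) (N : Matroid β) : Prop :=
  M.E.encard = N.E.encard ∧
    ∃ Φ : {F : Set α // M.IsCyclicFlat F} ≃o {F : Set β // N.IsCyclicFlat F},
      ∀ F, (Φ F).1.encard = F.1.encard ∧ N.eRk (Φ F).1 = M.eRk F.1

/-- `M` is configuration unique: each finite matroid with the same configuration as `M` is
isomorphic to `M`. -/
def ConfigurationUnique {α : Type u} (M : Matroid α) : Prop :=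
  ∀ (β : Type w) (N : Matroid β), N.Finite → M.SameConfiguration N → M.IsIsomorphic N

/-! ### The G-invariant -/

/-- The vector of rank increases when the elements of the list `π = [e₁, …, eₙ]` are added one
after the other: its `i`-th entry is `r({e₁, …, eᵢ}) - r({e₁, …, eᵢ₋₁})`. -/
noncomputable def rankSequence {α : Type u} (M : Matroid α) (π : List α) : List ℕ :=
  (List.range π.length).map fun i =>
    (M.eRk {x | x ∈ π.take (i + 1)} - M.eRk {x | x ∈ π.take i}).toNat

/-- The `𝒢`-invariant of a finite matroid `M`, which records the multiset of the rank sequences of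
all permutations of `E(M)`: its value at a vector `s` is the number of permutations `π` of `E(M)`
with rank sequence `s`. -/
noncomputable def gInvariant {α : Type u} (M : Matroid α) (s : List ℕ) : ℕ :=
  {π : List α | π.Nodup ∧ {x | x ∈ π} = M.E ∧ M.rankSequence π = s}.ncard

end Matroid

/-! Write `Q` for the free cone. A set `I` of elements of `Q` is independent exactly when its part
in `E(M)` is independent in `M` and `|I| ≤ r(proj I) + 1`, where `proj` is the projection from the
tip onto `E(M)`; this survives every principal extension in the construction (`partialCone_step`).
Hence a set containing the tip has rank `r(proj Y) + 1`, and one avoiding the tip has rank `min (r(Y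
∩ E(M)) + #added points of Y) (r(proj Y) + 1)`. The cyclic flats of `Q` can be read off: the cones
over nonempty flats `X` of `M`, of size `1 + (m + 1)|X|` and rank `r(X) + 1`, and the cyclic flats
`Z` of `M` (`IsCyclicFlat.freeCone_cases`).

Let `N` have the same configuration, with cyclic flats `D X` and `U Z` corresponding to these. The
lines `L e = D (cl e)` are too large to be pairwise disjoint in `N`, so two of them meet. If `w`,
`z`, `w'` are independent, the planes of `N` over `{w, z}` and `{w', z}` meet exactly in `L z`, so
`L w ∩ L w' ⊆ L z`; since `r(M) > 2`, this spreads a common element of two lines to all lines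
(`exists_common_point`). This element `a` plays the role of the tip. Counting then shows that `D X`
is the union of its lines, that `a` lies in no `U Z`, and that `U Z` meets `L e` in exactly `|cl e|`
elements for `e ∈ Z`. So membership in a cyclic flat of `N` depends only on the line of an element
and on whether the element belongs to a chosen set of `|cl e|` elements of that line. The same holds
in `Q` with equal counts, and any matching of these labels is an isomorphism.

For the `𝒢`-invariant, fix an order of the abstract cone on `n` labels and let the enumeration of
`E(M)` by these labels vary. The prefix ranks follow the first term of the minimum until the tip is
spanned, and `r(proj) + 1` from then on. For a switch at a given place, only ranks along one chain
of label sets matter (base parts, then projections), and their joint distribution over all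
enumerations is determined by `𝒢(M)` (`exists_equiv_setRk_chain`).

Finally, an isomorphism of cones fixes the tip. Contracting the tip gives `M` with each parallel
class enlarged by the factor `m + 1`, so `M` can be recovered (`isIsomorphic_of_freeCone`). -/

namespace Matroid

/-! ### Ranks as natural numbers, and cyclic flats -/

section Rank

variable {α : Type u} {M : Matroid α}

/-- The rank of a set as a natural number. -/
noncomputable def rk (M : Matroid α) (X : Set α) : ℕ := (M.eRk X).toNat

theorem cast_rk [M.RankFinite] (X : Set α) : (M.rk X : ℕ∞) = M.eRk X :=
  ENat.natCast_toNat (eRk_ne_top_iff.2 (M.isRkFinite_set X))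

theorem rk_mono [M.RankFinite] {X Y : Set α} (h : X ⊆ Y) : M.rk X ≤ M.rk Y := by
  have := M.eRk_mono h
  rwa [← cast_rk, ← cast_rk, Nat.cast_le] at this

@[simp] theorem rk_empty : M.rk ∅ = 0 := by simp [rk]

@[simp] theorem rk_closure (X : Set α) : M.rk (M.closure X) = M.rk X := by simp [rk]

theorem rk_congr_closure {X Y : Set α} (h : M.closure X = M.closure Y) : M.rk X = M.rk Y := by
  rw [← rk_closure X, h, rk_closure]

theorem rk_le_ncard [M.RankFinite] {X : Set α} (hX : X.Finite) : M.rk X ≤ X.ncard := by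
  have := M.eRk_le_encard X
  rwa [← cast_rk, ← hX.cast_ncard_eq, Nat.cast_le] at this

theorem rk_insert_le [M.RankFinite] (x : α) (X : Set α) : M.rk (insert x X) ≤ M.rk X + 1 := by
  have := M.eRk_insert_le_add_one x X
  simp only [← cast_rk] at this
  exact_mod_cast this

theorem rk_insert_eq_add_one [M.RankFinite] {x : α} {X : Set α} (hx : x ∈ M.E)
    (hxX : x ∉ M.closure X) : M.rk (insert x X) = M.rk X + 1 := by
  have := eRk_insert_eq_add_one ⟨hx, hxX⟩
  simp only [← cast_rk] at this
  exact_mod_cast this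

theorem rk_insert_eq {x : α} {X : Set α} (hxX : x ∈ M.closure X) :
    M.rk (insert x X) = M.rk X :=
  rk_congr_closure (closure_insert_eq_of_mem_closure hxX)

theorem mem_closure_iff_rk [M.RankFinite] {x : α} {X : Set α} (hx : x ∈ M.E) :
    x ∈ M.closure X ↔ M.rk (insert x X) = M.rk X := by
  refine ⟨rk_insert_eq, fun h => ?_⟩
  by_contra hxX
  have := rk_insert_eq_add_one hx hxX
  omega

theorem indep_iff_rk [M.RankFinite] {I : Set α} (hI : I.Finite) :
    M.Indep I ↔ M.rk I = I.ncard := by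
  rw [indep_iff_eRk_eq_encard_of_finite hI, ← cast_rk, ← hI.cast_ncard_eq, Nat.cast_inj]

theorem indep_iff_ncard_le_rk [M.RankFinite] {I : Set α} (hI : I.Finite) :
    M.Indep I ↔ I.ncard ≤ M.rk I := by
  rw [indep_iff_rk hI]
  have := M.rk_le_ncard hI
  omega

theorem rk_singleton [M.Loopless] [M.RankFinite] {x : α} (hx : x ∈ M.E) : M.rk {x} = 1 := by
  simp [rk, eRk_singleton_eq hx]

theorem rk_pos [M.Loopless] [M.RankFinite] {x : α} {X : Set α} (hx : x ∈ M.E) (hxX : x ∈ X) :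
    0 < M.rk X := by
  have := M.rk_mono (singleton_subset_iff.2 hxX)
  rw [rk_singleton hx] at this
  omega

theorem isFlat_iff_rk [M.RankFinite] {F : Set α} (hF : F ⊆ M.E) :
    M.IsFlat F ↔ ∀ x ∈ M.E, x ∉ F → M.rk F < M.rk (insert x F) := by
  rw [isFlat_iff_closure_eq]
  constructor
  · intro h x hx hxF
    rw [rk_insert_eq_add_one hx (by rwa [h])]
    omega
  · intro h
    refine (M.subset_closure F hF).antisymm' fun x hx => ?_
    by_contra hxF
    have := h x (mem_ground_of_mem_closure hx) hxF
    rw [rk_insert_eq hx] at this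
    omega

theorem IsFlat.eq_of_subset_of_rk_le [M.RankFinite] {F G : Set α} (hF : M.IsFlat F)
    (hG : M.IsFlat G) (h : F ⊆ G) (hr : M.rk G ≤ M.rk F) : F = G := by
  refine h.antisymm fun x hx => ?_
  by_contra hxF
  have h1 := (isFlat_iff_rk hF.subset_ground).1 hF x (hG.subset_ground hx) hxF
  have h2 := M.rk_mono (insert_subset hx h)
  omega

theorem IsFlat.inter' {F G : Set α} (hF : M.IsFlat F) (hG : M.IsFlat G) : M.IsFlat (F ∩ G) := by
  rw [isFlat_iff_closure_eq]
  refine (subset_inter ?_ ?_).antisymm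
    (M.subset_closure _ (inter_subset_left.trans hF.subset_ground))
  · exact (M.closure_subset_closure inter_subset_left).trans hF.closure.subset
  · exact (M.closure_subset_closure inter_subset_right).trans hG.closure.subset

/-- Two distinct flats of rank `k + 1` meet in a flat of rank at most `k`. -/
theorem IsFlat.rk_inter_lt [M.RankFinite] {F G : Set α} (hF : M.IsFlat F) (hG : M.IsFlat G)
    (hr : M.rk G ≤ M.rk F) (hne : F ≠ G) : M.rk (F ∩ G) < M.rk F := by
  by_contra! h
  have h1 := (hF.inter' hG).eq_of_subset_of_rk_le hF inter_subset_left h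
  exact hne (hF.eq_of_subset_of_rk_le hG (by rw [← h1]; exact inter_subset_right) hr)

theorem IsFlat.closure_subset {F X : Set α} (hF : M.IsFlat F) (h : X ⊆ F) : M.closure X ⊆ F :=
  (M.closure_subset_closure h).trans hF.closure.subset

theorem IsFlat.closure_singleton_subset {F : Set α} (hF : M.IsFlat F) {x : α} (h : x ∈ F) :
    M.closure {x} ⊆ F :=
  hF.closure_subset (singleton_subset_iff.2 h)

/-- An element of `F` lies in a circuit inside `F` if and only if it is spanned by the rest of `F`.
This turns cyclic flats into a pure rank condition, which the rank formula of the cone can decide.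
-/
theorem isCyclicFlat_iff_rk [M.RankFinite] {F : Set α} :
    M.IsCyclicFlat F ↔ M.IsFlat F ∧ ∀ x ∈ F, M.rk (F \ {x}) = M.rk F := by
  refine and_congr_right fun hF => ⟨?_, fun h => ?_⟩
  · rintro ⟨𝒞, hC, rfl⟩ x ⟨C, hC𝒞, hxC⟩
    have h1 := (hC C hC𝒞).mem_closure_sdiff_singleton_of_mem hxC
    refine rk_congr_closure (closure_sdiff_singleton_eq_closure ?_)
    exact M.closure_subset_closure (sdiff_subset_sdiff_left (subset_sUnion_of_mem hC𝒞)) h1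
  · refine ⟨{C | M.IsCircuit C ∧ C ⊆ F}, fun C hC => hC.1, ?_⟩
    refine subset_antisymm (fun x hx => ?_) (sUnion_subset fun C hC => hC.2)
    have hcl : x ∈ M.closure (F \ {x}) := by
      rw [mem_closure_iff_rk (hF.subset_ground hx), h x hx]
      simp [insert_eq_of_mem hx]
    obtain ⟨C, hCs, hC, hxC⟩ := exists_isCircuit_of_mem_closure hcl (by simp)
    exact ⟨C, ⟨hC, hCs.trans (by simp [hx])⟩, hxC⟩

theorem IsCircuit.isCyclicFlat_closure [M.RankFinite] {C : Set α} (hC : M.IsCircuit C) :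
    M.IsCyclicFlat (M.closure C) := by
  rw [isCyclicFlat_iff_rk]
  refine ⟨isFlat_closure _, fun x hx => rk_congr_closure (subset_antisymm
    (M.closure_subset_closure sdiff_subset) ?_)⟩
  have h1 : M.closure (C \ {x}) ⊆ M.closure (M.closure C \ {x}) :=
    M.closure_subset_closure (sdiff_subset_sdiff_left (M.subset_closure C hC.subset_ground))
  rw [hC.closure_sdiff_singleton_eq] at h1
  rwa [closure_closure]

theorem IsCircuit.rk_closure_lt [M.RankFinite] {C : Set α} (hC : M.IsCircuit C)
    (hfin : C.Finite) : M.rk (M.closure C) < C.ncard := by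
  have := hC.eRk_add_one_eq
  rw [← cast_rk, ← hfin.cast_ncard_eq] at this
  rw [rk_closure]
  norm_cast at this
  omega

/-- A matroid is determined by its cyclic flats and their ranks. -/
theorem indep_iff_forall_isCyclicFlat [M.Finite] {I : Set α} (hI : I ⊆ M.E) :
    M.Indep I ↔ ∀ F, M.IsCyclicFlat F → (I ∩ F).ncard ≤ M.rk F := by
  have hfin : I.Finite := M.ground_finite.subset hI
  refine ⟨fun h F hF => ?_, fun h => ?_⟩
  · rw [← (indep_iff_rk (hfin.subset inter_subset_left)).1 (h.subset inter_subset_left)]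
    exact M.rk_mono inter_subset_right
  · by_contra hd
    -- A circuit `C ⊆ I` violates the bound for its own closure, a cyclic flat of rank `|C| - 1`.
    obtain ⟨C, hCI, hC⟩ := ((not_indep_iff hI).1 hd).exists_isCircuit_subset
    have h1 := h _ hC.isCyclicFlat_closure
    have h2 := hC.rk_closure_lt (hfin.subset hCI)
    have h3 : C.ncard ≤ (I ∩ M.closure C).ncard :=
      ncard_le_ncard (subset_inter hCI (M.subset_closure C hC.subset_ground))
        (hfin.subset inter_subset_left)
    omega

/-- The set of all elements that lie in circuits is the largest cyclic flat. -/
theorem isCyclicFlat_sUnion_isCircuit (M : Matroid α) :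
    M.IsCyclicFlat (⋃₀ {C | M.IsCircuit C}) := by
  refine ⟨?_, _, fun C hC => hC, rfl⟩
  rw [isFlat_iff_closure_eq]
  refine (M.subset_closure _ (sUnion_subset fun C hC => hC.subset_ground)).antisymm'
    fun x hx => ?_
  by_contra hxF
  obtain ⟨C, -, hC, hxC⟩ := exists_isCircuit_of_mem_closure hx hxF
  exact hxF ⟨C, hC, hxC⟩

theorem IsCyclicFlat.subset_sUnion_isCircuit {F : Set α} (hF : M.IsCyclicFlat F) :
    F ⊆ ⋃₀ {C | M.IsCircuit C} := by
  obtain ⟨-, 𝒞, h𝒞, rfl⟩ := hF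
  exact sUnion_subset_sUnion fun C hC => h𝒞 C hC

theorem closure_singleton_eq_of_mem [M.Loopless] {x y : α}
    (h : x ∈ M.closure {y}) : M.closure {x} = M.closure {y} :=
  (isNonloop_of_loopless (mem_ground_of_mem_closure h)).closure_eq_of_mem_closure h

end Rank

/-- Bijections obtained by counting fibres. It serves to match elements of the cone with those of
`N`, enumerations with equal rank sequences, and elements of corresponding parallel classes. -/
theorem exists_equiv_of_labels {A : Type u} {B : Type v} {κ : Type w} [Finite A] [Finite B]
    (f : A → κ) (g : B → κ) (h : ∀ k, {a | f a = k}.ncard = {b | g b = k}.ncard) :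
    ∃ φ : A ≃ B, ∀ a, g (φ a) = f a := by
  have h' : ∀ k, Nonempty ({a // f a = k} ≃ {b // g b = k}) := fun k =>
    (Finite.card_eq).1 (h k)
  exact ⟨Equiv.ofFiberEquiv fun k => (h' k).some, fun a => Equiv.ofFiberEquiv_map _ a⟩

end Matroid

namespace Matroid

/-! ### Base part, added points and projection of a set in the cone -/

section ConeSets

variable {α : Type u} {m : ℕ}

/-- The elements of the original matroid that lie in a set of elements of the free cone. -/
def coneBase (Y : Set (FreeConePoint α m)) : Set α := {x | .base x ∈ Y}

/-- The points of a set of elements of the free cone that were added freely to lines. -/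
def conePts (Y : Set (FreeConePoint α m)) : Set (FreeConePoint α m) :=
  {y ∈ Y | ∃ x i, y = .pt x i}

/-- The projection from the tip of a set of elements of the free cone. -/
def coneProj (Y : Set (FreeConePoint α m)) : Set α := {x | .base x ∈ Y ∨ ∃ i, .pt x i ∈ Y}

@[simp] theorem mem_coneBase {Y : Set (FreeConePoint α m)} {x : α} :
    x ∈ coneBase Y ↔ .base x ∈ Y := Iff.rfl

theorem mem_coneProj {Y : Set (FreeConePoint α m)} {x : α} :
    x ∈ coneProj Y ↔ .base x ∈ Y ∨ ∃ i, .pt x i ∈ Y := Iff.rfl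

theorem coneBase_subset_coneProj (Y : Set (FreeConePoint α m)) : coneBase Y ⊆ coneProj Y :=
  fun _ hx => .inl hx

theorem coneProj_mono {Y Z : Set (FreeConePoint α m)} (h : Y ⊆ Z) : coneProj Y ⊆ coneProj Z :=
  fun _ hx => hx.imp (fun h1 => h h1) fun ⟨i, hi⟩ => ⟨i, h hi⟩

theorem coneBase_mono {Y Z : Set (FreeConePoint α m)} (h : Y ⊆ Z) : coneBase Y ⊆ coneBase Z :=
  fun _ hx => h hx

@[simp] theorem coneProj_insert_base (x : α) (Y : Set (FreeConePoint α m)) :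
    coneProj (insert (.base x) Y) = insert x (coneProj Y) := by
  ext z; simp [mem_coneProj, or_assoc]

@[simp] theorem coneProj_insert_pt (x : α) (i : Fin m) (Y : Set (FreeConePoint α m)) :
    coneProj (insert (.pt x i) Y) = insert x (coneProj Y) := by
  ext z
  simp only [mem_coneProj, mem_insert_iff, reduceCtorEq, false_or, FreeConePoint.pt.injEq]
  grind

@[simp] theorem coneProj_insert_tip (Y : Set (FreeConePoint α m)) :
    coneProj (insert .tip Y) = coneProj Y := by
  ext z; simp [mem_coneProj]

@[simp] theorem coneBase_insert_base (x : α) (Y : Set (FreeConePoint α m)) :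
    coneBase (insert (.base x) Y) = insert x (coneBase Y) := by
  ext z; simp

@[simp] theorem coneBase_insert_pt (x : α) (i : Fin m) (Y : Set (FreeConePoint α m)) :
    coneBase (insert (.pt x i) Y) = coneBase Y := by
  ext z; simp

@[simp] theorem coneBase_insert_tip (Y : Set (FreeConePoint α m)) :
    coneBase (insert .tip Y) = coneBase Y := by
  ext z; simp

@[simp] theorem conePts_insert_pt (x : α) (i : Fin m) (Y : Set (FreeConePoint α m)) :
    conePts (insert (.pt x i) Y) = insert (.pt x i) (conePts Y) := by
  ext z
  simp only [conePts, mem_insert_iff, mem_ofPred_eq]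
  grind

@[simp] theorem coneProj_empty : coneProj (∅ : Set (FreeConePoint α m)) = ∅ := by
  ext; simp [mem_coneProj]

@[simp] theorem coneBase_empty : coneBase (∅ : Set (FreeConePoint α m)) = ∅ := rfl

@[simp] theorem conePts_empty : conePts (∅ : Set (FreeConePoint α m)) = ∅ := by
  simp [conePts]

@[simp] theorem coneProj_image_base (Z : Set α) :
    coneProj (FreeConePoint.base (m := m) '' Z) = Z := by
  ext; simp [mem_coneProj]

@[simp] theorem coneBase_image_base (Z : Set α) :
    coneBase (FreeConePoint.base (m := m) '' Z) = Z := by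
  ext; simp

@[simp] theorem conePts_image_base (Z : Set α) :
    conePts (FreeConePoint.base (m := m) '' Z) = ∅ := by
  ext z; simp only [conePts, mem_ofPred_eq, mem_image]; grind

theorem FreeConePoint.base_injective : Function.Injective (FreeConePoint.base (α := α) (m := m)) :=
  fun _ _ h => FreeConePoint.base.inj h

theorem eq_image_base_union_conePts {Y : Set (FreeConePoint α m)} (h : .tip ∉ Y) :
    Y = FreeConePoint.base '' coneBase Y ∪ conePts Y := by
  ext z
  cases z <;> simp [conePts, h]

theorem Finite.coneBase {Y : Set (FreeConePoint α m)} (hY : Y.Finite) : (coneBase Y).Finite :=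
  hY.preimage (FreeConePoint.base_injective.injOn)

theorem ncard_eq_of_tip_notMem {Y : Set (FreeConePoint α m)} (hY : Y.Finite) (h : .tip ∉ Y) :
    Y.ncard = (coneBase Y).ncard + (conePts Y).ncard := by
  conv_lhs => rw [eq_image_base_union_conePts h]
  rw [ncard_union_eq ?_ ((Finite.coneBase hY).image _) (hY.subset fun _ h => h.1),
    ncard_image_of_injective _ FreeConePoint.base_injective]
  rw [disjoint_left]
  rintro _ ⟨x, -, rfl⟩ ⟨-, y, i, h⟩
  cases h

/-- The rank of the projection from the tip is at most the number of elements other than the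
tip. -/
theorem rk_coneProj_le (M : Matroid α) [M.RankFinite] {Y : Set (FreeConePoint α m)}
    (hY : Y.Finite) : M.rk (coneProj Y) ≤ (Y \ {.tip}).ncard := by
  induction Y, hY using Set.Finite.induction_on with
  | empty => simp
  | @insert z Y hz hY ih =>
    have hle : ∀ x, M.rk (insert x (coneProj Y)) ≤ M.rk (coneProj Y) + 1 := fun x =>
      M.rk_insert_le x _
    cases z with
    | tip => simpa using ih
    | base x =>
      rw [coneProj_insert_base, insert_sdiff_of_notMem _ (by simp),
        ncard_insert_of_notMem (fun h => hz h.1) (hY.subset sdiff_subset)]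
      linarith [hle x]
    | pt x i =>
      rw [coneProj_insert_pt, insert_sdiff_of_notMem _ (by simp),
        ncard_insert_of_notMem (fun h => hz h.1) (hY.subset sdiff_subset)]
      linarith [hle x]

theorem rk_coneProj_add_one_le (M : Matroid α) [M.RankFinite] {Y : Set (FreeConePoint α m)}
    (hY : Y.Finite) (h : .tip ∈ Y) : M.rk (coneProj Y) + 1 ≤ Y.ncard := by
  have := rk_coneProj_le M hY
  rw [← ncard_sdiff_singleton_add_one h hY]
  omega

end ConeSets

/-! ### Independent sets of the free cone -/

section ConeIndep

variable {α : Type u} {m : ℕ}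

/-- The independence predicate of the free cone. -/
def ConeIndep (M : Matroid α) (I : Set (FreeConePoint α m)) : Prop :=
  M.Indep (coneBase I) ∧ I.ncard ≤ M.rk (coneProj I) + 1

/-- The matroid obtained from the coloop extension of `M` by adding freely the points in a list
of labels. -/
noncomputable def partialCone (M : Matroid α) (l : List (α × Fin m)) :
    Matroid (FreeConePoint α m) :=
  l.foldl (fun N p => N.principalExt {FreeConePoint.tip, FreeConePoint.base p.1}
    (FreeConePoint.pt p.1 p.2)) (M.coloopExt m)

theorem partialCone_append (M : Matroid α) (l : List (α × Fin m)) (p : α × Fin m) :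
    M.partialCone (l ++ [p]) = (M.partialCone l).principalExt
      {FreeConePoint.tip, FreeConePoint.base p.1} (FreeConePoint.pt p.1 p.2) := by
  simp [partialCone]

theorem coloopExt_ground (M : Matroid α) :
    (M.coloopExt m).E = FreeConePoint.base '' M.E ∪ {FreeConePoint.tip} :=
  disjointSum_ground_eq (M := M.mapEmbedding (FreeConePoint.baseEmb α m))

theorem coloopExt_indep_iff (M : Matroid α) {I : Set (FreeConePoint α m)} :
    (M.coloopExt m).Indep I ↔
      (M.mapEmbedding (FreeConePoint.baseEmb α m)).Indep (I ∩ FreeConePoint.base '' M.E) ∧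
      (freeOn {FreeConePoint.tip}).Indep (I ∩ {FreeConePoint.tip}) ∧
      I ⊆ FreeConePoint.base '' M.E ∪ {FreeConePoint.tip} :=
  disjointSum_indep_iff (M := M.mapEmbedding (FreeConePoint.baseEmb α m))

theorem partialCone_ground (M : Matroid α) (l : List (α × Fin m)) :
    (M.partialCone l).E =
      {y | y = .tip ∨ (∃ x ∈ M.E, y = .base x) ∨ ∃ p ∈ l, y = .pt p.1 p.2} := by
  induction l using List.reverseRecOn with
  | nil =>
    rw [partialCone, List.foldl_nil, coloopExt_ground]
    ext y
    simp only [mem_union, mem_image, mem_singleton_iff, List.not_mem_nil, mem_ofPred_eq]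
    grind
  | append_singleton l p ih =>
    rw [partialCone_append, principalExt_ground, ih]
    ext y
    simp only [mem_insert_iff, mem_ofPred_eq, List.mem_append, List.mem_singleton]
    grind

theorem partialCone_ground_finite (M : Matroid α) [M.Finite] (l : List (α × Fin m)) :
    (M.partialCone l).E.Finite := by
  rw [partialCone_ground]
  have h1 : {y : FreeConePoint α m | ∃ p ∈ l, y = .pt p.1 p.2}.Finite :=
    ((List.finite_toSet l).image fun p => FreeConePoint.pt p.1 p.2).subset
      (by rintro _ ⟨p, hp, rfl⟩; exact ⟨p, hp, rfl⟩)
  have h2 : {y : FreeConePoint α m | ∃ x ∈ M.E, y = .base x}.Finite :=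
    (M.ground_finite.image FreeConePoint.base).subset
      (by rintro _ ⟨p, hp, rfl⟩; exact ⟨p, hp, rfl⟩)
  exact (finite_singleton _).union (h2.union h1)

/-- Without added points, base part and projection coincide and at most the tip is extra, so the
size condition follows from independence of the base part. -/
theorem partialCone_nil_indep_iff (M : Matroid α) [M.Finite] {I : Set (FreeConePoint α m)} :
    (M.partialCone []).Indep I ↔ I ⊆ (M.partialCone (m := m) []).E ∧ M.ConeIndep I := by
  by_cases hI : I ⊆ (M.partialCone (m := m) []).E
  swap
  · exact ⟨fun h => (hI h.subset_ground).elim, fun h => (hI h.1).elim⟩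
  have hfin := (M.partialCone_ground_finite []).subset hI
  have hbase : I ∩ FreeConePoint.base '' M.E = FreeConePoint.base '' coneBase I := by
    ext y
    constructor
    · rintro ⟨h1, x, -, rfl⟩
      exact ⟨x, h1, rfl⟩
    · rintro ⟨x, h1, rfl⟩
      refine ⟨h1, x, ?_, rfl⟩
      have := hI h1
      rw [partialCone_ground] at this
      simpa using this
  have hproj : coneProj I = coneBase I := by
    ext x
    rw [mem_coneProj, mem_coneBase, or_iff_left]
    rintro ⟨i, hi⟩
    have := hI hi
    rw [partialCone_ground] at this
    simp at this
  have hle : I.ncard ≤ (coneBase I).ncard + 1 := by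
    have h1 : I ⊆ insert .tip (FreeConePoint.base '' coneBase I) := by
      intro y hy
      have := hI hy
      rw [partialCone_ground] at this
      cases y with
      | tip => simp
      | base x => simpa using hy
      | pt x i => simp at this
    refine (ncard_le_ncard h1 ?_).trans ((ncard_insert_le _ _).trans ?_)
    · exact ((Finite.coneBase hfin).image _).insert _
    · rw [ncard_image_of_injective _ FreeConePoint.base_injective]
  have key : (M.partialCone []).Indep I ↔ M.Indep (coneBase I) := by
    rw [partialCone, List.foldl_nil] at hI ⊢
    rw [coloopExt_ground] at hI
    rw [coloopExt_indep_iff]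
    have h3 : (M.mapEmbedding (FreeConePoint.baseEmb α m)).Indep
        (I ∩ FreeConePoint.base '' M.E) ↔ M.Indep (coneBase I) := by
      rw [hbase, mapEmbedding_indep_iff]
      change M.Indep (FreeConePoint.base ⁻¹' _) ∧ _ ↔ _
      rw [preimage_image_eq _ FreeConePoint.base_injective]
      exact and_iff_left (image_subset_range _ _)
    exact ⟨fun h => h3.1 h.1, fun h => ⟨h3.2 h, freeOn_indep inter_subset_right, hI⟩⟩
  rw [key, ConeIndep, hproj]
  refine ⟨fun h => ⟨hI, h, ?_⟩, fun h => h.2.1⟩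
  rwa [(indep_iff_rk (Finite.coneBase hfin)).1 h]

/-- For an independent `J`, the new point may be added if and only if `J` does not span the line
through the tip and `e`. Testing the tip and `base e` with the inductive description shows that this
means `|J| ≤ r(proj J ∪ {e})`, which is the size bound for `J` with the new point. -/
theorem partialCone_step {M : Matroid α} [M.Finite] {N : Matroid (FreeConePoint α m)}
    (hfin : N.E.Finite) (hN : ∀ I, N.Indep I ↔ I ⊆ N.E ∧ M.ConeIndep I) {e : α} {i : Fin m}
    (he : .pt e i ∉ N.E) (htip : .tip ∈ N.E) (hbe : .base e ∈ N.E) (heM : e ∈ M.E)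
    (I : Set (FreeConePoint α m)) :
    (N.principalExt {.tip, .base e} (.pt e i)).Indep I ↔
      I ⊆ insert (.pt e i) N.E ∧ M.ConeIndep I := by
  rw [principalExt_indep_iff he]
  by_cases hI : I ⊆ insert (.pt e i) N.E
  swap
  · refine ⟨fun h => (hI fun y hy => ?_).elim, fun h => (hI h.1).elim⟩
    by_cases hye : y = .pt e i
    · exact .inl hye
    · exact .inr (h.1.subset_ground ⟨hy, hye⟩)
  by_cases hp : .pt e i ∈ I
  swap
  · rw [sdiff_singleton_eq_self hp, hN]
    simp only [hp, false_imp_iff, and_true, hI, true_and, and_iff_right_iff_imp]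
    exact fun _ y hy => (hI hy).resolve_left fun h => hp (h ▸ hy)
  obtain ⟨J, hJ, rfl⟩ : ∃ J, .pt e i ∉ J ∧ I = insert (.pt e i) J :=
    ⟨I \ {.pt e i}, by simp, by simp [insert_eq_of_mem hp]⟩
  have hJE : J ⊆ N.E := fun y hy =>
    (hI (mem_insert_of_mem _ hy)).resolve_left fun h => hJ (h ▸ hy)
  have hJfin := hfin.subset hJE
  simp only [mem_insert_iff, true_or, true_imp_iff, insert_sdiff_self_of_notMem hJ, hI, true_and]
  have hcard : (insert (.pt e i) J).ncard = J.ncard + 1 := ncard_insert_of_notMem hJ hJfin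
  rw [ConeIndep, hcard, coneBase_insert_pt, coneProj_insert_pt, Nat.add_le_add_iff_right]
  have hmono : M.rk (coneProj J) ≤ M.rk (insert e (coneProj J)) := M.rk_mono (subset_insert _ _)
  have hins := M.rk_insert_le e (coneProj J)
  constructor
  · rintro ⟨hJi, hcl⟩
    have hJc := (hN J).1 hJi
    refine ⟨hJc.2.1, ?_⟩
    -- If the bound fails, neither the tip nor `base e` fits into `J` (unless already there), so `J`
    -- spans the whole line.
    by_contra! hlt
    refine hcl (pair_subset ?_ ?_)
    · rw [hJi.mem_closure_iff']
      refine ⟨htip, fun h => by_contra fun htJ => ?_⟩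
      have := ((hN _).1 h).2.2
      rw [ncard_insert_of_notMem htJ hJfin, coneProj_insert_tip] at this
      omega
    · rw [hJi.mem_closure_iff']
      refine ⟨hbe, fun h => by_contra fun htJ => ?_⟩
      have := ((hN _).1 h).2.2
      rw [ncard_insert_of_notMem htJ hJfin, coneProj_insert_base] at this
      omega
  · rintro ⟨hB, hle⟩
    have hJi : N.Indep J := (hN J).2 ⟨hJE, hB, by omega⟩
    refine ⟨hJi, fun hcl => ?_⟩
    have h1 := hcl (mem_insert _ _)
    have h2 := hcl (mem_insert_of_mem _ rfl)
    rw [hJi.mem_closure_iff'] at h1 h2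
    -- If there is room already in `proj J`, the tip is unspanned. Otherwise `e` must raise the rank
    -- of the projection, and `base e` is unspanned.
    by_cases hlt : J.ncard ≤ M.rk (coneProj J)
    · have htJ : .tip ∉ J := fun h => by
        have := rk_coneProj_add_one_le M hJfin h
        omega
      refine htJ (h1.2 ((hN _).2 ⟨insert_subset htip hJE, by simpa using hB, ?_⟩))
      rw [ncard_insert_of_notMem htJ hJfin, coneProj_insert_tip]
      omega
    · have hecl : e ∉ M.closure (coneProj J) := fun h => by
        rw [rk_insert_eq h] at hle
        omega
      have heJ : .base e ∉ J := fun h => hecl (M.mem_closure_of_mem' (.inl h) heM)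
      refine heJ (h2.2 ((hN _).2 ⟨insert_subset hbe hJE, ?_, ?_⟩))
      · rw [coneBase_insert_base]
        exact ((hB.notMem_closure_iff heM).1 fun h => hecl
          (M.closure_subset_closure (coneBase_subset_coneProj J) h)).1
      · rw [ncard_insert_of_notMem heJ hJfin, coneProj_insert_base]
        omega

/-- The description on the right mentions the list only through the ground set, so the order of the
extensions is immaterial. `Nodup` ensures that each extension adds a genuinely new element. -/
theorem partialCone_indep_iff (M : Matroid α) [M.Finite] (l : List (α × Fin m))
    (hl : l.Nodup) (hlE : ∀ p ∈ l, p.1 ∈ M.E) (I : Set (FreeConePoint α m)) :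
    (M.partialCone l).Indep I ↔ I ⊆ (M.partialCone l).E ∧ M.ConeIndep I := by
  induction l using List.reverseRecOn generalizing I with
  | nil => exact M.partialCone_nil_indep_iff
  | append_singleton l p ih =>
    rw [List.nodup_append] at hl
    have hpE := hlE p (by simp)
    rw [partialCone_append, principalExt_ground]
    refine partialCone_step (M.partialCone_ground_finite l)
      (ih hl.1 fun q hq => hlE q (by simp [hq])) ?_ ?_ ?_ hpE I
    · rw [partialCone_ground]
      simp only [mem_ofPred_eq, reduceCtorEq, false_or, not_or, not_exists, not_and]
      refine ⟨fun x _ h => h, fun q hq h => ?_⟩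
      have : p = q := Prod.ext (FreeConePoint.pt.inj h).1 (FreeConePoint.pt.inj h).2
      exact hl.2.2 q hq p (by simp) this.symm
    · simp [partialCone_ground]
    · simp [partialCone_ground, hpE]

theorem freeCone_ground (M : Matroid α) [M.Finite] :
    (M.freeCone m).E = {y | y = .tip ∨ (∃ x ∈ M.E, y = .base x) ∨
      ∃ x ∈ M.E, ∃ i, y = .pt x i} := by
  change (M.partialCone _).E = _
  rw [partialCone_ground]
  ext y
  simp

@[simp] theorem tip_mem_freeCone (M : Matroid α) [M.Finite] : .tip ∈ (M.freeCone m).E := by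
  simp [freeCone_ground]

@[simp] theorem base_mem_freeCone (M : Matroid α) [M.Finite] {x : α} :
    .base x ∈ (M.freeCone m).E ↔ x ∈ M.E := by
  simp [freeCone_ground]

@[simp] theorem pt_mem_freeCone (M : Matroid α) [M.Finite] {x : α} {i : Fin m} :
    .pt x i ∈ (M.freeCone m).E ↔ x ∈ M.E := by
  simp [freeCone_ground]

instance freeCone_finite (M : Matroid α) [M.Finite] : (M.freeCone m).Finite :=
  ⟨M.partialCone_ground_finite _⟩

theorem freeCone_indep_iff (M : Matroid α) [M.Finite] {I : Set (FreeConePoint α m)} :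
    (M.freeCone m).Indep I ↔ I ⊆ (M.freeCone m).E ∧ M.Indep (coneBase I) ∧
      I.ncard ≤ M.rk (coneProj I) + 1 :=
  M.partialCone_indep_iff _ (Finset.nodup_toList _) (by simp) I

theorem coneProj_subset_ground (M : Matroid α) [M.Finite] {Y : Set (FreeConePoint α m)}
    (hY : Y ⊆ (M.freeCone m).E) : coneProj Y ⊆ M.E := by
  rintro x (hx | ⟨i, hi⟩)
  · simpa using hY hx
  · simpa using hY hi

end ConeIndep

end Matroid

namespace Matroid

/-! ### The rank function of the free cone -/

section ConeRank

variable {α : Type u} {m : ℕ}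

theorem IsBasis.ncard_eq_rk {M : Matroid α} {I X : Set α} (h : M.IsBasis I X) :
    I.ncard = M.rk X := by
  rw [rk, ← h.encard_eq_eRk, ncard]

theorem exists_notMem_closure_of_rk_lt {M : Matroid α} [M.RankFinite] {X Y : Set α}
    (h : M.rk X < M.rk Y) : ∃ y ∈ Y, y ∉ M.closure X := by
  by_contra! hc
  have := M.rk_mono (show Y ⊆ M.closure X from hc)
  rw [rk_closure] at this
  omega

variable (M : Matroid α) [M.Finite]

/-- By maximality of `I`, one of the two independence conditions fails for `I ∪ {y}`; if the base
part stays independent, it must be the size bound. -/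
theorem freeCone_indep_insert {I Y : Set (FreeConePoint α m)} {y : FreeConePoint α m}
    (hY : Y ⊆ (M.freeCone m).E) (hI : (M.freeCone m).IsBasis I Y) (hy : y ∈ Y) (hyI : y ∉ I)
    (h1 : M.Indep (coneBase (insert y I))) :
    M.rk (coneProj (insert y I)) + 1 ≤ I.ncard := by
  by_contra! hlt
  have hIfin := (M.freeCone m).ground_finite.subset (hI.subset.trans hY)
  refine hyI (hI.mem_of_insert_indep hy ((freeCone_indep_iff M).2
    ⟨insert_subset (hY hy) (hI.subset.trans hY), h1, ?_⟩))
  rw [ncard_insert_of_notMem hyI hIfin]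
  omega

/-- The hypothesis says that `I` attains the size bound. An element of `Y` projecting outside the
closure of `proj I` would raise the bound by one and so could be added. -/
theorem rk_coneProj_le_of_isBasis {I Y : Set (FreeConePoint α m)}
    (hY : Y ⊆ (M.freeCone m).E) (hI : (M.freeCone m).IsBasis I Y)
    (h : M.rk (coneProj I) < I.ncard) : M.rk (coneProj Y) ≤ M.rk (coneProj I) := by
  by_contra! hlt
  obtain ⟨x, hx, hxI⟩ := exists_notMem_closure_of_rk_lt hlt
  have hIi := ((freeCone_indep_iff M).1 hI.indep)
  have hxE : x ∈ M.E := M.coneProj_subset_ground hY hx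
  have hxp : x ∉ coneProj I := fun h => hxI (M.mem_closure_of_mem' h hxE)
  have hrk := rk_insert_eq_add_one hxE hxI
  obtain hx | ⟨i, hx⟩ := hx
  · have h1 := M.freeCone_indep_insert hY hI hx (fun h => hxp (.inl h)) (by
      rw [coneBase_insert_base]
      exact ((hIi.2.1.notMem_closure_iff hxE).1 fun h => hxI
        (M.closure_subset_closure (coneBase_subset_coneProj I) h)).1)
    rw [coneProj_insert_base] at h1
    omega
  · have h1 := M.freeCone_indep_insert hY hI hx (fun h => hxp (.inr ⟨i, h⟩)) (by
      rw [coneBase_insert_pt]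
      exact hIi.2.1)
    rw [coneProj_insert_pt] at h1
    omega

/-- A basis below the size bound could be enlarged by the tip, which changes neither its base part
nor its projection. -/
theorem freeCone_rk_of_tip_mem {Y : Set (FreeConePoint α m)} (hY : Y ⊆ (M.freeCone m).E)
    (h : .tip ∈ Y) : (M.freeCone m).rk Y = M.rk (coneProj Y) + 1 := by
  obtain ⟨I, hI⟩ := (M.freeCone m).exists_isBasis Y
  have hIfin := (M.freeCone m).ground_finite.subset (hI.subset.trans hY)
  have hIi := ((freeCone_indep_iff M).1 hI.indep)
  have hmono := M.rk_mono (coneProj_mono hI.subset)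
  rw [← hI.ncard_eq_rk]
  by_cases hlt : M.rk (coneProj I) < I.ncard
  · have := M.rk_coneProj_le_of_isBasis hY hI hlt
    omega
  · have htI : .tip ∉ I := fun h => by
      have := rk_coneProj_add_one_le M hIfin h
      omega
    have h1 := M.freeCone_indep_insert hY hI h htI (by simpa using hIi.2.1)
    rw [coneProj_insert_tip] at h1
    omega

/-- A basis of `Y` either attains the size bound, and then its projection spans `proj Y`, or it has
room left. In the latter case it contains every added point of `Y`, and its base part spans that of
`Y`. -/
theorem freeCone_rk_of_tip_notMem {Y : Set (FreeConePoint α m)} (hY : Y ⊆ (M.freeCone m).E)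
    (h : .tip ∉ Y) : (M.freeCone m).rk Y =
      min (M.rk (coneBase Y) + (conePts Y).ncard) (M.rk (coneProj Y) + 1) := by
  obtain ⟨I, hI⟩ := (M.freeCone m).exists_isBasis Y
  have hYfin := (M.freeCone m).ground_finite.subset hY
  have hIfin := hYfin.subset hI.subset
  have hIi := ((freeCone_indep_iff M).1 hI.indep)
  have hmono := M.rk_mono (coneProj_mono hI.subset)
  have hmono' := M.rk_mono (coneBase_mono hI.subset)
  have hcard := ncard_eq_of_tip_notMem hIfin fun h' => h (hI.subset h')
  have hpts : conePts I ⊆ conePts Y := fun y hy => ⟨hI.subset hy.1, hy.2⟩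
  have hptsfin : (conePts Y).Finite := hYfin.subset fun y hy => hy.1
  have hle := ncard_le_ncard hpts hptsfin
  rw [← (indep_iff_rk (Finite.coneBase hIfin)).1 hIi.2.1] at hcard
  rw [← hI.ncard_eq_rk]
  by_cases hlt : M.rk (coneProj I) < I.ncard
  · have := M.rk_coneProj_le_of_isBasis hY hI hlt
    omega
  · have h1 : conePts I = conePts Y := by
      refine hpts.antisymm ?_
      rintro _ ⟨hy, x, i, rfl⟩
      by_contra hyI
      have h1 := M.freeCone_indep_insert hY hI hy (fun h => hyI ⟨h, x, i, rfl⟩)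
        (by simpa using hIi.2.1)
      have h2 := M.rk_mono (coneProj_mono (subset_insert (.pt x i) I))
      omega
    have h2 : M.rk (coneBase Y) ≤ M.rk (coneBase I) := by
      by_contra! hlt'
      obtain ⟨x, hx, hxI⟩ := exists_notMem_closure_of_rk_lt hlt'
      have hxE : x ∈ M.E := M.coneProj_subset_ground hY (.inl hx)
      have hins := (hIi.2.1.notMem_closure_iff hxE).1 hxI
      have h1 := M.freeCone_indep_insert hY hI hx hins.2
        (by rw [coneBase_insert_base]; exact hins.1)
      have h2 := M.rk_mono (coneProj_mono (subset_insert (.base x) I))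
      omega
    rw [h1] at hcard
    omega

end ConeRank

/-! ### Cyclic flats of the free cone -/

section Cone

variable {α : Type u} {m : ℕ}

/-- The union of the lines spanned by the tip and the elements of `X`. -/
def cone (m : ℕ) (X : Set α) : Set (FreeConePoint α m) :=
  {y | y = .tip ∨ (∃ x ∈ X, y = .base x) ∨ ∃ x ∈ X, ∃ i, y = .pt x i}

@[simp] theorem tip_mem_cone (X : Set α) : .tip ∈ cone m X := .inl rfl

@[simp] theorem base_mem_cone {X : Set α} {x : α} : .base x ∈ cone m X ↔ x ∈ X := by
  simp [cone]

@[simp] theorem pt_mem_cone {X : Set α} {x : α} {i : Fin m} : .pt x i ∈ cone m X ↔ x ∈ X := by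
  simp [cone]

@[simp] theorem coneProj_cone (X : Set α) : coneProj (cone m X) = X := by
  ext x
  simp [mem_coneProj]

theorem cone_subset_cone {X Y : Set α} : cone m X ⊆ cone m Y ↔ X ⊆ Y := by
  refine ⟨fun h x hx => by simpa using h (base_mem_cone.2 hx), fun h y hy => ?_⟩
  cases y with
  | tip => simp
  | base x => simpa using h (by simpa using hy)
  | pt x i => simpa using h (by simpa using hy)

theorem subset_cone_coneProj (Y : Set (FreeConePoint α m)) : Y ⊆ cone m (coneProj Y) := by
  intro y hy
  cases y with
  | tip => simp
  | base x => exact base_mem_cone.2 (.inl hy)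
  | pt x i => exact pt_mem_cone.2 (.inr ⟨i, hy⟩)

theorem image_base_subset_cone {X Y : Set α} :
    FreeConePoint.base '' X ⊆ cone m Y ↔ X ⊆ Y := by
  simp [subset_def]

theorem ncard_cone {X : Set α} (hX : X.Finite) : (cone m X).ncard = 1 + (m + 1) * X.ncard := by
  have h1 : cone m X = insert .tip (FreeConePoint.base '' X ∪
      (fun p : α × Fin m => FreeConePoint.pt p.1 p.2) '' (X ×ˢ univ)) := by
    ext y
    cases y <;> simp
  have hp : (X ×ˢ (univ : Set (Fin m))).Finite := hX.prod finite_univ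
  have hinj : Function.Injective (fun p : α × Fin m => FreeConePoint.pt p.1 p.2) := fun p q h =>
    Prod.ext (FreeConePoint.pt.inj h).1 (FreeConePoint.pt.inj h).2
  rw [h1, ncard_insert_of_notMem (by simp) ((hX.image _).union (hp.image _)),
    ncard_union_eq ?_ (hX.image _) (hp.image _),
    ncard_image_of_injective _ FreeConePoint.base_injective, ncard_image_of_injective _ hinj,
    ncard_prod]
  · simp only [ncard_univ, Nat.card_fin]
    ring
  · rw [disjoint_left]
    rintro _ ⟨x, -, rfl⟩ ⟨p, -, h⟩
    cases h

variable (M : Matroid α) [M.Finite]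

theorem freeCone_ground_eq_cone : (M.freeCone m).E = cone m M.E := freeCone_ground M

variable {M}

theorem freeCone_rk_cone {X : Set α} (hX : X ⊆ M.E) :
    (M.freeCone m).rk (cone m X) = M.rk X + 1 := by
  rw [freeCone_rk_of_tip_mem _ _ (tip_mem_cone X), coneProj_cone]
  rw [freeCone_ground_eq_cone]
  exact cone_subset_cone.2 hX

theorem image_base_subset_freeCone {X : Set α} (hX : X ⊆ M.E) :
    FreeConePoint.base '' X ⊆ (M.freeCone m).E := by
  rw [freeCone_ground_eq_cone]
  exact image_base_subset_cone.2 hX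

theorem freeCone_rk_image_base {X : Set α} (hX : X ⊆ M.E) :
    (M.freeCone m).rk (FreeConePoint.base '' X) = M.rk X := by
  rw [freeCone_rk_of_tip_notMem _ (image_base_subset_freeCone hX) (by simp)]
  simp

theorem freeCone_rk_insert_tip {Y : Set (FreeConePoint α m)} (hY : Y ⊆ (M.freeCone m).E) :
    (M.freeCone m).rk (insert .tip Y) = M.rk (coneProj Y) + 1 := by
  rw [freeCone_rk_of_tip_mem _ (insert_subset (tip_mem_freeCone M) hY) (mem_insert _ _),
    coneProj_insert_tip]

/-- Positivity of `m` makes the cone cyclic: an added point on the same line replaces a deleted base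
element in the projection, and an added point also keeps the rank up when the tip is deleted. -/
theorem isCyclicFlat_cone (hm : 0 < m) {X : Set α} (hX : M.IsFlat X) (hne : X.Nonempty) :
    (M.freeCone m).IsCyclicFlat (cone m X) := by
  have hXE : cone m X ⊆ (M.freeCone m).E := by
    rw [freeCone_ground_eq_cone]
    exact cone_subset_cone.2 hX.subset_ground
  have hrk := freeCone_rk_cone (m := m) hX.subset_ground
  have hins : ∀ x ∈ M.E, x ∉ X → M.rk X < M.rk (insert x X) := fun x =>
    (isFlat_iff_rk hX.subset_ground).1 hX x
  rw [isCyclicFlat_iff_rk, isFlat_iff_rk hXE]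
  constructor
  · intro y hy hyX
    rw [hrk, freeCone_rk_of_tip_mem _ (insert_subset hy hXE) (.inr (tip_mem_cone X))]
    cases y with
    | tip => simp at hyX
    | base x => simpa using hins x (by simpa using hy) (by simpa using hyX)
    | pt x i => simpa using hins x (by simpa using hy) (by simpa using hyX)
  · intro y hy
    have hsub : cone m X \ {y} ⊆ (M.freeCone m).E := sdiff_subset.trans hXE
    have hproj : coneProj (cone m X \ {y}) = X := by
      refine ((coneProj_mono sdiff_subset).trans (coneProj_cone X).subset).antisymm
        fun x hx => ?_
      by_cases hyx : y = .base x
      · exact .inr ⟨⟨0, hm⟩, by simpa using hx, by simp [hyx]⟩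
      · exact .inl ⟨by simpa using hx, fun h => hyx h.symm⟩
    by_cases hyt : y = .tip
    · subst hyt
      rw [hrk, freeCone_rk_of_tip_notMem _ hsub (by simp), hproj, min_eq_right]
      have hb : coneBase (cone m X \ {.tip}) = X := by ext; simp
      have hp : 1 ≤ (conePts (cone m X \ {.tip})).ncard := by
        obtain ⟨x, hx⟩ := hne
        refine (ncard_pos ((M.freeCone m).ground_finite.subset fun y hy => hsub hy.1)).2 ?_
        exact ⟨.pt x ⟨0, hm⟩, ⟨by simpa using hx, by simp⟩, _, _, rfl⟩
      rw [hb]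
      omega
    · rw [hrk, freeCone_rk_of_tip_mem _ hsub ⟨tip_mem_cone X, fun h => hyt h.symm⟩, hproj]

theorem isCyclicFlat_image_base {Z : Set α} (hZ : M.IsCyclicFlat Z) :
    (M.freeCone m).IsCyclicFlat (FreeConePoint.base '' Z) := by
  rw [isCyclicFlat_iff_rk] at hZ
  have hZE := hZ.1.subset_ground
  have hZE' := image_base_subset_freeCone (m := m) hZE
  rw [isCyclicFlat_iff_rk, isFlat_iff_rk hZE']
  constructor
  · intro y hy hyZ
    have hins : ∀ x ∈ M.E, x ∉ Z → M.rk Z < M.rk (insert x Z) := fun x =>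
      (isFlat_iff_rk hZE).1 hZ.1 x
    rw [freeCone_rk_image_base hZE]
    cases y with
    | tip =>
      rw [freeCone_rk_insert_tip hZE']
      simp
    | base x =>
      rw [← image_insert_eq, freeCone_rk_image_base (insert_subset (by simpa using hy) hZE)]
      exact hins x (by simpa using hy) (by simpa using hyZ)
    | pt x i =>
      rw [freeCone_rk_of_tip_notMem _ (insert_subset hy hZE') (by simp)]
      have := M.rk_mono (subset_insert x Z)
      simp only [coneBase_insert_pt, coneBase_image_base, conePts_insert_pt, conePts_image_base,
        insert_empty_eq, ncard_singleton, coneProj_insert_pt, coneProj_image_base]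
      omega
  · rintro _ ⟨x, hx, rfl⟩
    rw [← image_singleton, ← image_sdiff FreeConePoint.base_injective, freeCone_rk_image_base hZE,
      freeCone_rk_image_base (sdiff_subset.trans hZE)]
    exact hZ.2 x hx

/-- The cyclic flats of the free cone are the cones over nonempty flats and the cyclic flats of the
original matroid. -/
theorem IsCyclicFlat.freeCone_cases {F : Set (FreeConePoint α m)}
    (hF : (M.freeCone m).IsCyclicFlat F) :
    (∃ X, M.IsFlat X ∧ X.Nonempty ∧ F = cone m X) ∨
      ∃ Z, M.IsCyclicFlat Z ∧ F = FreeConePoint.base '' Z := by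
  rw [isCyclicFlat_iff_rk] at hF
  obtain ⟨hF, hcyc⟩ := hF
  have hFE := hF.subset_ground
  rw [isFlat_iff_rk hFE] at hF
  have hpE := M.coneProj_subset_ground hFE
  by_cases ht : .tip ∈ F
  · left
    have hrk := freeCone_rk_of_tip_mem M hFE ht
    have hFeq : F = cone m (coneProj F) := by
      refine (subset_cone_coneProj F).antisymm fun y hy => ?_
      by_contra hyF
      have hyE : y ∈ (M.freeCone m).E := by
        rw [freeCone_ground_eq_cone]
        exact cone_subset_cone.2 hpE hy
      have h1 := hF y hyE hyF
      rw [hrk, freeCone_rk_of_tip_mem M (insert_subset hyE hFE) (.inr ht)] at h1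
      cases y with
      | tip => exact hyF ht
      | base x =>
        rw [base_mem_cone] at hy
        simp [insert_eq_of_mem hy] at h1
      | pt x i =>
        rw [pt_mem_cone] at hy
        simp [insert_eq_of_mem hy] at h1
    refine ⟨coneProj F, ?_, ?_, hFeq⟩
    · rw [isFlat_iff_rk hpE]
      intro x hx hxF
      have hxE : .base x ∈ (M.freeCone m).E := by simpa using hx
      have h1 := hF (.base x) hxE fun h => hxF (.inl h)
      rw [hrk, freeCone_rk_of_tip_mem M (insert_subset hxE hFE) (.inr ht)] at h1
      simpa using h1
    -- With empty projection `F` would be `{tip}`, whose rank drops when the tip is deleted.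
    · rw [nonempty_iff_ne_empty]
      intro he
      have h1 := hcyc _ ht
      have h2 : F \ {.tip} = ∅ := by
        rw [sdiff_eq_empty]
        intro y hy
        have h3 := hFeq.subset hy
        rw [he] at h3
        simpa [cone] using h3
      rw [h2, hrk] at h1
      simp at h1
  · right
    have hrk := freeCone_rk_of_tip_notMem M hFE ht
    -- The flat `F` does not span the tip, so the minimum in the rank formula is its first term,
    -- strictly below the second.
    have hbal := hF _ (tip_mem_freeCone M) ht
    rw [freeCone_rk_insert_tip hFE, hrk] at hbal
    have hle : M.rk (coneBase F) + (conePts F).ncard ≤ M.rk (coneProj F) := by omega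
    have hFfin := (M.freeCone m).ground_finite.subset hFE
    -- Deleting an added point would lower that first term by one, which cyclicity forbids.
    have hpts : conePts F = ∅ := by
      by_contra hne
      obtain ⟨y, hyF, x, i, rfl⟩ := nonempty_iff_ne_empty.2 hne
      have h1 := hcyc _ hyF
      have hfin : (conePts F).Finite := hFfin.subset fun y hy => hy.1
      have h2 : conePts (F \ {.pt x i}) = conePts F \ {.pt x i} := by
        ext z
        simp only [conePts, mem_sdiff, mem_ofPred_eq]
        tauto
      have h3 : (conePts F \ {.pt x i}).ncard + 1 = (conePts F).ncard :=
        ncard_sdiff_singleton_add_one ⟨hyF, x, i, rfl⟩ hfin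
      have h4 := M.rk_mono (coneBase_mono (sdiff_subset (s := F) (t := {.pt x i})))
      rw [hrk, freeCone_rk_of_tip_notMem M (sdiff_subset.trans hFE) (fun h => ht h.1), h2] at h1
      omega
    have hFeq := eq_image_base_union_conePts ht
    rw [hpts, union_empty] at hFeq
    have hbE : coneBase F ⊆ M.E := (coneBase_subset_coneProj F).trans hpE
    have hrk' : (M.freeCone m).rk F = M.rk (coneBase F) := by
      conv_lhs => rw [hFeq]
      exact freeCone_rk_image_base hbE
    refine ⟨coneBase F, isCyclicFlat_iff_rk.2 ⟨?_, ?_⟩, hFeq⟩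
    · rw [isFlat_iff_rk hbE]
      intro x hx hxF
      have h1 := hF (.base x) (by simpa using hx) hxF
      rwa [hrk', hFeq, coneBase_image_base, ← image_insert_eq,
        freeCone_rk_image_base (insert_subset hx hbE)] at h1
    · intro x hx
      have h1 := hcyc (.base x) hx
      rwa [hrk', hFeq, coneBase_image_base, ← image_singleton,
        ← image_sdiff FreeConePoint.base_injective,
        freeCone_rk_image_base (sdiff_subset.trans hbE)] at h1

end Cone

end Matroid

set_option linter.unusedSectionVars false

namespace Matroid

/-! ### Parallel classes -/

section ParallelClasses

variable {α : Type u} {M : Matroid α}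

theorem ncard_biUnion_finset {ι : Type u} {β : Type v} (s : Finset ι) (f : ι → Set β)
    (hfin : ∀ i ∈ s, (f i).Finite) (hd : ∀ i ∈ s, ∀ j ∈ s, i ≠ j → Disjoint (f i) (f j)) :
    (⋃ i ∈ s, f i).ncard = ∑ i ∈ s, (f i).ncard := by
  rw [← finsum_mem_coe_finset, ← Finite.ncard_biUnion s.finite_toSet hfin
    fun i hi j hj hij => hd i hi j hj hij]
  simp

open scoped Classical in
/-- The closures of the elements of `X`. -/
noncomputable def pointClosures (M : Matroid α) [M.Finite] (X : Set α) : Finset (Set α) :=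
  (M.ground_finite.subset (inter_subset_right (s := X))).toFinset.image fun e => M.closure {e}

theorem mem_pointClosures [M.Finite] {X ℓ : Set α} (hX : X ⊆ M.E) :
    ℓ ∈ M.pointClosures X ↔ ∃ e ∈ X, M.closure {e} = ℓ := by
  simp [pointClosures, inter_eq_self_of_subset_left hX]

theorem exists_notMem_closure_of_ncard_lt [M.RankFinite] {X : Set α} (hX : X.Finite) (h : X.ncard < M.rk M.E) :
    ∃ y ∈ M.E, y ∉ M.closure X :=
  exists_notMem_closure_of_rk_lt ((M.rk_le_ncard hX).trans_lt h)

variable [M.Loopless]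

theorem disjoint_closure_singleton {e f : α} (h : M.closure {e} ≠ M.closure {f}) :
    Disjoint (M.closure {e}) (M.closure {f}) := by
  rw [disjoint_left]
  intro x hx hx'
  exact h ((closure_singleton_eq_of_mem hx).symm.trans (closure_singleton_eq_of_mem hx'))

/-- In a loopless matroid the closures of single elements are the parallel classes, and they
partition every flat. -/
theorem sum_ncard_pointClosures [M.Finite] {X : Set α} (hX : M.IsFlat X) :
    ∑ ℓ ∈ M.pointClosures X, ℓ.ncard = X.ncard := by
  have hXE := hX.subset_ground
  rw [← ncard_biUnion_finset]
  · congr 1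
    ext x
    simp only [mem_iUnion, mem_pointClosures hXE, exists_prop]
    constructor
    · rintro ⟨_, ⟨e, he, rfl⟩, hx⟩
      exact hX.closure_singleton_subset he hx
    · exact fun hx => ⟨_, ⟨x, hx, rfl⟩, M.mem_closure_self x (hXE hx)⟩
  · intro ℓ hℓ
    obtain ⟨e, -, rfl⟩ := (mem_pointClosures hXE).1 hℓ
    exact M.ground_finite.subset (M.closure_subset_ground _)
  · intro ℓ hℓ ℓ' hℓ' hne
    obtain ⟨e, -, rfl⟩ := (mem_pointClosures hXE).1 hℓ
    obtain ⟨f, -, rfl⟩ := (mem_pointClosures hXE).1 hℓ'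
    exact disjoint_closure_singleton hne

theorem one_le_ncard_closure_singleton [M.Finite] {e : α} (he : e ∈ M.E) :
    1 ≤ (M.closure {e}).ncard :=
  (ncard_pos (M.ground_finite.subset (M.closure_subset_ground _))).2
    ⟨e, M.mem_closure_self e he⟩

end ParallelClasses

/-- The data of a matroid `N` that has the same configuration as the free `m`-cone of `M`:
the cyclic flat `D X` of `N` corresponds to the cone over `X`, and the cyclic flat `U Z` of `N`
corresponds to the cyclic flat `Z` of `M`. -/
structure ConeConfig {α : Type u} {β : Type v} (M : Matroid α) (m : ℕ) (N : Matroid β) where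
  D : Set α → Set β
  U : Set α → Set β
  D_cyc : ∀ X, M.IsFlat X → X.Nonempty → N.IsCyclicFlat (D X)
  U_cyc : ∀ Z, M.IsCyclicFlat Z → N.IsCyclicFlat (U Z)
  D_ncard : ∀ X, M.IsFlat X → X.Nonempty → (D X).ncard = 1 + (m + 1) * X.ncard
  U_ncard : ∀ Z, M.IsCyclicFlat Z → (U Z).ncard = Z.ncard
  D_rk : ∀ X, M.IsFlat X → X.Nonempty → N.rk (D X) = M.rk X + 1
  U_rk : ∀ Z, M.IsCyclicFlat Z → N.rk (U Z) = M.rk Z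
  D_sub : ∀ X Y, M.IsFlat X → X.Nonempty → M.IsFlat Y → Y.Nonempty → (D X ⊆ D Y ↔ X ⊆ Y)
  U_sub : ∀ Z W, M.IsCyclicFlat Z → M.IsCyclicFlat W → (U Z ⊆ U W ↔ Z ⊆ W)
  UD_sub : ∀ Z X, M.IsCyclicFlat Z → M.IsFlat X → X.Nonempty → (U Z ⊆ D X ↔ Z ⊆ X)
  DU_sub : ∀ X Z, M.IsFlat X → X.Nonempty → M.IsCyclicFlat Z → ¬ D X ⊆ U Z
  cases : ∀ F, N.IsCyclicFlat F →
    (∃ X, M.IsFlat X ∧ X.Nonempty ∧ F = D X) ∨ ∃ Z, M.IsCyclicFlat Z ∧ F = U Z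
  ground : N.E.ncard = 1 + (m + 1) * M.E.ncard

/-! ### Finding the tip in a matroid with the configuration of a cone -/

namespace ConeConfig

variable {α : Type u} {β : Type v} {M : Matroid α} {m : ℕ} {N : Matroid β} [M.Finite] [N.Finite]
  [M.Loopless] (c : ConeConfig M m N)

/-- The line of `N` that corresponds to the cone over an element of `M`. -/
def L (e : α) : Set β := c.D (M.closure {e})

include c in
-- The set of loops is a cyclic flat of rank zero. Every `D X` has positive rank, so it is some `U
-- Z` with `r(Z) = 0`; then `Z` is empty, and so is `U Z`.
theorem loopless : N.Loopless := by
  have hcyc : N.IsCyclicFlat (N.closure ∅) := by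
    rw [isCyclicFlat_iff_rk]
    refine ⟨isFlat_closure _, fun x hx => ?_⟩
    have := N.rk_mono (sdiff_subset (s := N.closure ∅) (t := {x}))
    rw [rk_closure, rk_empty] at this ⊢
    omega
  have hrk : N.rk (N.closure ∅) = 0 := by simp
  obtain ⟨X, hX, hne, h⟩ | ⟨Z, hZ, h⟩ := c.cases _ hcyc
  · rw [h, c.D_rk X hX hne] at hrk
    omega
  · rw [h, c.U_rk Z hZ] at hrk
    have hZ0 : Z = ∅ := by
      by_contra hne
      obtain ⟨x, hx⟩ := nonempty_iff_ne_empty.2 hne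
      have := M.rk_pos (hZ.1.subset_ground hx) hx
      omega
    have h1 := c.U_ncard Z hZ
    rw [← h, hZ0, ncard_empty, ncard_eq_zero
      (N.ground_finite.subset (N.closure_subset_ground _))] at h1
    exact ⟨h1⟩

variable {c}

theorem flat_closure_singleton {e : α} (he : e ∈ M.E) :
    M.IsFlat (M.closure {e}) ∧ (M.closure {e}).Nonempty :=
  ⟨isFlat_closure _, e, M.mem_closure_self e he⟩

theorem L_isFlat {e : α} (he : e ∈ M.E) : N.IsFlat (c.L e) :=
  (c.D_cyc _ (flat_closure_singleton he).1 (flat_closure_singleton he).2).1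

theorem L_rk {e : α} (he : e ∈ M.E) : N.rk (c.L e) = 2 := by
  rw [L, c.D_rk _ (flat_closure_singleton he).1 (flat_closure_singleton he).2, rk_closure,
    rk_singleton he]

theorem L_ncard {e : α} (he : e ∈ M.E) :
    (c.L e).ncard = 1 + (m + 1) * (M.closure {e}).ncard :=
  c.D_ncard _ (flat_closure_singleton he).1 (flat_closure_singleton he).2

theorem L_finite {e : α} (he : e ∈ M.E) : (c.L e).Finite :=
  N.ground_finite.subset (L_isFlat he).subset_ground

theorem L_subset_D {e : α} {X : Set α} (hX : M.IsFlat X) (he : e ∈ X) : c.L e ⊆ c.D X := by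
  have h := flat_closure_singleton (hX.subset_ground he)
  exact (c.D_sub _ _ h.1 h.2 hX ⟨e, he⟩).2 (hX.closure_singleton_subset he)

theorem L_congr {e f : α} (h : M.closure {e} = M.closure {f}) : c.L e = c.L f := by
  rw [L, L, h]

/-- Two distinct elements of `N` that are parallel span a cyclic flat that comes from a parallel
class of `M`. -/
theorem exists_closure_pair_eq {y z : β} (hy : y ∈ N.E) (hz : z ∈ N.E) (hne : y ≠ z)
    (hr : N.rk {y, z} ≤ 1) :
    ∃ x ∈ M.E, M.IsCyclicFlat (M.closure {x}) ∧ N.closure {y, z} = c.U (M.closure {x}) := by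
  have := c.loopless
  have hE : {y, z} ⊆ N.E := pair_subset hy hz
  have hdep : ¬ N.Indep {y, z} := by
    rw [indep_iff_rk (toFinite _), ncard_pair hne]
    omega
  obtain ⟨C, hCs, hC⟩ := ((not_indep_iff hE).1 hdep).exists_isCircuit_subset
  have hCn : 2 ≤ C.ncard := by
    have := loopless_iff_forall_isCircuit.1 this C hC
    have := ((toFinite {y, z}).subset hCs).to_subtype
    exact one_lt_ncard_iff_nontrivial.2 ‹_›
  have hCeq : C = {y, z} := eq_of_subset_of_ncard_le hCs (by rwa [ncard_pair hne])
  subst hCeq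
  have hcyc := hC.isCyclicFlat_closure
  have hr' : N.rk (N.closure {y, z}) ≤ 1 := by rwa [rk_closure]
  -- Each `D X` has rank at least two, so the closure is some `U Z` with `Z` of rank one, and such a
  -- flat is the parallel class of any of its elements.
  obtain ⟨X, hX, ⟨e, he⟩, h⟩ | ⟨Z, hZ, h⟩ := c.cases _ hcyc
  · rw [h, c.D_rk X hX ⟨e, he⟩] at hr'
    have := M.rk_pos (hX.subset_ground he) he
    omega
  · have hne' : Z.Nonempty := by
      rw [← ncard_pos (M.ground_finite.subset hZ.1.subset_ground), ← c.U_ncard Z hZ, ← h,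
        ncard_pos (N.ground_finite.subset (N.closure_subset_ground _))]
      exact ⟨y, N.mem_closure_of_mem (by simp)⟩
    obtain ⟨x, hx⟩ := hne'
    have hxE := hZ.1.subset_ground hx
    have hZx : M.closure {x} = Z := by
      refine (isFlat_closure _).eq_of_subset_of_rk_le hZ.1 (hZ.1.closure_singleton_subset hx) ?_
      rw [rk_closure, rk_singleton hxE, ← c.U_rk Z hZ, ← h]
      exact hr'
    exact ⟨x, hxE, hZx ▸ hZ, by rw [h, hZx]⟩

theorem closure_eq_of_U_subset_L {x e : α} (hx : x ∈ M.E) (hxc : M.IsCyclicFlat (M.closure {x}))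
    (he : e ∈ M.E) (h : c.U (M.closure {x}) ⊆ c.L e) : M.closure {x} = M.closure {e} := by
  have h1 := flat_closure_singleton he
  exact closure_singleton_eq_of_mem
    ((c.UD_sub _ _ hxc h1.1 h1.2).1 h (M.mem_closure_self x hx))

/-- Two distinct lines meet in at most one element. -/
theorem eq_of_mem_L_inter {e f : α} (he : e ∈ M.E) (hf : f ∈ M.E)
    (hef : M.closure {e} ≠ M.closure {f}) {y z : β} (hy : y ∈ c.L e ∩ c.L f)
    (hz : z ∈ c.L e ∩ c.L f) : y = z := by
  by_contra hne
  have hLne : c.L e ≠ c.L f := fun h => by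
    have h1 := flat_closure_singleton he
    have h2 := flat_closure_singleton hf
    exact hef (((c.D_sub _ _ h1.1 h1.2 h2.1 h2.2).1 h.subset).antisymm
      ((c.D_sub _ _ h2.1 h2.2 h1.1 h1.2).1 h.superset))
  have hr := (L_isFlat he).rk_inter_lt (L_isFlat hf) (by rw [L_rk he, L_rk hf]) hLne
  rw [L_rk he] at hr
  have hr' := N.rk_mono (pair_subset hy hz)
  -- Two common elements are parallel, so they span the flat `U` of a parallel class. It lies in
  -- both lines, which forces that class to be both `cl e` and `cl f`.
  obtain ⟨x, hx, hxc, h⟩ := c.exists_closure_pair_eq ((L_isFlat he).subset_ground hy.1)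
    ((L_isFlat he).subset_ground hz.1) hne (by omega)
  have h1 := closure_eq_of_U_subset_L hx hxc he
    (h ▸ (L_isFlat he).closure_subset (pair_subset hy.1 hz.1))
  have h2 := closure_eq_of_U_subset_L hx hxc hf
    (h ▸ (L_isFlat hf).closure_subset (pair_subset hy.2 hz.2))
  exact hef (h1.symm.trans h2)

/-- The two distinct planes `D (cl {w, z})` and `D (cl {w', z})` have rank three, so they meet in
rank at most two. The meet contains `L z`, hence equals it, and it also contains `L w ∩ L w'`. -/
theorem L_inter_subset {w w' z : α} (hw : w ∈ M.E) (hw' : w' ∈ M.E) (hz : z ∈ M.E)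
    (h : w ∉ M.closure {z}) (h' : w' ∉ M.closure {w, z}) : c.L w ∩ c.L w' ⊆ c.L z := by
  have hA : M.IsFlat (M.closure {w, z}) := isFlat_closure _
  have hB : M.IsFlat (M.closure {w', z}) := isFlat_closure _
  have hwA : w ∈ M.closure {w, z} := M.mem_closure_of_mem (by simp) (pair_subset hw hz)
  have hzA : z ∈ M.closure {w, z} := M.mem_closure_of_mem (by simp) (pair_subset hw hz)
  have hwB : w' ∈ M.closure {w', z} := M.mem_closure_of_mem (by simp) (pair_subset hw' hz)
  have hzB : z ∈ M.closure {w', z} := M.mem_closure_of_mem (by simp) (pair_subset hw' hz)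
  have hrA : M.rk {w, z} = 2 := by rw [rk_insert_eq_add_one hw h, rk_singleton hz]
  have hrB : M.rk {w', z} = 2 := by
    rw [rk_insert_eq_add_one hw' fun h1 => h' (M.closure_subset_closure (by simp) h1),
      rk_singleton hz]
  have hDA := (c.D_cyc _ hA ⟨z, hzA⟩).1
  have hDB := (c.D_cyc _ hB ⟨z, hzB⟩).1
  have hne : c.D (M.closure {w, z}) ≠ c.D (M.closure {w', z}) := fun heq =>
    h' ((c.D_sub _ _ hB ⟨z, hzB⟩ hA ⟨z, hzA⟩).1 heq.superset hwB)
  have hr := hDA.rk_inter_lt hDB (by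
    rw [c.D_rk _ hA ⟨z, hzA⟩, c.D_rk _ hB ⟨z, hzB⟩, rk_closure, rk_closure, hrA, hrB]) hne
  rw [c.D_rk _ hA ⟨z, hzA⟩, rk_closure, hrA] at hr
  have heq := (L_isFlat (c := c) hz).eq_of_subset_of_rk_le (hDA.inter' hDB)
    (subset_inter (L_subset_D hA hzA) (L_subset_D hB hzB)) (by rw [L_rk hz]; omega)
  rw [heq]
  exact inter_subset_inter (L_subset_D hA hwA) (L_subset_D hB hwB)

theorem L_inter_subset_of_notMem_closure {e f z : α} (he : e ∈ M.E) (hf : f ∈ M.E)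
    (hz : z ∈ M.E) (hef : f ∉ M.closure {e}) (h : z ∉ M.closure {e, f}) :
    c.L e ∩ c.L f ⊆ c.L z := by
  refine L_inter_subset he hf hz (fun hez => h ?_) fun hfz => h ?_
  · have h1 := closure_singleton_eq_of_mem hez
    have h2 : z ∈ M.closure {e} := h1 ▸ M.mem_closure_self z hz
    exact M.closure_subset_closure (by simp) h2
  · rw [pair_comm] at hfz ⊢
    exact (M.closure_exchange ⟨hfz, hef⟩).1

/-- Pairwise disjoint lines would have `k + (m + 1)|E(M)|` elements in total, where `k > 1` is the
number of parallel classes, but `N` has only `1 + (m + 1)|E(M)|`. -/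
theorem exists_nonempty_L_inter (hr : 2 < M.rk M.E) (c : ConeConfig M m N) :
    ∃ e ∈ M.E, ∃ f ∈ M.E, f ∉ M.closure {e} ∧ (c.L e ∩ c.L f).Nonempty := by
  by_contra! hcon
  have hdis : ∀ e ∈ M.E, ∀ f ∈ M.E, M.closure {e} ≠ M.closure {f} →
      Disjoint (c.L e) (c.L f) := fun e he f hf hef => by
    rw [disjoint_iff_inter_eq_empty]
    exact hcon e he f hf fun h => hef (closure_singleton_eq_of_mem h).symm
  have hsum : (⋃ ℓ ∈ M.pointClosures M.E, c.D ℓ).ncard =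
      ∑ ℓ ∈ M.pointClosures M.E, (1 + (m + 1) * ℓ.ncard) := by
    rw [ncard_biUnion_finset]
    · refine Finset.sum_congr rfl fun ℓ hℓ => ?_
      obtain ⟨e, he, rfl⟩ := (mem_pointClosures subset_rfl).1 hℓ
      exact L_ncard he
    · intro ℓ hℓ
      obtain ⟨e, he, rfl⟩ := (mem_pointClosures subset_rfl).1 hℓ
      exact L_finite he
    · intro ℓ hℓ ℓ' hℓ' hne
      obtain ⟨e, he, rfl⟩ := (mem_pointClosures subset_rfl).1 hℓ
      obtain ⟨f, hf, rfl⟩ := (mem_pointClosures subset_rfl).1 hℓ'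
      exact hdis e he f hf hne
  rw [Finset.sum_add_distrib, ← Finset.mul_sum, sum_ncard_pointClosures M.ground_isFlat] at hsum
  have hle : (⋃ ℓ ∈ M.pointClosures M.E, c.D ℓ).ncard ≤ N.E.ncard := by
    refine ncard_le_ncard (iUnion₂_subset fun ℓ hℓ => ?_) N.ground_finite
    obtain ⟨e, he, rfl⟩ := (mem_pointClosures subset_rfl).1 hℓ
    exact (L_isFlat he).subset_ground
  rw [c.ground, hsum] at hle
  obtain ⟨e, he, -⟩ := exists_notMem_closure_of_ncard_lt (M := M) (X := ∅) (by simp) (by simp; omega)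
  obtain ⟨f, hf, hfe⟩ := exists_notMem_closure_of_ncard_lt (M := M) (X := {e}) (by simp)
    (by simp; omega)
  have hcard : 1 < (M.pointClosures M.E).card := by
    rw [Finset.one_lt_card]
    refine ⟨_, (mem_pointClosures subset_rfl).2 ⟨e, he, rfl⟩, _,
      (mem_pointClosures subset_rfl).2 ⟨f, hf, rfl⟩, fun h => hfe ?_⟩
    rw [h]
    exact M.mem_closure_self f hf
  simp only [Finset.sum_const, smul_eq_mul, mul_one] at hle
  omega

/-- A common element of `L e` and `L f` lies on `L z` for all `z` outside the plane `cl {e, f}`. For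
`z` in that plane but not parallel to `e`, the same argument applies to `e` and some `g` outside the
plane; this is where rank at least three is needed. -/
theorem exists_common_point (hr : 2 < M.rk M.E) (c : ConeConfig M m N) :
    ∃ a, ∀ z ∈ M.E, a ∈ c.L z := by
  obtain ⟨e, he, f, hf, hef, y, hy⟩ := exists_nonempty_L_inter hr c
  refine ⟨y, fun z hz => ?_⟩
  obtain ⟨g, hg, hgef⟩ := exists_notMem_closure_of_ncard_lt (M := M) (X := {e, f}) (toFinite _)
    ((ncard_insert_le _ _).trans_lt (by simpa using hr))
  have hyg := L_inter_subset_of_notMem_closure he hf hg hef hgef hy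
  by_cases hz1 : z ∈ M.closure {e, f}
  swap
  · exact L_inter_subset_of_notMem_closure he hf hz hef hz1 hy
  by_cases hze : z ∈ M.closure {e}
  · rw [L_congr (closure_singleton_eq_of_mem hze)]
    exact hy.1
  refine L_inter_subset_of_notMem_closure he hg hz (fun h => hgef ?_) (fun h => hgef ?_)
    ⟨hy.1, hyg⟩
  · exact M.closure_subset_closure (by simp) h
  · rw [pair_comm] at h
    have h1 := (M.closure_exchange ⟨h, hze⟩).1
    refine M.closure_subset_closure_of_subset_closure (pair_subset hz1 ?_) h1
    exact M.mem_closure_of_mem (by simp) (pair_subset he hf)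

end ConeConfig

end Matroid

namespace Matroid

/-! ### How the cyclic flats of `N` meet the lines through the common element -/

namespace ConeConfig

variable {α : Type u} {β : Type v} {M : Matroid α} {m : ℕ} {N : Matroid β} [M.Finite] [N.Finite]
  [M.Loopless] {c : ConeConfig M m N} {a : β}

theorem disjoint_L_sdiff (ha : ∀ z ∈ M.E, a ∈ c.L z) {e f : α} (he : e ∈ M.E) (hf : f ∈ M.E)
    (hef : M.closure {e} ≠ M.closure {f}) : Disjoint (c.L e \ {a}) (c.L f \ {a}) := by
  rw [disjoint_left]
  rintro y ⟨hy, hya⟩ ⟨hy', -⟩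
  exact hya (eq_of_mem_L_inter he hf hef ⟨hy, hy'⟩ ⟨ha e he, ha f hf⟩)

theorem closure_eq_of_mem_L (ha : ∀ z ∈ M.E, a ∈ c.L z) {e f : α} (he : e ∈ M.E) (hf : f ∈ M.E)
    {y : β} (hya : y ≠ a) (hye : y ∈ c.L e) (hyf : y ∈ c.L f) :
    M.closure {e} = M.closure {f} := by
  by_contra hef
  exact hya (eq_of_mem_L_inter he hf hef ⟨hye, hyf⟩ ⟨ha e he, ha f hf⟩)

/-- The lines over `X` are disjoint apart from `a`, so together with `a` they have `1 + (m + 1)|X|`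
elements, which is all of `D X`. -/
theorem mem_D_iff (ha : ∀ z ∈ M.E, a ∈ c.L z) {X : Set α} (hX : M.IsFlat X) (hne : X.Nonempty)
    {y : β} : y ∈ c.D X ↔ ∃ e ∈ X, y ∈ c.L e := by
  have hXE := hX.subset_ground
  have hsum : (⋃ ℓ ∈ M.pointClosures X, c.D ℓ \ {a}).ncard = (m + 1) * X.ncard := by
    rw [ncard_biUnion_finset, ← sum_ncard_pointClosures hX, Finset.mul_sum]
    · refine Finset.sum_congr rfl fun ℓ hℓ => ?_
      obtain ⟨e, he, rfl⟩ := (mem_pointClosures hXE).1 hℓ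
      have h1 := ncard_sdiff_singleton_add_one (ha e (hXE he)) (L_finite (hXE he))
      rw [L_ncard (hXE he), add_comm, Nat.add_left_cancel_iff] at h1
      exact h1
    · intro ℓ hℓ
      obtain ⟨e, he, rfl⟩ := (mem_pointClosures hXE).1 hℓ
      exact (L_finite (hXE he)).subset sdiff_subset
    · intro ℓ hℓ ℓ' hℓ' hne
      obtain ⟨e, he, rfl⟩ := (mem_pointClosures hXE).1 hℓ
      obtain ⟨f, hf, rfl⟩ := (mem_pointClosures hXE).1 hℓ'
      exact disjoint_L_sdiff ha (hXE he) (hXE hf) hne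
  have hDfin : (c.D X).Finite := N.ground_finite.subset (c.D_cyc X hX hne).1.subset_ground
  have hsub : (⋃ ℓ ∈ M.pointClosures X, c.D ℓ \ {a}) ⊆ c.D X := by
    refine iUnion₂_subset fun ℓ hℓ => ?_
    obtain ⟨e, he, rfl⟩ := (mem_pointClosures hXE).1 hℓ
    exact sdiff_subset.trans (L_subset_D hX he)
  have haD : a ∈ c.D X := L_subset_D hX hne.some_mem (ha _ (hXE hne.some_mem))
  have heq : insert a (⋃ ℓ ∈ M.pointClosures X, c.D ℓ \ {a}) = c.D X := by
    refine eq_of_subset_of_ncard_le (insert_subset haD hsub) ?_ hDfin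
    rw [c.D_ncard X hX hne, ncard_insert_of_notMem (by simp) (hDfin.subset hsub), hsum]
    omega
  constructor
  · intro hy
    rw [← heq, mem_insert_iff, mem_iUnion₂] at hy
    obtain rfl | ⟨ℓ, hℓ, hy⟩ := hy
    · exact ⟨_, hne.some_mem, ha _ (hXE hne.some_mem)⟩
    · obtain ⟨e, he, rfl⟩ := (mem_pointClosures hXE).1 hℓ
      exact ⟨e, he, hy.1⟩
  · rintro ⟨e, he, hy⟩
    exact L_subset_D hX he hy

theorem exists_mem_L (ha : ∀ z ∈ M.E, a ∈ c.L z) (hne : M.E.Nonempty) {y : β} (hy : y ∈ N.E) :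
    ∃ e ∈ M.E, y ∈ c.L e := by
  rw [← mem_D_iff ha M.ground_isFlat hne]
  have h1 : c.D M.E = N.E :=
    eq_of_subset_of_ncard_le (c.D_cyc _ M.ground_isFlat hne).1.subset_ground
      (by rw [c.D_ncard _ M.ground_isFlat hne, c.ground]) N.ground_finite
  rwa [h1]

/-- Otherwise `U Z` would contain the whole line, but no `D X` lies in a `U Z`. -/
theorem rk_U_inter_L_le {Z : Set α} (hZ : M.IsCyclicFlat Z) {e : α} (he : e ∈ M.E) :
    N.rk (c.U Z ∩ c.L e) ≤ 1 := by
  by_contra! h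
  have h1 := ((c.U_cyc Z hZ).1.inter' (L_isFlat he)).eq_of_subset_of_rk_le
    (L_isFlat (c := c) he) inter_subset_right (by rw [L_rk he]; omega)
  have h2 := flat_closure_singleton he
  exact c.DU_sub _ Z h2.1 h2.2 hZ (inter_eq_right.1 h1)

/-- If the intersection is larger, it has two elements; these are parallel and span `U` of a
parallel class. By rank this is the whole intersection, and since it lies in `L e` the class is `cl
e`, so the size is `|cl e|` after all. -/
theorem ncard_U_inter_L_le {Z : Set α} (hZ : M.IsCyclicFlat Z) {e : α} (he : e ∈ M.E) :
    (c.U Z ∩ c.L e).ncard ≤ (M.closure {e}).ncard := by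
  have hr := rk_U_inter_L_le (c := c) hZ he
  have hK := (c.U_cyc Z hZ).1.inter' (L_isFlat (c := c) he)
  have hfin := N.ground_finite.subset hK.subset_ground
  by_contra! hlt
  obtain ⟨y, z, hy, hz, hne⟩ := (one_lt_ncard_iff hfin).1
    ((one_le_ncard_closure_singleton he).trans_lt hlt)
  obtain ⟨x, hx, hxc, h⟩ := c.exists_closure_pair_eq (hK.subset_ground hy) (hK.subset_ground hz)
    hne ((N.rk_mono (pair_subset hy hz)).trans hr)
  have hsub : c.U (M.closure {x}) ⊆ c.U Z ∩ c.L e := h ▸ hK.closure_subset (pair_subset hy hz)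
  have heq := (c.U_cyc _ hxc).1.eq_of_subset_of_rk_le hK hsub
    (by rw [c.U_rk _ hxc, rk_closure, rk_singleton hx]; exact hr)
  have hxe := closure_eq_of_U_subset_L hx hxc he (hsub.trans inter_subset_right)
  rw [← heq, c.U_ncard _ hxc, hxe] at hlt
  exact lt_irrefl _ hlt

theorem notMem_U (hr : 2 < M.rk M.E) (ha : ∀ z ∈ M.E, a ∈ c.L z) {Z : Set α}
    (hZ : M.IsCyclicFlat Z) : a ∉ c.U Z := by
  have := c.loopless
  intro haZ
  have hZE := hZ.1.subset_ground
  have hUfin : (c.U Z).Finite := N.ground_finite.subset (c.U_cyc Z hZ).1.subset_ground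
  have haE := (c.U_cyc Z hZ).1.subset_ground haZ
  have hne : Z.Nonempty := by
    rw [← ncard_pos (M.ground_finite.subset hZE), ← c.U_ncard Z hZ, ncard_pos hUfin]
    exact ⟨a, haZ⟩
  -- Another element `y` of `U Z` shares a line with `a`, hence is parallel to `a` and lies on every
  -- line. The flat spanned by `a` and `y` would then identify all parallel classes of `M`.
  have hsub : c.U Z ⊆ {a} := by
    intro y hy
    by_contra hya
    obtain ⟨e, he, hye⟩ := (mem_D_iff ha hZ.1 hne).1
      (((c.UD_sub Z Z hZ hZ.1 hne).2 subset_rfl) hy)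
    have hyE := (L_isFlat (hZE he)).subset_ground hye
    have hr1 : N.rk {a, y} ≤ 1 :=
      (N.rk_mono (show {a, y} ⊆ c.U Z ∩ c.L e from
        pair_subset ⟨haZ, ha e (hZE he)⟩ ⟨hy, hye⟩)).trans (rk_U_inter_L_le hZ (hZE he))
    obtain ⟨x, hx, hxc, h⟩ := c.exists_closure_pair_eq haE hyE (Ne.symm hya) hr1
    have hya' : y ∈ N.closure {a} := by
      have := N.rk_mono (show ({a} : Set β) ⊆ {a, y} by simp)
      rw [mem_closure_iff_rk hyE, pair_comm]
      rw [rk_singleton haE] at this ⊢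
      omega
    have hall : ∀ g ∈ M.E, M.closure {x} = M.closure {g} := fun g hg => by
      refine closure_eq_of_U_subset_L (c := c) hx hxc hg ?_
      rw [← h]
      exact (L_isFlat hg).closure_subset (pair_subset (ha g hg)
        ((L_isFlat hg).closure_singleton_subset (ha g hg) hya'))
    obtain ⟨g, hg, hgx⟩ := exists_notMem_closure_of_ncard_lt (M := M) (X := {x}) (by simp)
      (by simp; omega)
    exact hgx (hall g hg ▸ M.mem_closure_self g hg)
  -- Now `Z` has a single element; that element is not a loop, so `Z` is not cyclic.
  have h1 := ncard_le_ncard hsub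
  rw [c.U_ncard Z hZ, ncard_singleton] at h1
  obtain ⟨x, hx⟩ := hne
  have hZx : Z = {x} := by
    refine (eq_of_subset_of_ncard_le (singleton_subset_iff.2 hx) (by simpa using h1)
      (M.ground_finite.subset hZE)).symm
  have h2 := (isCyclicFlat_iff_rk.1 hZ).2 x hx
  rw [hZx, Set.sdiff_self, rk_empty, rk_singleton (hZE hx)] at h2
  omega

/-- Since `a ∉ U Z`, the lines over `Z` partition `U Z`. The upper bounds `|cl e|` sum to `|Z| = |U
Z|`, so each is attained. -/
theorem ncard_U_inter_L (hr : 2 < M.rk M.E) (ha : ∀ z ∈ M.E, a ∈ c.L z) {Z : Set α}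
    (hZ : M.IsCyclicFlat Z) {e : α} (he : e ∈ Z) :
    (c.U Z ∩ c.L e).ncard = (M.closure {e}).ncard := by
  have hZE := hZ.1.subset_ground
  have hfin : (c.U Z).Finite := N.ground_finite.subset (c.U_cyc Z hZ).1.subset_ground
  have hU : (⋃ ℓ ∈ M.pointClosures Z, c.U Z ∩ c.D ℓ) = c.U Z := by
    refine (iUnion₂_subset fun _ _ => inter_subset_left).antisymm fun y hy => ?_
    obtain ⟨f, hf, hyf⟩ := (mem_D_iff ha hZ.1 ⟨e, he⟩).1
      (((c.UD_sub Z Z hZ hZ.1 ⟨e, he⟩).2 subset_rfl) hy)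
    exact mem_iUnion₂.2 ⟨_, (mem_pointClosures hZE).2 ⟨f, hf, rfl⟩, hy, hyf⟩
  have hsum : ∑ ℓ ∈ M.pointClosures Z, (c.U Z ∩ c.D ℓ).ncard =
      ∑ ℓ ∈ M.pointClosures Z, ℓ.ncard := by
    rw [sum_ncard_pointClosures hZ.1, ← c.U_ncard Z hZ, ← ncard_biUnion_finset, hU]
    · exact fun ℓ _ => hfin.subset inter_subset_left
    · intro ℓ hℓ ℓ' hℓ' hne
      obtain ⟨g, hg, rfl⟩ := (mem_pointClosures hZE).1 hℓ
      obtain ⟨f, hf, rfl⟩ := (mem_pointClosures hZE).1 hℓ'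
      rw [disjoint_left]
      rintro y ⟨hyU, hyg⟩ ⟨-, hyf⟩
      exact hne (closure_eq_of_mem_L ha (hZE hg) (hZE hf)
        (fun h => notMem_U hr ha hZ (h ▸ hyU)) hyg hyf)
  refine (Finset.sum_eq_sum_iff_of_le fun ℓ hℓ => ?_).1 hsum _
    ((mem_pointClosures hZE).2 ⟨e, he, rfl⟩)
  obtain ⟨g, hg, rfl⟩ := (mem_pointClosures hZE).1 hℓ
  exact ncard_U_inter_L_le hZ (hZE hg)

/-- In each line of `N` through the common point one can choose elements that play the role of the
elements of `M`. -/
theorem exists_baseSets (hr : 2 < M.rk M.E) (ha : ∀ z ∈ M.E, a ∈ c.L z) :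
    ∃ B : Set α → Set β, (∀ e ∈ M.E, B (M.closure {e}) ⊆ c.L e \ {a} ∧
        (B (M.closure {e})).ncard = (M.closure {e}).ncard) ∧
      ∀ Z, M.IsCyclicFlat Z → ∀ y, y ∈ c.U Z ↔ ∃ e ∈ Z, y ∈ B (M.closure {e}) := by
  -- On lines over the largest cyclic flat `V` the choice is forced to be `U V ∩ L e`; on the other
  -- lines any set of the right size avoiding `a` will do.
  set V := ⋃₀ {C | M.IsCircuit C} with hVdef
  have hV : M.IsCyclicFlat V := M.isCyclicFlat_sUnion_isCircuit
  have h1 : ∀ ℓ : Set α, ∃ B : Set β, ℓ ∈ M.pointClosures M.E →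
      B ⊆ c.D ℓ \ {a} ∧ B.ncard = ℓ.ncard ∧ (ℓ ⊆ V → B = c.U V ∩ c.D ℓ) := by
    intro ℓ
    by_cases hℓ : ℓ ∈ M.pointClosures M.E
    swap
    · exact ⟨∅, fun h => (hℓ h).elim⟩
    obtain ⟨e, he, rfl⟩ := (mem_pointClosures subset_rfl).1 hℓ
    by_cases hℓV : M.closure {e} ⊆ V
    · have heV := hℓV (M.mem_closure_self e he)
      refine ⟨c.U V ∩ c.L e, fun _ => ⟨fun y hy => ⟨hy.2, fun h => ?_⟩,
        ncard_U_inter_L hr ha hV heV, fun _ => rfl⟩⟩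
      exact notMem_U hr ha hV (h ▸ hy.1)
    · have h2 := ncard_sdiff_singleton_add_one (ha e he) (L_finite he)
      rw [L_ncard he, add_comm, Nat.add_left_cancel_iff] at h2
      obtain ⟨B, hB, hBc⟩ := exists_subset_card_eq (s := c.L e \ {a})
        (n := (M.closure {e}).ncard) (by rw [h2]; nlinarith)
      exact ⟨B, fun _ => ⟨hB, hBc, fun h => (hℓV h).elim⟩⟩
  choose B hB using h1
  have hB' : ∀ e ∈ M.E, _ := fun e he => hB _ ((mem_pointClosures subset_rfl).2 ⟨e, he, rfl⟩)
  refine ⟨B, fun e he => ⟨(hB' e he).1, (hB' e he).2.1⟩, fun Z hZ y => ?_⟩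
  have hZV : Z ⊆ V := hZ.subset_sUnion_isCircuit
  have hZE := hZ.1.subset_ground
  have hfin : (c.U V).Finite := N.ground_finite.subset (c.U_cyc V hV).1.subset_ground
  -- `U Z ∩ L e` is contained in `U V ∩ L e`, and both have `|cl e|` elements.
  have key : ∀ e ∈ Z, c.U Z ∩ c.L e = B (M.closure {e}) := by
    intro e he
    rw [(hB' e (hZE he)).2.2 (hV.1.closure_singleton_subset (hZV he))]
    refine eq_of_subset_of_ncard_le
      (inter_subset_inter_left _ ((c.U_sub Z V hZ hV).2 hZV)) ?_ (hfin.subset inter_subset_left)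
    exact (ncard_U_inter_L hr ha hV (hZV he)).trans_le (ncard_U_inter_L hr ha hZ he).ge
  constructor
  · intro hy
    have hne : Z.Nonempty := by
      rw [← ncard_pos (M.ground_finite.subset hZE), ← c.U_ncard Z hZ,
        ncard_pos (hfin.subset ((c.U_sub Z V hZ hV).2 hZV))]
      exact ⟨y, hy⟩
    obtain ⟨e, he, hye⟩ := (mem_D_iff ha hZ.1 hne).1
      (((c.UD_sub Z Z hZ hZ.1 hne).2 subset_rfl) hy)
    exact ⟨e, he, key e he ▸ ⟨hy, hye⟩⟩
  · rintro ⟨e, he, hye⟩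
    rw [← key e he] at hye
    exact hye.1

end ConeConfig

theorem exists_equiv_of_labels_on {A : Type u} {B : Type v} {κ : Type w} {S : Set A} {T : Set B}
    (hS : S.Finite) (hT : T.Finite) (f : A → κ) (g : B → κ)
    (h : ∀ k, {a ∈ S | f a = k}.ncard = {b ∈ T | g b = k}.ncard) :
    ∃ φ : S ≃ T, ∀ a, g (φ a) = f a := by
  have := hS.to_subtype
  have := hT.to_subtype
  refine exists_equiv_of_labels (fun a : S => f a) (fun b : T => g b) fun k => ?_
  have h1 : Subtype.val '' {a : S | f a = k} = {a ∈ S | f a = k} := by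
    ext; simp [and_comm]
  have h2 : Subtype.val '' {b : T | g b = k} = {b ∈ T | g b = k} := by
    ext; simp [and_comm]
  rw [← ncard_image_of_injective _ Subtype.val_injective, h1, h k, ← h2,
    ncard_image_of_injective _ Subtype.val_injective]

/-- The bijection preserves the numbers `|I ∩ F|`, and by `indep_iff_forall_isCyclicFlat` these
decide independence. -/
theorem isIsomorphic_of_cyclicFlats {α : Type u} {β : Type v} {M : Matroid α} {N : Matroid β}
    [M.Finite] [N.Finite] (φ : M.E ≃ N.E)
    (h1 : ∀ F, M.IsCyclicFlat F → ∃ F', N.IsCyclicFlat F' ∧ N.rk F' = M.rk F ∧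
      ∀ a, a.1 ∈ F ↔ (φ a).1 ∈ F')
    (h2 : ∀ F', N.IsCyclicFlat F' → ∃ F, M.IsCyclicFlat F ∧ N.rk F' = M.rk F ∧
      ∀ a, a.1 ∈ F ↔ (φ a).1 ∈ F') :
    M.IsIsomorphic N := by
  refine ⟨φ, fun I => ?_⟩
  have hcard : ∀ (F : Set α) (F' : Set β), (∀ a, a.1 ∈ F ↔ (φ a).1 ∈ F') →
      (Subtype.val '' I ∩ F).ncard = (Subtype.val '' (φ '' I) ∩ F').ncard := by
    intro F F' h
    have e1 : Subtype.val '' I ∩ F = Subtype.val '' {a ∈ I | a.1 ∈ F} := by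
      ext x
      simp only [mem_inter_iff, mem_image, Set.mem_ofPred_eq]
      grind
    have e2 : Subtype.val '' (φ '' I) ∩ F' = (fun a => (φ a).1) '' {a ∈ I | a.1 ∈ F} := by
      ext x
      simp only [mem_inter_iff, mem_image, Set.mem_ofPred_eq, h]
      grind
    rw [e1, e2, ncard_image_of_injective _ Subtype.val_injective, ncard_image_of_injective]
    exact Subtype.val_injective.comp φ.injective
  rw [indep_iff_forall_isCyclicFlat (by simp), indep_iff_forall_isCyclicFlat (by simp)]
  constructor
  · intro h F' hF'
    obtain ⟨F, hF, hr, hm⟩ := h2 F' hF'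
    rw [← hcard F F' hm, hr]
    exact h F hF
  · intro h F hF
    obtain ⟨F', hF', hr, hm⟩ := h1 F hF
    rw [hcard F F' hm, ← hr]
    exact h F' hF'

/-! ### The isomorphism from the cone -/

namespace ConeConfig

variable {α : Type u} {β : Type v} {M : Matroid α} {m : ℕ} {N : Matroid β} [M.Finite] [N.Finite]
  [M.Loopless]

/-- The label of an element of the free cone: its line through the tip, and whether it is an
element of the original matroid. -/
def coneLabel (M : Matroid α) : FreeConePoint α m → Option (Set α × Prop)
  | .base x => some (M.closure {x}, True)
  | .tip => none
  | .pt x _ => some (M.closure {x}, False)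

/-- Flats are unions of parallel classes, so labels need not distinguish parallel elements. -/
theorem mem_cone_iff_coneLabel {X : Set α} (hX : M.IsFlat X) {y : FreeConePoint α m}
    (hy : y ∈ (M.freeCone m).E) :
    y ∈ cone m X ↔ coneLabel M y = none ∨ ∃ e ∈ X, ∃ p, coneLabel M y = some (M.closure {e}, p) := by
  have key : ∀ x ∈ M.E, x ∈ X ↔ ∃ e ∈ X, M.closure {x} = M.closure {e} := fun x hx =>
    ⟨fun h => ⟨x, h, rfl⟩, fun ⟨e, he, h⟩ =>
      hX.closure_singleton_subset he (h ▸ M.mem_closure_self x hx)⟩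
  cases y with
  | tip => simp [coneLabel]
  | base x =>
    refine (base_mem_cone.trans (key x (by simpa using hy))).trans
      ⟨fun ⟨e, he, h⟩ => .inr ⟨e, he, _, by rw [coneLabel, h]⟩, ?_⟩
    rintro (h | ⟨e, he, p, h⟩)
    · cases h
    · exact ⟨e, he, (Prod.mk.inj (Option.some.inj h)).1⟩
  | pt x i =>
    refine (pt_mem_cone.trans (key x (by simpa using hy))).trans
      ⟨fun ⟨e, he, h⟩ => .inr ⟨e, he, _, by rw [coneLabel, h]⟩, ?_⟩
    rintro (h | ⟨e, he, p, h⟩)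
    · cases h
    · exact ⟨e, he, (Prod.mk.inj (Option.some.inj h)).1⟩

theorem mem_image_base_iff_coneLabel {Z : Set α} (hZ : M.IsFlat Z) {y : FreeConePoint α m}
    (hy : y ∈ (M.freeCone m).E) :
    y ∈ FreeConePoint.base '' Z ↔ ∃ e ∈ Z, coneLabel M y = some (M.closure {e}, True) := by
  have key : ∀ x ∈ M.E, x ∈ Z ↔ ∃ e ∈ Z, M.closure {x} = M.closure {e} := fun x hx =>
    ⟨fun h => ⟨x, h, rfl⟩, fun ⟨e, he, h⟩ =>
      hZ.closure_singleton_subset he (h ▸ M.mem_closure_self x hx)⟩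
  cases y with
  | tip => simp [coneLabel]
  | base x => simpa [coneLabel] using key x (by simpa using hy)
  | pt x i => simp [coneLabel]

theorem isIsomorphic (hr : 2 < M.rk M.E) (hm : 0 < m) (c : ConeConfig M m N) :
    (M.freeCone m).IsIsomorphic N := by
  obtain ⟨a, ha⟩ := exists_common_point hr c
  obtain ⟨B, hB, hUB⟩ := exists_baseSets hr ha
  have hEne : M.E.Nonempty := by
    rw [nonempty_iff_ne_empty]
    intro h
    rw [h, rk_empty] at hr
    omega
  have hex : ∀ y : β, ∃ e, y ∈ N.E → e ∈ M.E ∧ y ∈ c.L e := fun y => by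
    by_cases hy : y ∈ N.E
    · obtain ⟨e, he⟩ := exists_mem_L ha hEne hy
      exact ⟨e, fun _ => he⟩
    · exact ⟨hEne.some, fun h => (hy h).elim⟩
  choose π hπ using hex
  classical
  -- The labels of `N`: `a` stands for the tip and the sets `B` for the elements of `M`. The choice
  -- `π` of a line is immaterial, since an element other than `a` lies on only one line.
  let g : β → Option (Set α × Prop) := fun y =>
    if y = a then none else some (M.closure {π y}, y ∈ B (M.closure {π y}))
  have haE : a ∈ N.E := (L_isFlat hEne.some_mem).subset_ground (ha _ hEne.some_mem)
  have hLE : ∀ e ∈ M.E, c.L e ⊆ N.E := fun e he => (L_isFlat he).subset_ground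
  have hg : ∀ y ∈ N.E, ∀ e ∈ M.E, ∀ p, g y = some (M.closure {e}, p) ↔
      y ∈ c.L e ∧ y ≠ a ∧ (y ∈ B (M.closure {e}) ↔ p) := by
    intro y hy e he p
    by_cases hya : y = a
    · simp [g, hya]
    simp only [g, hya, if_false, Option.some.injEq, Prod.mk.injEq, ne_eq, not_false_eq_true,
      true_and]
    constructor
    · rintro ⟨h, rfl⟩
      rw [h]
      refine ⟨?_, Iff.rfl⟩
      rw [← L_congr h]
      exact (hπ y hy).2
    · rintro ⟨h, hp⟩
      have := closure_eq_of_mem_L ha (hπ y hy).1 he hya (hπ y hy).2 h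
      exact ⟨this, by rw [this]; exact propext hp⟩
  have hQfin : ∀ S : Set (FreeConePoint α m), S ⊆ (M.freeCone m).E → S.Finite := fun S hS =>
    (M.freeCone m).ground_finite.subset hS
  obtain ⟨φ, hφ⟩ : ∃ φ : (M.freeCone m).E ≃ N.E, ∀ y, g (φ y) = coneLabel M y.1 := by
    refine exists_equiv_of_labels_on (M.freeCone m).ground_finite N.ground_finite
      (coneLabel M) g fun k => ?_
    -- The fibres agree in size: one element for `none`; for a parallel class `ℓ`, `|ℓ|` elements
    -- with `True` and `m|ℓ|` with `False`; none for any other first component.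
    obtain _ | ⟨ℓ, p⟩ := k
    · have h1 : {y ∈ (M.freeCone m).E | coneLabel M y = none} = {.tip} := by
        ext y
        cases y <;> simp [coneLabel]
      have h2 : {y ∈ N.E | g y = none} = {a} := by
        ext y
        by_cases hya : y = a
        · simp [g, hya, haE]
        · simp [g, hya]
      rw [h1, h2, ncard_singleton, ncard_singleton]
    · by_cases hℓ : ∃ e ∈ M.E, M.closure {e} = ℓ
      swap
      · have h1 : {y ∈ (M.freeCone m).E | coneLabel M y = some (ℓ, p)} = ∅ := by
          ext y
          cases y with
          | tip => simp [coneLabel]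
          | base x => simpa [coneLabel] using fun hx h => (hℓ ⟨x, hx, h⟩).elim
          | pt x i => simpa [coneLabel] using fun hx h => (hℓ ⟨x, hx, h⟩).elim
        have h2 : {y ∈ N.E | g y = some (ℓ, p)} = ∅ := by
          ext y
          simp only [Set.mem_ofPred_eq, mem_empty_iff_false, iff_false, not_and]
          intro hy h
          by_cases hya : y = a
          · simp [g, hya] at h
          · simp only [g, hya, if_false, Option.some.injEq, Prod.mk.injEq] at h
            exact hℓ ⟨π y, (hπ y hy).1, h.1⟩
        rw [h1, h2, ncard_empty, ncard_empty]
      obtain ⟨e, he, rfl⟩ := hℓ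
      have hclE := M.closure_subset_ground {e}
      have hiff : ∀ x ∈ M.E, M.closure {x} = M.closure {e} ↔ x ∈ M.closure {e} := fun x hx =>
        ⟨fun h => h ▸ M.mem_closure_self x hx, closure_singleton_eq_of_mem⟩
      have hbaseE : FreeConePoint.base (m := m) '' M.closure {e} ⊆ (M.freeCone m).E :=
        image_base_subset_freeCone hclE
      obtain rfl | rfl := Classical.propComplete p
      · have h1 : {y ∈ (M.freeCone m).E | coneLabel M y = some (M.closure {e}, True)} =
            FreeConePoint.base '' M.closure {e} := by
          ext y
          cases y with
          | tip => simp [coneLabel]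
          | base x =>
            simp only [coneLabel, Set.mem_ofPred_eq, base_mem_freeCone, Option.some.injEq,
              Prod.mk.injEq, and_true, FreeConePoint.base_injective.mem_set_image]
            exact ⟨fun h => (hiff x h.1).1 h.2, fun h => ⟨hclE h, (hiff x (hclE h)).2 h⟩⟩
          | pt x i => simp [coneLabel]
        have h2 : {y ∈ N.E | g y = some (M.closure {e}, True)} = B (M.closure {e}) := by
          ext y
          simp only [Set.mem_ofPred_eq]
          constructor
          · rintro ⟨hy, h⟩
            simpa using ((hg y hy e he True).1 h).2.2
          · intro hy
            have hyL := (hB e he).1 hy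
            have hyE := hLE e he hyL.1
            exact ⟨hyE, (hg y hyE e he True).2 ⟨hyL.1, hyL.2, by simpa using hy⟩⟩
        rw [h1, h2, (hB e he).2, ncard_image_of_injective _ FreeConePoint.base_injective]
      · have h1 : {y ∈ (M.freeCone m).E | coneLabel M y = some (M.closure {e}, False)} =
            (cone m (M.closure {e}) \ {.tip}) \ FreeConePoint.base '' M.closure {e} := by
          ext y
          cases y with
          | tip => simp [coneLabel]
          | base x => simp [coneLabel]
          | pt x i =>
            simp only [coneLabel, Set.mem_ofPred_eq, pt_mem_freeCone, Option.some.injEq,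
              Prod.mk.injEq, and_true, mem_sdiff, pt_mem_cone, mem_singleton_iff, reduceCtorEq,
              not_false_eq_true, mem_image, and_false, exists_false]
            exact ⟨fun h => (hiff x h.1).1 h.2, fun h => ⟨hclE h, (hiff x (hclE h)).2 h⟩⟩
        have h2 : {y ∈ N.E | g y = some (M.closure {e}, False)} =
            (c.L e \ {a}) \ B (M.closure {e}) := by
          ext y
          simp only [Set.mem_ofPred_eq]
          constructor
          · rintro ⟨hy, h⟩
            obtain ⟨h1, h2, h3⟩ := (hg y hy e he False).1 h
            exact ⟨⟨h1, h2⟩, by simpa using h3⟩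
          · rintro ⟨hyL, hy⟩
            have hyE := hLE e he hyL.1
            exact ⟨hyE, (hg y hyE e he False).2 ⟨hyL.1, hyL.2, by simpa using hy⟩⟩
        have hbfin := hQfin _ hbaseE
        have h3 : FreeConePoint.base '' M.closure {e} ⊆ cone m (M.closure {e}) \ {.tip} := by
          rintro _ ⟨x, hx, rfl⟩
          simpa using hx
        have hclfin := M.ground_finite.subset hclE
        rw [h1, h2, ncard_sdiff h3 hbfin,
          ncard_sdiff (hB e he).1 ((L_finite he).subset ((hB e he).1.trans sdiff_subset)),
          (hB e he).2, ncard_image_of_injective _ FreeConePoint.base_injective,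
          ncard_sdiff_singleton_of_mem (tip_mem_cone _), ncard_cone hclfin,
          ncard_sdiff_singleton_of_mem (ha e he), L_ncard he]
  have hcone : ∀ X, M.IsFlat X → X.Nonempty → ∀ y : (M.freeCone m).E,
      y.1 ∈ cone m X ↔ (φ y).1 ∈ c.D X := by
    intro X hX hne y
    rw [mem_cone_iff_coneLabel hX y.2, ← hφ, mem_D_iff ha hX hne]
    by_cases hya : (φ y).1 = a
    · simp only [g, hya, if_true, true_or, true_iff]
      exact ⟨_, hne.some_mem, ha _ (hX.subset_ground hne.some_mem)⟩
    · have hnone : g (φ y) ≠ none := by simp [g, hya]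
      simp only [hnone, false_or]
      refine exists_congr fun e => and_congr_right fun he => ?_
      simp only [hg _ (φ y).2 e (hX.subset_ground he)]
      exact ⟨fun ⟨p, h⟩ => h.1, fun h => ⟨_, h, hya, Iff.rfl⟩⟩
  have hbase : ∀ Z, M.IsCyclicFlat Z → ∀ y : (M.freeCone m).E,
      y.1 ∈ FreeConePoint.base '' Z ↔ (φ y).1 ∈ c.U Z := by
    intro Z hZ y
    rw [mem_image_base_iff_coneLabel hZ.1 y.2, ← hφ, hUB Z hZ]
    refine exists_congr fun e => and_congr_right fun he => ?_
    have heE := hZ.1.subset_ground he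
    rw [hg _ (φ y).2 e heE, iff_true]
    exact ⟨fun h => h.2.2, fun h => ⟨((hB e heE).1 h).1, ((hB e heE).1 h).2, h⟩⟩
  refine isIsomorphic_of_cyclicFlats φ (fun F hF => ?_) fun F' hF' => ?_
  · obtain ⟨X, hX, hne, rfl⟩ | ⟨Z, hZ, rfl⟩ := hF.freeCone_cases
    · exact ⟨c.D X, c.D_cyc X hX hne, by rw [c.D_rk X hX hne, freeCone_rk_cone hX.subset_ground],
        hcone X hX hne⟩
    · exact ⟨c.U Z, c.U_cyc Z hZ, by rw [c.U_rk Z hZ, freeCone_rk_image_base hZ.1.subset_ground],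
        hbase Z hZ⟩
  · obtain ⟨X, hX, hne, rfl⟩ | ⟨Z, hZ, rfl⟩ := c.cases F' hF'
    · exact ⟨cone m X, isCyclicFlat_cone hm hX hne,
        by rw [c.D_rk X hX hne, freeCone_rk_cone hX.subset_ground], hcone X hX hne⟩
    · exact ⟨FreeConePoint.base '' Z, isCyclicFlat_image_base hZ,
        by rw [c.U_rk Z hZ, freeCone_rk_image_base hZ.1.subset_ground], hbase Z hZ⟩

end ConeConfig

open scoped Classical in
/-- A matroid with the same configuration as a free cone yields the data of a `ConeConfig`. -/
theorem SameConfiguration.nonempty_coneConfig {α : Type u} {β : Type v} {M : Matroid α} {m : ℕ}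
    [M.Finite] [M.Loopless] {N : Matroid β} [N.Finite] (hm : 0 < m)
    (h : (M.freeCone m).SameConfiguration N) : Nonempty (ConeConfig M m N) := by
  obtain ⟨hE, Φ, hΦ⟩ := h
  -- The lattice isomorphism as a total function on sets; the value `∅` off the cyclic flats is
  -- never used.
  let Ψ : Set (FreeConePoint α m) → Set β := fun F =>
    if hF : (M.freeCone m).IsCyclicFlat F then (Φ ⟨F, hF⟩).1 else ∅
  have hΨ : ∀ F (hF : (M.freeCone m).IsCyclicFlat F), Ψ F = (Φ ⟨F, hF⟩).1 := fun F hF =>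
    dif_pos hF
  have hcyc : ∀ F, (M.freeCone m).IsCyclicFlat F → N.IsCyclicFlat (Ψ F) := fun F hF => by
    rw [hΨ F hF]
    exact (Φ ⟨F, hF⟩).2
  have hsub : ∀ F G, (M.freeCone m).IsCyclicFlat F → (M.freeCone m).IsCyclicFlat G →
      (Ψ F ⊆ Ψ G ↔ F ⊆ G) := fun F G hF hG => by
    rw [hΨ F hF, hΨ G hG]
    exact Φ.le_iff_le (x := ⟨F, hF⟩) (y := ⟨G, hG⟩)
  have hcard : ∀ F, (M.freeCone m).IsCyclicFlat F → (Ψ F).ncard = F.ncard := fun F hF => by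
    rw [hΨ F hF, ncard, (hΦ ⟨F, hF⟩).1, ncard]
  have hrk : ∀ F, (M.freeCone m).IsCyclicFlat F → N.rk (Ψ F) = (M.freeCone m).rk F :=
    fun F hF => by rw [hΨ F hF, rk, (hΦ ⟨F, hF⟩).2, rk]
  have hsurj : ∀ G, N.IsCyclicFlat G → ∃ F, (M.freeCone m).IsCyclicFlat F ∧ G = Ψ F :=
    fun G hG => by
      refine ⟨(Φ.symm ⟨G, hG⟩).1, (Φ.symm ⟨G, hG⟩).2, ?_⟩
      rw [hΨ _ (Φ.symm ⟨G, hG⟩).2]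
      simp
  refine ⟨{
    D := fun X => Ψ (cone m X)
    U := fun Z => Ψ (FreeConePoint.base '' Z)
    D_cyc := fun X hX hne => hcyc _ (isCyclicFlat_cone hm hX hne)
    U_cyc := fun Z hZ => hcyc _ (isCyclicFlat_image_base hZ)
    D_ncard := fun X hX hne => by
      rw [hcard _ (isCyclicFlat_cone hm hX hne),
        ncard_cone (M.ground_finite.subset hX.subset_ground)]
    U_ncard := fun Z hZ => by
      rw [hcard _ (isCyclicFlat_image_base hZ),
        ncard_image_of_injective _ FreeConePoint.base_injective]
    D_rk := fun X hX hne => by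
      rw [hrk _ (isCyclicFlat_cone hm hX hne), freeCone_rk_cone hX.subset_ground]
    U_rk := fun Z hZ => by
      rw [hrk _ (isCyclicFlat_image_base hZ), freeCone_rk_image_base hZ.1.subset_ground]
    D_sub := fun X Y hX hX' hY hY' => by
      rw [hsub _ _ (isCyclicFlat_cone hm hX hX') (isCyclicFlat_cone hm hY hY'), cone_subset_cone]
    U_sub := fun Z W hZ hW => by
      rw [hsub _ _ (isCyclicFlat_image_base hZ) (isCyclicFlat_image_base hW),
        image_subset_image_iff FreeConePoint.base_injective]
    UD_sub := fun Z X hZ hX hX' => by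
      rw [hsub _ _ (isCyclicFlat_image_base hZ) (isCyclicFlat_cone hm hX hX'),
        image_base_subset_cone]
    DU_sub := fun X Z hX hX' hZ h => by
      rw [hsub _ _ (isCyclicFlat_cone hm hX hX') (isCyclicFlat_image_base hZ)] at h
      simpa using h (tip_mem_cone X)
    cases := fun G hG => by
      obtain ⟨F, hF, rfl⟩ := hsurj G hG
      obtain ⟨X, hX, hne, rfl⟩ | ⟨Z, hZ, rfl⟩ := hF.freeCone_cases
      · exact .inl ⟨X, hX, hne, rfl⟩
      · exact .inr ⟨Z, hZ, rfl⟩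
    ground := by
      rw [← ncard_cone M.ground_finite, ← freeCone_ground_eq_cone, ncard, ← hE, ncard] }⟩

theorem configurationUnique_freeCone {α : Type u} {M : Matroid α} {m : ℕ} [M.Finite] [M.Loopless]
    (hm : 0 < m) (hr : 2 < M.rk M.E) : ConfigurationUnique.{u, w} (M.freeCone m) :=
  fun _ _ _ h => (h.nonempty_coneConfig hm).elim fun c => c.isIsomorphic hr hm

end Matroid

namespace Matroid

/-! ### The `𝒢`-invariant and ranks along chains -/

section PrefixRank

variable {α : Type u} {β : Type v} {n : ℕ}

/-- The rank of the image of a set under an enumeration of the ground set. -/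
noncomputable def setRk (M : Matroid α) (σ : Fin n ≃ M.E) (S : Set (Fin n)) : ℕ :=
  M.rk ((fun i => (σ i : α)) '' S)

/-- The differences of consecutive values. -/
def diffList (n : ℕ) (R : ℕ → ℕ) : List ℕ := (List.range n).map fun i => R (i + 1) - R i

/-- The ranks of the initial segments of an enumeration of the ground set. -/
noncomputable def prefixRk (M : Matroid α) (σ : Fin n ≃ M.E) (k : ℕ) : ℕ :=
  M.setRk σ {i | i.1 < k}

theorem setOf_mem_take_ofFn (f : Fin n → α) (k : ℕ) :
    {x | x ∈ (List.ofFn f).take k} = f '' {i | i.1 < k} := by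
  ext x
  simp only [List.mem_take_iff_getElem, List.length_ofFn, List.getElem_ofFn, Set.mem_ofPred_eq,
    mem_image]
  constructor
  · rintro ⟨i, hi, rfl⟩
    exact ⟨⟨i, by omega⟩, by simp; omega, rfl⟩
  · rintro ⟨i, hi, rfl⟩
    exact ⟨i, by omega, rfl⟩

theorem rankSequence_ofFn (M : Matroid α) [M.RankFinite] (σ : Fin n ≃ M.E) :
    M.rankSequence (List.ofFn fun i => (σ i : α)) = diffList n (M.prefixRk σ) := by
  rw [rankSequence, diffList, List.length_ofFn]
  refine List.map_congr_left fun i _ => ?_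
  rw [setOf_mem_take_ofFn, setOf_mem_take_ofFn, ← cast_rk, ← cast_rk, ← ENat.natCast_sub,
    ENat.toNat_natCast]
  rfl

theorem gInvariant_eq_ncard (M : Matroid α) [M.Finite] (hn : M.E.ncard = n) (s : List ℕ) :
    M.gInvariant s = {σ : Fin n ≃ M.E | diffList n (M.prefixRk σ) = s}.ncard := by
  have hinj : Function.Injective
      (fun σ : Fin n ≃ M.E => List.ofFn fun i => (σ i : α)) := fun σ σ' h => by
    have := List.ofFn_injective h
    ext i
    exact congr_fun this i
  rw [gInvariant, ← ncard_image_of_injective _ hinj]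
  congr 1
  ext π
  simp only [Set.mem_ofPred_eq, mem_image]
  constructor
  · rintro ⟨hnd, hE, hs⟩
    have hlen : π.length = n := by
      classical
      rw [← hn, ← hE, ← List.toFinset_card_of_nodup hnd, ← ncard_coe_finset]
      congr 1
      ext; simp
    subst hlen
    have hmem : ∀ i : Fin π.length, π[i] ∈ M.E := fun i => by
      rw [← hE]
      exact List.getElem_mem i.2
    have hbij : Function.Bijective (fun i : Fin π.length => (⟨π[i], hmem i⟩ : M.E)) := by
      constructor
      · intro i j hij
        exact Fin.ext ((List.Nodup.getElem_inj_iff hnd).1 (Subtype.mk.inj hij))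
      · rintro ⟨x, hx⟩
        rw [← hE] at hx
        obtain ⟨i, hi, rfl⟩ := List.getElem_of_mem hx
        exact ⟨⟨i, hi⟩, rfl⟩
    have hπ : (List.ofFn fun i => ((Equiv.ofBijective _ hbij i : M.E) : α)) = π :=
      List.ofFn_getElem
    refine ⟨Equiv.ofBijective _ hbij, ?_, hπ⟩
    rw [← rankSequence_ofFn, hπ, hs]
  · rintro ⟨σ, hσ, rfl⟩
    refine ⟨List.nodup_ofFn.2 (Subtype.val_injective.comp σ.injective), ?_, ?_⟩
    · ext x
      simp only [List.mem_ofFn, Set.mem_ofPred_eq]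
      exact ⟨fun ⟨i, hi⟩ => hi ▸ (σ i).2, fun hx => ⟨σ.symm ⟨x, hx⟩, by simp⟩⟩
    · rw [rankSequence_ofFn, hσ]

theorem prefixRk_mono (M : Matroid α) [M.RankFinite] (σ : Fin n ≃ M.E) :
    Monotone (M.prefixRk σ) := fun _ _ hij =>
  M.rk_mono (image_mono fun _ hk => lt_of_lt_of_le hk hij)

theorem prefixRk_zero (M : Matroid α) (σ : Fin n ≃ M.E) : M.prefixRk σ 0 = 0 := by
  simp [prefixRk, setRk]

theorem prefixRk_of_le (M : Matroid α) (σ : Fin n ≃ M.E) {k : ℕ} (hk : n ≤ k) :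
    M.prefixRk σ k = M.prefixRk σ n := by
  rw [prefixRk, prefixRk]
  congr 1
  ext i
  simp only [Set.mem_ofPred_eq, i.2, iff_true]
  omega

/-- Monotonicity makes the truncated differences exact, so the sequences can be summed back. -/
theorem eq_of_diffList_eq {R R' : ℕ → ℕ} (h : diffList n R = diffList n R') (hR : Monotone R)
    (hR' : Monotone R') (h0 : R 0 = R' 0) {k : ℕ} (hk : k ≤ n) : R k = R' k := by
  induction k with
  | zero => exact h0
  | succ k ih =>
    have h1 := congr_arg (fun l => l[k]?) h
    simp only [diffList, List.getElem?_map, List.getElem?_range (show k < n by omega),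
      Option.map_some, Option.some.injEq] at h1
    have := ih (by omega)
    have := hR (Nat.le_succ k)
    have := hR' (Nat.le_succ k)
    simp only [Nat.succ_eq_add_one] at *
    omega

theorem exists_enumeration (M : Matroid α) [M.Finite] : Nonempty (Fin M.E.ncard ≃ M.E) := by
  have := M.ground_finite.to_subtype
  exact ⟨(Finite.equivFinOfCardEq rfl).symm⟩

/-- A vector counted with nonzero multiplicity has the size of the ground set as its length. -/
theorem ncard_ground_eq_of_gInvariant_eq {M : Matroid α} {N : Matroid β} [M.Finite] [N.Finite]
    (h : M.gInvariant = N.gInvariant) : M.E.ncard = N.E.ncard := by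
  obtain ⟨σ⟩ := M.exists_enumeration
  have := M.ground_finite.to_subtype
  have h1 := congr_fun h (diffList M.E.ncard (M.prefixRk σ))
  rw [M.gInvariant_eq_ncard rfl, N.gInvariant_eq_ncard rfl] at h1
  have h2 : 0 < {σ' : Fin M.E.ncard ≃ M.E |
      diffList M.E.ncard (M.prefixRk σ') = diffList M.E.ncard (M.prefixRk σ)}.ncard :=
    (ncard_pos (toFinite _)).2 ⟨σ, rfl⟩
  rw [h1] at h2
  obtain ⟨σ', hσ'⟩ := nonempty_of_ncard_ne_zero h2.ne'
  simpa [diffList] using (congr_arg List.length hσ').symm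

/-- Matroids with the same `𝒢`-invariant have enumerations of their ground sets that are matched
in such a way that the ranks of initial segments agree. -/
theorem exists_equiv_prefixRk {M : Matroid α} {N : Matroid β} [M.Finite] [N.Finite]
    (h : M.gInvariant = N.gInvariant) (hn : M.E.ncard = n) :
    ∃ e : (Fin n ≃ M.E) ≃ (Fin n ≃ N.E), ∀ σ k, N.prefixRk (e σ) k = M.prefixRk σ k := by
  have hn' : N.E.ncard = n := by rw [← ncard_ground_eq_of_gInvariant_eq h, hn]
  have := M.ground_finite.to_subtype
  have := N.ground_finite.to_subtype
  obtain ⟨e, he⟩ := exists_equiv_of_labels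
    (fun σ : Fin n ≃ M.E => diffList n (M.prefixRk σ))
    (fun σ : Fin n ≃ N.E => diffList n (N.prefixRk σ)) fun s => by
      rw [← M.gInvariant_eq_ncard hn, ← N.gInvariant_eq_ncard hn', h]
  have key : ∀ σ k, k ≤ n → N.prefixRk (e σ) k = M.prefixRk σ k := fun σ k hk =>
    eq_of_diffList_eq (he σ) (N.prefixRk_mono _) (M.prefixRk_mono _)
      (by rw [prefixRk_zero, prefixRk_zero]) hk
  refine ⟨e, fun σ k => ?_⟩
  obtain hk | hk := le_total k n
  · exact key σ k hk
  · rw [prefixRk_of_le _ _ hk, prefixRk_of_le _ _ hk, key σ n le_rfl]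

theorem exists_eq_setOf_lt {S : Set (Fin n)} (hS : IsLowerSet S) : ∃ k, S = {i | i.1 < k} := by
  classical
  by_cases h : ∃ k, ∃ hk : k < n, (⟨k, hk⟩ : Fin n) ∉ S
  · refine ⟨Nat.find h, ?_⟩
    obtain ⟨h1, h2⟩ := Nat.find_spec h
    ext i
    constructor
    · intro hi
      change i.1 < _
      by_contra! hle
      exact h2 (hS (Fin.le_def.2 hle) hi)
    · intro (hi : i.1 < _)
      by_contra hiS
      exact Nat.find_min h hi ⟨i.2, hiS⟩
  · push Not at h
    exact ⟨n, by ext i; simpa using h i i.2⟩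

/-- The sets in a chain can be moved simultaneously to initial segments. -/
theorem exists_perm_chain {C : ℕ → Set (Fin n)} (hC : Monotone C) :
    ∃ s : Equiv.Perm (Fin n), ∀ i, ∃ k, C i = s '' {j | j.1 < k} := by
  classical
  -- `f x` is the first index at which `x` enters the chain, `⊤` if it never does; sorting by `f`
  -- makes each `C i` an initial segment.
  let f : Fin n → WithTop ℕ := fun x => if h : ∃ i, x ∈ C i then (Nat.find h : ℕ) else ⊤
  have hf : ∀ x i, x ∈ C i ↔ f x ≤ (i : WithTop ℕ) := by
    intro x i
    by_cases h : ∃ i, x ∈ C i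
    · simp only [f, h, dite_true]
      rw [Nat.cast_le]
      exact ⟨fun hx => Nat.find_min' h hx, fun hle => hC hle (Nat.find_spec h)⟩
    · simp only [f, h, dite_false, top_le_iff, WithTop.natCast_ne_top, iff_false]
      exact fun hx => h ⟨i, hx⟩
  refine ⟨Tuple.sort f, fun i => ?_⟩
  have hlow : IsLowerSet (Tuple.sort f ⁻¹' C i) := fun x y hyx hx =>
    (hf _ _).2 ((Tuple.monotone_sort f hyx).trans ((hf _ _).1 hx))
  obtain ⟨k, hk⟩ := exists_eq_setOf_lt hlow
  exact ⟨k, by rw [← hk, image_preimage_eq _ (Equiv.surjective _)]⟩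

/-- Precomposing enumerations with the permutation of `exists_perm_chain` reduces a chain to initial
segments. One matching serves all members of the chain at once. -/
theorem exists_equiv_setRk_chain {M : Matroid α} {N : Matroid β} [M.Finite] [N.Finite]
    (h : M.gInvariant = N.gInvariant) (hn : M.E.ncard = n) {C : ℕ → Set (Fin n)}
    (hC : Monotone C) :
    ∃ e : (Fin n ≃ M.E) ≃ (Fin n ≃ N.E), ∀ σ i, N.setRk (e σ) (C i) = M.setRk σ (C i) := by
  obtain ⟨e, he⟩ := exists_equiv_prefixRk h hn
  obtain ⟨s, hs⟩ := exists_perm_chain hC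
  refine ⟨(Equiv.equivCongr s.symm (Equiv.refl _)).trans
    (e.trans (Equiv.equivCongr s (Equiv.refl _))), fun σ i => ?_⟩
  obtain ⟨k, hk⟩ := hs i
  have h1 := he (Equiv.equivCongr s.symm (Equiv.refl _) σ) k
  rw [prefixRk, prefixRk, setRk, setRk] at h1
  rw [setRk, setRk, hk, image_image, image_image]
  simpa using h1

end PrefixRank

/-! ### Counting by the place of a switch -/

section Counting

theorem ncard_setOf_eq_sum {T : Type u} [Fintype T] (P : T → Prop) [DecidablePred P] :
    {t | P t}.ncard = ∑ t, if P t then 1 else 0 := by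
  rw [← Finset.card_filter, ← ncard_coe_finset]
  congr 1
  ext; simp

/-- Counting by the last index at which an antitone predicate holds. -/
theorem ncard_eq_sum_last {T : Type u} [Finite T] {u v : T → ℕ → ℕ} {b : T → ℕ → Prop}
    {R : T → ℕ → ℕ} {K : ℕ} (hb : ∀ t, Antitone (b t)) (h0 : ∀ t, b t 0) (hK : ∀ t, ¬ b t K)
    (hu : ∀ t i, b t i → R t i = u t i) (hv : ∀ t i, ¬ b t i → R t i = v t i)
    (p : (ℕ → ℕ) → Prop) :
    {t | p (R t)}.ncard = ∑ k ∈ Finset.range K,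
      ({t | b t k ∧ p (fun i => if i ≤ k then u t i else v t i)}.ncard -
        {t | b t (k + 1) ∧ p (fun i => if i ≤ k then u t i else v t i)}.ncard) := by
  have hR : ∀ t k, b t k → ¬ b t (k + 1) → R t = fun i => if i ≤ k then u t i else v t i := by
    intro t k h1 h2
    funext i
    split_ifs with hi
    · exact hu t i (hb t hi h1)
    · exact hv t i fun h => h2 (hb t (by omega) h)
  have hunion : {t | p (R t)} =
      ⋃ k ∈ Finset.range K, {t | b t k ∧ ¬ b t (k + 1) ∧ p (R t)} := by
    ext t
    simp only [Set.mem_ofPred_eq, mem_iUnion, Finset.mem_range, exists_prop]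
    constructor
    · intro hp
      classical
      have hex : ∃ k, ¬ b t k := ⟨K, hK t⟩
      have hpos : Nat.find hex ≠ 0 := fun h => Nat.find_spec hex (h ▸ h0 t)
      obtain ⟨k, hk⟩ := Nat.exists_eq_succ_of_ne_zero hpos
      have hle : Nat.find hex ≤ K := Nat.find_min' hex (hK t)
      refine ⟨k, by omega, ?_, ?_, hp⟩
      · exact not_not.1 (Nat.find_min hex (m := k) (by omega))
      · rw [← Nat.succ_eq_add_one, ← hk]
        exact Nat.find_spec hex
    · rintro ⟨k, -, -, -, hp⟩
      exact hp
  rw [hunion, ncard_biUnion_finset _ _ (fun _ _ => toFinite _)]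
  · refine Finset.sum_congr rfl fun k _ => ?_
    -- Both counts use the sequence that switches after `k`, so their difference keeps exactly those
    -- `t` whose last index is `k`.
    rw [← ncard_sdiff]
    · congr 1
      ext t
      simp only [Set.mem_ofPred_eq, mem_sdiff]
      constructor
      · rintro ⟨h1, h2, h3⟩
        rw [hR t k h1 h2] at h3
        exact ⟨⟨h1, h3⟩, fun h => h2 h.1⟩
      · rintro ⟨⟨h1, h2⟩, h3⟩
        have h4 : ¬ b t (k + 1) := fun h => h3 ⟨h, h2⟩
        exact ⟨h1, h4, by rwa [hR t k h1 h4]⟩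
    · exact fun t ht => ⟨hb t (Nat.le_succ k) ht.1, ht.2⟩
  · intro i _ j _ hij
    rw [disjoint_left]
    rintro t ⟨h1, h2, -⟩ ⟨h3, h4, -⟩
    obtain h | h := lt_or_gt_of_ne hij
    · exact h2 (hb t h h3)
    · exact h4 (hb t h h1)

end Counting

/-! ### The `𝒢`-invariant of the free cone -/

section ConeEnumeration

variable {α : Type u} {β : Type v} {m n : ℕ}

/-- The map between elements of free cones that is induced by a map between elements. -/
def FreeConePoint.map (m : ℕ) (f : α → β) : FreeConePoint α m → FreeConePoint β m
  | .base x => .base (f x)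
  | .tip => .tip
  | .pt x i => .pt (f x) i

theorem FreeConePoint.map_injective {f : α → β} (hf : Function.Injective f) :
    Function.Injective (FreeConePoint.map m f) := by
  intro x y h
  cases x <;> cases y <;> simp_all [FreeConePoint.map, hf.eq_iff]

theorem tip_mem_image_map {f : α → β} {Y : Set (FreeConePoint α m)} :
    .tip ∈ FreeConePoint.map m f '' Y ↔ .tip ∈ Y := by
  constructor
  · rintro ⟨y, hy, h⟩
    cases y with
    | tip => exact hy
    | base x => cases h
    | pt x i => cases h
  · exact fun h => ⟨_, h, rfl⟩

theorem coneBase_image_map (f : α → β) (Y : Set (FreeConePoint α m)) :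
    coneBase (FreeConePoint.map m f '' Y) = f '' coneBase Y := by
  ext x
  constructor
  · rintro ⟨y, hy, h⟩
    cases y with
    | tip => cases h
    | base z => exact ⟨z, hy, FreeConePoint.base.inj h⟩
    | pt z i => cases h
  · rintro ⟨z, hz, rfl⟩
    exact ⟨_, hz, rfl⟩

theorem coneProj_image_map (f : α → β) (Y : Set (FreeConePoint α m)) :
    coneProj (FreeConePoint.map m f '' Y) = f '' coneProj Y := by
  ext x
  constructor
  · rintro (⟨y, hy, h⟩ | ⟨i, y, hy, h⟩)
    · cases y with
      | tip => cases h
      | base z => exact ⟨z, .inl hy, FreeConePoint.base.inj h⟩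
      | pt z i => cases h
    · cases y with
      | tip => cases h
      | base z => cases h
      | pt z j => exact ⟨z, .inr ⟨j, hy⟩, (FreeConePoint.pt.inj h).1⟩
  · rintro ⟨z, hz | ⟨i, hz⟩, rfl⟩
    · exact .inl ⟨_, hz, rfl⟩
    · exact .inr ⟨i, _, hz, rfl⟩

theorem conePts_image_map (f : α → β) (Y : Set (FreeConePoint α m)) :
    conePts (FreeConePoint.map m f '' Y) = FreeConePoint.map m f '' conePts Y := by
  ext x
  constructor
  · rintro ⟨⟨y, hy, rfl⟩, z, i, h⟩
    cases y with
    | tip => cases h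
    | base x => cases h
    | pt x j => exact ⟨_, ⟨hy, x, j, rfl⟩, rfl⟩
  · rintro ⟨_, ⟨hy, x, j, rfl⟩, rfl⟩
    exact ⟨⟨_, hy, rfl⟩, _, _, rfl⟩

variable (M : Matroid α) [M.Finite]

/-- The enumeration of the ground set of the free cone that is induced by an enumeration of the
ground set. -/
noncomputable def coneEquiv (m : ℕ) (τ : Fin n ≃ M.E) :
    FreeConePoint (Fin n) m ≃ (M.freeCone m).E :=
  Equiv.ofBijective (fun y => ⟨FreeConePoint.map m (fun i => (τ i : α)) y, by
      cases y <;> simp [FreeConePoint.map]⟩) ⟨fun x y h =>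
    FreeConePoint.map_injective (Subtype.val_injective.comp τ.injective) (Subtype.mk.inj h), by
      rintro ⟨y, hy⟩
      cases y with
      | tip => exact ⟨.tip, rfl⟩
      | base x => exact ⟨.base (τ.symm ⟨x, by simpa using hy⟩), by simp [FreeConePoint.map]⟩
      | pt x i => exact ⟨.pt (τ.symm ⟨x, by simpa using hy⟩) i, by simp [FreeConePoint.map]⟩⟩

/-- The tip is not spanned by the image of `Y`. -/
def Balanced (τ : Fin n ≃ M.E) (Y : Set (FreeConePoint (Fin n) m)) : Prop :=
  .tip ∉ Y ∧ M.setRk τ (coneBase Y) + (conePts Y).ncard < M.setRk τ (coneProj Y) + 1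

variable {M}

theorem map_enumeration_injective (τ : Fin n ≃ M.E) :
    Function.Injective (FreeConePoint.map m (fun i => (τ i : α))) :=
  FreeConePoint.map_injective (Subtype.val_injective.comp τ.injective)

theorem image_coneEquiv_subset (τ : Fin n ≃ M.E) (Y : Set (FreeConePoint (Fin n) m)) :
    FreeConePoint.map m (fun i => (τ i : α)) '' Y ⊆ (M.freeCone m).E := by
  rintro _ ⟨y, -, rfl⟩
  exact (M.coneEquiv m τ y).2

theorem rk_image_map_of_balanced {τ : Fin n ≃ M.E} {Y : Set (FreeConePoint (Fin n) m)}
    (h : M.Balanced τ Y) :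
    (M.freeCone m).rk (FreeConePoint.map m (fun i => (τ i : α)) '' Y) =
      M.setRk τ (coneBase Y) + (conePts Y).ncard := by
  rw [freeCone_rk_of_tip_notMem M (image_coneEquiv_subset τ Y) (by rw [tip_mem_image_map]; exact h.1),
    coneBase_image_map, coneProj_image_map, conePts_image_map, ncard_image_of_injective _
      (map_enumeration_injective τ)]
  exact min_eq_left h.2.le

theorem rk_image_map_of_not_balanced {τ : Fin n ≃ M.E} {Y : Set (FreeConePoint (Fin n) m)}
    (h : ¬ M.Balanced τ Y) :
    (M.freeCone m).rk (FreeConePoint.map m (fun i => (τ i : α)) '' Y) =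
      M.setRk τ (coneProj Y) + 1 := by
  by_cases ht : .tip ∈ Y
  · rw [freeCone_rk_of_tip_mem M (image_coneEquiv_subset τ Y) (tip_mem_image_map.2 ht),
      coneProj_image_map]
    rfl
  · rw [freeCone_rk_of_tip_notMem M (image_coneEquiv_subset τ Y)
      (by rwa [tip_mem_image_map]), coneBase_image_map, coneProj_image_map, conePts_image_map,
      ncard_image_of_injective _ (map_enumeration_injective τ)]
    exact min_eq_right (not_lt.1 fun h' => h ⟨ht, h'⟩)

/-- In this form it is clear that subsets of balanced sets are balanced, which the defining
inequality does not show. -/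
theorem balanced_iff {τ : Fin n ≃ M.E} {Y : Set (FreeConePoint (Fin n) m)} :
    M.Balanced τ Y ↔
      .tip ∉ (M.freeCone m).closure (FreeConePoint.map m (fun i => (τ i : α)) '' Y) := by
  rw [mem_closure_iff_rk (tip_mem_freeCone M), freeCone_rk_insert_tip (image_coneEquiv_subset τ Y),
    coneProj_image_map]
  change _ ↔ ¬ M.setRk τ (coneProj Y) + 1 = _
  by_cases h : M.Balanced τ Y
  · rw [rk_image_map_of_balanced h]
    simp only [h, true_iff]
    exact h.2.ne'
  · rw [rk_image_map_of_not_balanced h]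
    simp [h]

theorem Balanced.subset {τ : Fin n ≃ M.E} {Y Z : Set (FreeConePoint (Fin n) m)}
    (h : M.Balanced τ Y) (hZ : Z ⊆ Y) : M.Balanced τ Z := by
  rw [balanced_iff] at h ⊢
  exact fun h' => h ((M.freeCone m).closure_subset_closure (image_mono hZ) h')

theorem balanced_empty (τ : Fin n ≃ M.E) :
    M.Balanced τ (∅ : Set (FreeConePoint (Fin n) m)) := by
  simp [Balanced, setRk]

/-- For a fixed enumeration of the elements of the free cone of a set, the number of enumerations
of the ground set that give prescribed ranks depends only on the `𝒢`-invariant. -/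
theorem ncard_prefixRk_cone_eq {N : Matroid β} [N.Finite] (h : M.gInvariant = N.gInvariant)
    (hn : M.E.ncard = n) {K : ℕ} (σ : Fin K ≃ FreeConePoint (Fin n) m) (p : (ℕ → ℕ) → Prop) :
    {τ : Fin n ≃ M.E | p ((M.freeCone m).prefixRk (σ.trans (M.coneEquiv m τ)))}.ncard =
      {τ : Fin n ≃ N.E | p ((N.freeCone m).prefixRk (σ.trans (N.coneEquiv m τ)))}.ncard := by
  have := M.ground_finite.to_subtype
  have := N.ground_finite.to_subtype
  let P : ℕ → Set (FreeConePoint (Fin n) m) := fun k => σ '' {i | i.1 < k}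
  have hP : Monotone P := fun i j hij => image_mono fun k (hk : k.1 < i) => hk.trans_le hij
  have hP0 : P 0 = ∅ := by simp [P]
  have hPK : .tip ∈ P K := ⟨σ.symm .tip, (σ.symm .tip).2, by simp⟩
  have himM : ∀ (τ : Fin n ≃ M.E) k, (M.freeCone m).prefixRk (σ.trans (M.coneEquiv m τ)) k =
      (M.freeCone m).rk (FreeConePoint.map m (fun i => (τ i : α)) '' P k) := fun τ k => by
    rw [prefixRk, setRk, image_image]
    rfl
  have himN : ∀ (τ : Fin n ≃ N.E) k, (N.freeCone m).prefixRk (σ.trans (N.coneEquiv m τ)) k =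
      (N.freeCone m).rk (FreeConePoint.map m (fun i => (τ i : β)) '' P k) := fun τ k => by
    rw [prefixRk, setRk, image_image]
    rfl
  rw [ncard_eq_sum_last (K := K) (b := fun τ k => M.Balanced τ (P k))
      (u := fun τ k => M.setRk τ (coneBase (P k)) + (conePts (P k)).ncard)
      (v := fun τ k => M.setRk τ (coneProj (P k)) + 1)
      (fun τ i j hij hb => hb.subset (hP hij)) (fun τ => hP0 ▸ balanced_empty τ)
      (fun τ hb => hb.1 hPK)
      (fun τ i hb => by rw [himM]; exact rk_image_map_of_balanced hb)
      (fun τ i hb => by rw [himM]; exact rk_image_map_of_not_balanced hb),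
    ncard_eq_sum_last (K := K) (b := fun τ k => N.Balanced τ (P k))
      (u := fun τ k => N.setRk τ (coneBase (P k)) + (conePts (P k)).ncard)
      (v := fun τ k => N.setRk τ (coneProj (P k)) + 1)
      (fun τ i j hij hb => hb.subset (hP hij)) (fun τ => hP0 ▸ balanced_empty τ)
      (fun τ hb => hb.1 hPK)
      (fun τ i hb => by rw [himN]; exact rk_image_map_of_balanced hb)
      (fun τ i hb => by rw [himN]; exact rk_image_map_of_not_balanced hb)]
  have hchain : ∀ k, ∃ e : (Fin n ≃ M.E) ≃ (Fin n ≃ N.E),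
      (∀ τ i, i ≤ k → N.setRk (e τ) (coneBase (P i)) = M.setRk τ (coneBase (P i))) ∧
      ∀ τ i, k ≤ i → N.setRk (e τ) (coneProj (P i)) = M.setRk τ (coneProj (P i)) := by
    intro k
    -- Base parts up to index `k`, then projections. The shift by one lets both the base part and
    -- the projection of `P k` occur, as balance at `k` compares the two.
    obtain ⟨e, he⟩ := exists_equiv_setRk_chain h hn
      (C := fun i => if i ≤ k then coneBase (P i) else coneProj (P (i - 1))) (by
        intro i j hij
        dsimp only
        split_ifs with h1 h2 h2
        · exact coneBase_mono (hP hij)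
        · exact (coneBase_mono (hP (by omega))).trans (coneBase_subset_coneProj _)
        · omega
        · exact coneProj_mono (hP (by omega)))
    refine ⟨e, fun τ i hi => ?_, fun τ i hi => ?_⟩
    · simpa [hi] using he τ i
    · simpa [show ¬ i + 1 ≤ k by omega] using he τ (i + 1)
  have hcount : ∀ (S : Set (Fin n ≃ M.E)) (S' : Set (Fin n ≃ N.E))
      (e : (Fin n ≃ M.E) ≃ (Fin n ≃ N.E)), (∀ τ, e τ ∈ S' ↔ τ ∈ S) → S.ncard = S'.ncard := by
    intro S S' e he
    rw [← ncard_image_of_injective S e.injective]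
    congr 1
    ext τ
    rw [e.image_eq_preimage_symm, mem_preimage, ← he, e.apply_symm_apply]
  refine Finset.sum_congr rfl fun k _ => congr_arg₂ _ ?_ ?_
  · obtain ⟨e, he1, he2⟩ := hchain k
    refine hcount _ _ e fun τ => ?_
    simp only [Set.mem_ofPred_eq, Balanced, he1 τ k le_rfl, he2 τ k le_rfl]
    refine and_congr_right fun _ => iff_of_eq (congr_arg p (funext fun i => ?_))
    split_ifs with hi
    · rw [he1 τ i hi]
    · rw [he2 τ i (by omega)]
  · obtain ⟨e, he1, he2⟩ := hchain (k + 1)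
    refine hcount _ _ e fun τ => ?_
    simp only [Set.mem_ofPred_eq, Balanced, he1 τ (k + 1) le_rfl, he2 τ (k + 1) le_rfl]
    refine and_congr_right fun _ => iff_of_eq (congr_arg p (funext fun i => ?_))
    split_ifs with hi
    · rw [he1 τ i (by omega)]
    · rw [he2 τ i (by omega)]

/-- Double counting of pairs `(σ, τ)`: for each fixed `τ`, the orders `σ` of the abstract cone run
through all enumerations of the free cone exactly once. -/
theorem gInvariant_freeCone_mul [Fintype (Fin n ≃ M.E)] {K : ℕ}
    [Fintype (Fin K ≃ FreeConePoint (Fin n) m)] (hK : (M.freeCone m).E.ncard = K) (s : List ℕ) :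
    Fintype.card (Fin n ≃ M.E) * (M.freeCone m).gInvariant s =
      ∑ σ : Fin K ≃ FreeConePoint (Fin n) m, {τ : Fin n ≃ M.E |
        diffList K ((M.freeCone m).prefixRk (σ.trans (M.coneEquiv m τ))) = s}.ncard := by
  classical
  have := (M.freeCone m).ground_finite.to_subtype
  have : Fintype (Fin K ≃ (M.freeCone m).E) := Fintype.ofFinite _
  simp only [gInvariant_eq_ncard _ hK, ncard_setOf_eq_sum]
  rw [Finset.sum_comm, ← smul_eq_mul, ← Finset.card_univ, ← Finset.sum_const]
  refine Finset.sum_congr rfl fun τ _ => ?_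
  exact (Equiv.sum_comp (Equiv.equivCongr (Equiv.refl (Fin K)) (M.coneEquiv m τ)) _).symm

/-- The `𝒢`-invariant of the free cone is determined by the `𝒢`-invariant of the matroid. -/
theorem gInvariant_freeCone_eq {N : Matroid β} [N.Finite] (h : M.gInvariant = N.gInvariant) :
    (M.freeCone m).gInvariant = (N.freeCone m).gInvariant := by
  classical
  funext s
  have hN := ncard_ground_eq_of_gInvariant_eq h
  have := M.ground_finite.to_subtype
  have := N.ground_finite.to_subtype
  have := (M.freeCone m).ground_finite.to_subtype
  have := Fintype.ofFinite (Fin M.E.ncard ≃ M.E)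
  have := Fintype.ofFinite (Fin M.E.ncard ≃ N.E)
  obtain ⟨τ⟩ := M.exists_enumeration
  have : Finite (FreeConePoint (Fin M.E.ncard) m) := Finite.of_equiv _ (M.coneEquiv m τ).symm
  have := Fintype.ofFinite (Fin (M.freeCone m).E.ncard ≃ FreeConePoint (Fin M.E.ncard) m)
  have hK : (N.freeCone m).E.ncard = (M.freeCone m).E.ncard := by
    rw [freeCone_ground_eq_cone, freeCone_ground_eq_cone, ncard_cone M.ground_finite,
      ncard_cone N.ground_finite, hN]
  have h1 := gInvariant_freeCone_mul (M := M) (m := m) (n := M.E.ncard) rfl s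
  have h2 := gInvariant_freeCone_mul (M := N) (m := m) (n := M.E.ncard) hK s
  obtain ⟨e, -⟩ := exists_equiv_prefixRk h rfl
  rw [← Fintype.card_congr e] at h2
  refine Nat.eq_of_mul_eq_mul_left (Fintype.card_pos_iff.2 ⟨τ⟩) (h1.trans (Eq.trans ?_ h2.symm))
  exact Finset.sum_congr rfl fun σ _ =>
    ncard_prefixRk_cone_eq h rfl σ fun R => diffList _ R = s

end ConeEnumeration

end Matroid

namespace Matroid

/-! ### Recovering a matroid from its free cone -/

section Recovery

variable {α : Type u} {β : Type v} {m : ℕ} {M : Matroid α} {N : Matroid β} [M.Finite] [N.Finite]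

/-- The element `y` of the free cone, other than the tip, projects from the tip to `e`. -/
def IsOver : FreeConePoint α m → α → Prop
  | .base x, e => x = e
  | .tip, _ => False
  | .pt x _, e => x = e

theorem IsOver.ne_tip {y : FreeConePoint α m} {e : α} (h : IsOver y e) : y ≠ .tip := by
  rintro rfl
  exact h

theorem exists_isOver {y : FreeConePoint α m} (h : y ≠ .tip) : ∃ e, IsOver y e := by
  cases y with
  | tip => exact (h rfl).elim
  | base x => exact ⟨x, rfl⟩
  | pt x i => exact ⟨x, rfl⟩

theorem IsOver.eq {y : FreeConePoint α m} {e f : α} (h : IsOver y e) (h' : IsOver y f) :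
    e = f := by
  cases y with
  | tip => exact h.elim
  | base x => exact Eq.trans (Eq.symm h) h'
  | pt x i => exact Eq.trans (Eq.symm h) h'

theorem IsOver.mem_ground_iff {y : FreeConePoint α m} {e : α} (h : IsOver y e) :
    y ∈ (M.freeCone m).E ↔ e ∈ M.E := by
  cases y with
  | tip => exact h.elim
  | base x => obtain rfl : x = e := h; simp
  | pt x i => obtain rfl : x = e := h; simp

theorem IsOver.coneProj_insert {y : FreeConePoint α m} {e : α} (h : IsOver y e)
    (Y : Set (FreeConePoint α m)) : coneProj (insert y Y) = insert e (coneProj Y) := by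
  cases y with
  | tip => exact h.elim
  | base x => obtain rfl : x = e := h; simp
  | pt x i => obtain rfl : x = e := h; simp

theorem mem_coneProj_iff {Y : Set (FreeConePoint α m)} {x : α} :
    x ∈ coneProj Y ↔ ∃ y ∈ Y, IsOver y x := by
  constructor
  · rintro (h | ⟨i, h⟩)
    · exact ⟨_, h, rfl⟩
    · exact ⟨_, h, rfl⟩
  · rintro ⟨y, hy, h⟩
    cases y with
    | tip => exact h.elim
    | base x => obtain rfl := h; exact .inl hy
    | pt x i => obtain rfl := h; exact .inr ⟨i, hy⟩

/-- A set of elements is independent together with the tip if and only if it is independent after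
projection. -/
theorem freeCone_indep_insert_tip_iff {J : Set (FreeConePoint α m)} (hJ : J ⊆ (M.freeCone m).E)
    (ht : .tip ∉ J) :
    (M.freeCone m).Indep (insert .tip J) ↔ J.ncard ≤ M.rk (coneProj J) := by
  have hfin := (M.freeCone m).ground_finite.subset hJ
  rw [indep_iff_rk (hfin.insert _), freeCone_rk_insert_tip hJ, ncard_insert_of_notMem ht hfin]
  have := rk_coneProj_le M hfin
  rw [sdiff_singleton_eq_self ht] at this
  omega

theorem freeCone_indep_tip_pair_iff [M.Loopless] {y z : FreeConePoint α m} {e f : α}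
    (hy : y ∈ (M.freeCone m).E) (hz : z ∈ (M.freeCone m).E) (hye : IsOver y e) (hzf : IsOver z f)
    (hne : y ≠ z) :
    (M.freeCone m).Indep {.tip, y, z} ↔ M.closure {e} ≠ M.closure {f} := by
  have he := hye.mem_ground_iff.1 hy
  have hf := hzf.mem_ground_iff.1 hz
  rw [freeCone_indep_insert_tip_iff (pair_subset hy hz)
    (by simp [hye.ne_tip.symm, hzf.ne_tip.symm]), ncard_pair hne, hye.coneProj_insert,
    ← insert_empty_eq z, hzf.coneProj_insert, coneProj_empty]
  by_cases h : e ∈ M.closure {f}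
  · have h1 := M.rk_singleton hf
    rw [insert_empty_eq, rk_insert_eq h, h1, closure_singleton_eq_of_mem h]
    simp
  · rw [insert_empty_eq, rk_insert_eq_add_one he h, rk_singleton hf]
    simp only [le_refl, true_iff]
    exact fun h' => h (h' ▸ M.mem_closure_self e he)

/-- These are the parallel classes after contracting the tip. Their sizes determine those of the
parallel classes of `M`. -/
theorem ncard_isOver_closure [M.Loopless] (e : α) :
    {y : FreeConePoint α m | ∃ f ∈ M.E, IsOver y f ∧ M.closure {f} = M.closure {e}}.ncard =
      (m + 1) * (M.closure {e}).ncard := by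
  have hcl := M.closure_subset_ground {e}
  have h1 : {y : FreeConePoint α m | ∃ f ∈ M.E, IsOver y f ∧ M.closure {f} = M.closure {e}} =
      cone m (M.closure {e}) \ {.tip} := by
    have hiff : ∀ x, (x ∈ M.E ∧ M.closure {x} = M.closure {e}) ↔ x ∈ M.closure {e} := fun x =>
      ⟨fun h => h.2 ▸ M.mem_closure_self x h.1, fun h => ⟨hcl h, closure_singleton_eq_of_mem h⟩⟩
    ext y
    cases y with
    | tip => simp [IsOver]
    | base x => simp [IsOver, ← hiff]
    | pt x i => simp [IsOver, ← hiff]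
  rw [h1, ncard_sdiff_singleton_of_mem (tip_mem_cone _), ncard_cone (M.ground_finite.subset hcl)]
  omega

theorem closure_image_congr {ι : Type w} {f g : ι → α} {I : Set ι}
    (h : ∀ i ∈ I, M.closure {f i} = M.closure {g i}) : M.closure (f '' I) = M.closure (g '' I) := by
  have := M.closure_biUnion_congr (fun i => {f i}) (fun i => {g i}) I h
  simpa only [biUnion_of_singleton, ← image_eq_iUnion] using this

theorem IsIsomorphic.exists_bijOn [Nonempty β] (h : M.IsIsomorphic N) :
    ∃ ψ : α → β, BijOn ψ M.E N.E ∧ ∀ I ⊆ M.E, (M.Indep I ↔ N.Indep (ψ '' I)) := by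
  classical
  obtain ⟨φ, hφ⟩ := h
  let ψ : α → β := fun x => if hx : x ∈ M.E then φ ⟨x, hx⟩ else Classical.arbitrary β
  have hψ : ∀ x : M.E, ψ x = φ x := fun x => dif_pos x.2
  refine ⟨ψ, ⟨fun x hx => ?_, fun x hx y hy hxy => ?_, fun y hy => ?_⟩, fun I hI => ?_⟩
  · rw [hψ ⟨x, hx⟩]
    exact (φ _).2
  · rw [hψ ⟨x, hx⟩, hψ ⟨y, hy⟩] at hxy
    exact Subtype.mk.inj (φ.injective (Subtype.val_injective hxy))
  · exact ⟨φ.symm ⟨y, hy⟩, (φ.symm ⟨y, hy⟩).2, by rw [hψ]; simp⟩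
  · have h1 := hφ (Subtype.val ⁻¹' I)
    rw [Subtype.image_preimage_coe, inter_eq_self_of_subset_right hI] at h1
    rw [h1, image_image]
    have h2 : ψ '' I = (fun x : M.E => ψ x) '' (Subtype.val ⁻¹' I) := by
      rw [← image_image ψ Subtype.val, Subtype.image_preimage_coe,
        inter_eq_self_of_subset_right hI]
    simp only [h2, hψ]

/-- An isomorphism between free cones preserves the tip. -/
theorem map_tip_eq_tip [M.Loopless] [N.Loopless] (hm : 0 < m) (hr : 1 < M.rk M.E)
    {ψ : FreeConePoint α m → FreeConePoint β m}
    (hψ : BijOn ψ (M.freeCone m).E (N.freeCone m).E)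
    (hI : ∀ I ⊆ (M.freeCone m).E, ((M.freeCone m).Indep I ↔ (N.freeCone m).Indep (ψ '' I))) :
    ψ .tip = .tip := by
  obtain ⟨b, hb, hbt⟩ := hψ.surjOn (tip_mem_freeCone N)
  by_cases hbtip : b = .tip
  · rwa [hbtip] at hbt
  exfalso
  obtain ⟨x, hbx⟩ := exists_isOver hbtip
  have hx : x ∈ M.E := hbx.mem_ground_iff.1 hb
  obtain ⟨e, he, hex⟩ := exists_notMem_closure_of_ncard_lt (M := M) (X := {x}) (by simp)
    (by simpa using hr)
  have hxe : x ≠ e := fun h => hex (h ▸ M.mem_closure_self x hx)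
  -- If `b ≠ tip` is mapped to the tip, take an added point `y` on another line; it puts no
  -- constraint on base parts. The image of `y` lies on a line through the tip with a further
  -- element `ψ z`, so `{b, y, z}` has dependent image.
  set y : FreeConePoint α m := .pt e ⟨0, hm⟩ with hydef
  have hy : y ∈ (M.freeCone m).E := by simpa [hydef] using he
  have hye : IsOver y e := rfl
  have hyb : y ≠ b := fun h => hxe (hbx.eq (h ▸ hye))
  have hyt : ψ y ≠ .tip := fun h => hyb (hψ.injOn hy hb (h.trans hbt.symm))
  obtain ⟨f, hf⟩ := exists_isOver hyt
  have hfE : f ∈ N.E := hf.mem_ground_iff.1 (hψ.mapsTo hy)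
  obtain ⟨z', hz'y, hz'⟩ : ∃ z', z' ≠ ψ y ∧ IsOver z' f := by
    by_cases h : ψ y = .base f
    · exact ⟨.pt f ⟨0, hm⟩, by rw [h]; simp, rfl⟩
    · exact ⟨.base f, Ne.symm h, rfl⟩
  have hz'E : z' ∈ (N.freeCone m).E := hz'.mem_ground_iff.2 hfE
  obtain ⟨z, hz, rfl⟩ := hψ.surjOn hz'E
  have hdep : ¬ (N.freeCone m).Indep (ψ '' {b, y, z}) := by
    rw [image_insert_eq, image_pair, hbt,
      freeCone_indep_tip_pair_iff (hψ.mapsTo hy) hz'E hf hz' hz'y.symm]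
    simp
  have hbz : (M.freeCone m).Indep {b, z} := by
    rw [hI _ (pair_subset hb hz), image_pair, hbt,
      freeCone_indep_insert_tip_iff (singleton_subset_iff.2 hz'E)
        (by simpa using hz'.ne_tip.symm), ← insert_empty_eq (ψ z), hz'.coneProj_insert,
      coneProj_empty, insert_empty_eq, insert_empty_eq, rk_singleton hfE, ncard_singleton]
  have hsub : {b, y, z} ⊆ (M.freeCone m).E := insert_subset hb (pair_subset hy hz)
  rw [← hI _ hsub] at hdep
  -- Yet `{b, y, z}` is independent: its base part is that of the independent set `{b, z}`, and its
  -- projection has rank at least two, allowing three elements.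
  refine hdep (freeCone_indep_iff M |>.2 ⟨hsub, ?_, ?_⟩)
  · rw [insert_comm, hydef, coneBase_insert_pt]
    exact ((freeCone_indep_iff M).1 hbz).2.1
  · have h1 : ({b, y, z} : Set (FreeConePoint α m)).ncard ≤ 3 := by
      refine (ncard_insert_le _ _).trans ?_
      have := ncard_insert_le y {z}
      rw [ncard_singleton] at this
      omega
    have h2 : {e, x} ⊆ coneProj {b, y, z} :=
      pair_subset (mem_coneProj_iff.2 ⟨y, by simp, hye⟩) (mem_coneProj_iff.2 ⟨b, by simp, hbx⟩)
    have h3 := M.rk_mono h2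
    rw [rk_insert_eq_add_one he hex, rk_singleton hx] at h3
    omega

/-- A loopless matroid of rank at least two can be recovered from its free cone. -/
theorem isIsomorphic_of_freeCone [M.Loopless] [N.Loopless] (hm : 0 < m) (hr : 1 < M.rk M.E)
    (h : (M.freeCone m).IsIsomorphic (N.freeCone m)) : M.IsIsomorphic N := by
  have : Nonempty (FreeConePoint β m) := ⟨.tip⟩
  obtain ⟨ψ, hψ, hI⟩ := h.exists_bijOn
  have htip := map_tip_eq_tip hm hr hψ hI
  have hne : ∀ y ∈ (M.freeCone m).E, y ≠ .tip → ψ y ≠ .tip := fun y hy hyt h =>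
    hyt (hψ.injOn hy (tip_mem_freeCone M) (h.trans htip.symm))
  have hpar : ∀ y ∈ (M.freeCone m).E, ∀ z ∈ (M.freeCone m).E, ∀ e f e' f', IsOver y e →
      IsOver z f → IsOver (ψ y) e' → IsOver (ψ z) f' →
      (M.closure {e} = M.closure {f} ↔ N.closure {e'} = N.closure {f'}) := by
    intro y hy z hz e f e' f' hye hzf hye' hzf'
    by_cases hyz : y = z
    · subst hyz
      rw [hye.eq hzf, hye'.eq hzf']
      simp
    · have h1 := freeCone_indep_tip_pair_iff hy hz hye hzf hyz
      rw [hI _ (insert_subset (tip_mem_freeCone M) (pair_subset hy hz)), image_insert_eq,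
        image_pair, htip, freeCone_indep_tip_pair_iff (hψ.mapsTo hy) (hψ.mapsTo hz) hye' hzf'
          fun h => hyz (hψ.injOn hy hz h)] at h1
      exact (not_iff_not.1 h1).symm
  have hbase : ∀ x ∈ M.E, .base x ∈ (M.freeCone m).E := fun x hx => by simpa using hx
  have hex : ∀ x : M.E, ∃ p, IsOver (ψ (.base x)) p := fun x =>
    exists_isOver (hne _ (hbase x x.2) (by simp))
  choose p hp using hex
  have hpE : ∀ x : M.E, p x ∈ N.E := fun x =>
    (hp x).mem_ground_iff.1 (hψ.mapsTo (hbase x x.2))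
  have := M.ground_finite.to_subtype
  have := N.ground_finite.to_subtype
  -- The map `p` respects parallel classes but need not be injective, as `ψ` may move base elements
  -- to added points of one line. Corresponding classes have equal size, so `p` can be replaced by a
  -- bijection without changing any closure.
  obtain ⟨θ, hθ⟩ : ∃ θ : M.E ≃ N.E, ∀ x, N.closure {(θ x : β)} = N.closure {p x} := by
    refine exists_equiv_of_labels (fun x : M.E => N.closure {p x})
      (fun y : N.E => N.closure {(y : β)}) fun k => ?_
    by_cases hk : ∃ y ∈ N.E, N.closure {y} = k
    swap
    · have h1 : {x : M.E | N.closure {p x} = k} = ∅ := by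
        ext x
        simpa using fun h => hk ⟨p x, hpE x, h⟩
      have h2 : {y : N.E | N.closure {(y : β)} = k} = ∅ := by
        ext y
        simpa using fun h => hk ⟨y, y.2, h⟩
      rw [h1, h2, ncard_empty, ncard_empty]
    obtain ⟨y₀, hy₀, rfl⟩ := hk
    obtain ⟨w, hw, hwy⟩ := hψ.surjOn (show .base y₀ ∈ (N.freeCone m).E by simpa using hy₀)
    have hwt : w ≠ .tip := by
      rintro rfl
      rw [htip] at hwy
      cases hwy
    obtain ⟨e, hwe⟩ := exists_isOver hwt
    have he : e ∈ M.E := hwe.mem_ground_iff.1 hw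
    have hwy' : IsOver (ψ w) y₀ := hwy ▸ rfl
    have hset : ∀ x : M.E, N.closure {p x} = N.closure {y₀} ↔ M.closure {x.1} = M.closure {e} :=
      fun x => (hpar _ (hbase x x.2) w hw x e _ _ rfl hwe (hp x) hwy').symm
    have hM : Subtype.val '' {x : M.E | N.closure {p x} = N.closure {y₀}} = M.closure {e} := by
      ext x
      simp only [hset, mem_image, Set.mem_ofPred_eq]
      constructor
      · rintro ⟨x, hx, rfl⟩
        exact hx ▸ M.mem_closure_self x.1 x.2
      · exact fun hx => ⟨⟨x, mem_ground_of_mem_closure hx⟩, closure_singleton_eq_of_mem hx, rfl⟩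
    have hN : Subtype.val '' {y : N.E | N.closure {(y : β)} = N.closure {y₀}} =
        N.closure {y₀} := by
      ext x
      simp only [mem_image, Set.mem_ofPred_eq]
      constructor
      · rintro ⟨x, hx, rfl⟩
        exact hx ▸ N.mem_closure_self x.1 x.2
      · exact fun hx => ⟨⟨x, mem_ground_of_mem_closure hx⟩, closure_singleton_eq_of_mem hx, rfl⟩
    rw [← ncard_image_of_injective _ Subtype.val_injective, hM,
      ← ncard_image_of_injective _ Subtype.val_injective, hN]
    refine Nat.eq_of_mul_eq_mul_left (Nat.succ_pos m) ?_
    rw [Nat.succ_eq_add_one, ← ncard_isOver_closure, ← ncard_isOver_closure]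
    have himg : ψ '' {y | ∃ f ∈ M.E, IsOver y f ∧ M.closure {f} = M.closure {e}} =
        {y | ∃ f ∈ N.E, IsOver y f ∧ N.closure {f} = N.closure {y₀}} := by
      ext z
      constructor
      · rintro ⟨y, ⟨f, hf, hyf, hfe⟩, rfl⟩
        have hy := (hyf.mem_ground_iff (M := M)).2 hf
        obtain ⟨f', hf'⟩ := exists_isOver (hne y hy hyf.ne_tip)
        exact ⟨f', hf'.mem_ground_iff.1 (hψ.mapsTo hy), hf',
          (hpar y hy w hw _ _ _ _ hyf hwe hf' hwy').1 hfe⟩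
      · rintro ⟨f', hf', hzf', hfy⟩
        obtain ⟨y, hy, rfl⟩ := hψ.surjOn (hzf'.mem_ground_iff.2 hf')
        have hyt : y ≠ .tip := fun h => hzf'.ne_tip (h ▸ htip)
        obtain ⟨f, hf⟩ := exists_isOver hyt
        exact ⟨y, ⟨f, hf.mem_ground_iff.1 hy, hf,
          (hpar y hy w hw _ _ _ _ hf hwe hzf' hwy').2 hfy⟩, rfl⟩
    rw [← himg, InjOn.ncard_image]
    refine hψ.injOn.mono ?_
    rintro y ⟨f, hf, hyf, -⟩
    exact hyf.mem_ground_iff.2 hf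
  refine ⟨θ, fun I => ?_⟩
  have hIE : Subtype.val '' I ⊆ M.E := by simp
  have hIfin := M.ground_finite.subset hIE
  have hb : FreeConePoint.base (m := m) '' (Subtype.val '' I) ⊆ (M.freeCone m).E :=
    image_base_subset_freeCone hIE
  have hψb : ψ '' (FreeConePoint.base '' (Subtype.val '' I)) ⊆ (N.freeCone m).E :=
    (image_mono hb).trans hψ.image_eq.subset
  have hproj : coneProj (ψ '' (FreeConePoint.base '' (Subtype.val '' I))) = p '' I := by
    ext q
    rw [mem_coneProj_iff, image_image, image_image]
    constructor
    · rintro ⟨_, ⟨x, hx, rfl⟩, hq⟩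
      exact ⟨x, hx, (hp x).eq hq⟩
    · rintro ⟨x, hx, rfl⟩
      exact ⟨_, ⟨x, hx, rfl⟩, hp x⟩
  have hcl : N.rk (p '' I) = N.rk (Subtype.val '' (θ '' I)) := by
    rw [image_image]
    exact rk_congr_closure (closure_image_congr fun x _ => (hθ x).symm)
  -- With the tip adjoined, independence in either cone depends only on the projection, so both
  -- sides reduce to independence in `M` and `N`.
  have hindep := hI _ (insert_subset (tip_mem_freeCone M) hb)
  rw [freeCone_indep_insert_tip_iff hb (by simp), image_insert_eq, htip,
    freeCone_indep_insert_tip_iff hψb, hproj, hcl, coneProj_image_base,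
    (hψ.injOn.mono hb).ncard_image,
    ncard_image_of_injective _ FreeConePoint.base_injective, ← indep_iff_ncard_le_rk hIfin,
    ncard_image_of_injective _ Subtype.val_injective] at hindep
  · rw [hindep, indep_iff_ncard_le_rk (toFinite _),
      ncard_image_of_injective _ Subtype.val_injective, ncard_image_of_injective _ θ.injective]
  · rintro ⟨y, hy, hyt⟩
    obtain ⟨x, hx, rfl⟩ := hy
    exact hne _ (hb ⟨x, hx, rfl⟩) (by simp) hyt

end Recovery

end Matroid

namespace Matroid

/-! ### Rank and looplessness from the `𝒢`-invariant -/

section Consequences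

variable {α : Type u} {β : Type v} {M : Matroid α} {N : Matroid β} [M.Finite] [N.Finite]

theorem prefixRk_length {n : ℕ} (M : Matroid α) (σ : Fin n ≃ M.E) :
    M.prefixRk σ n = M.rk M.E := by
  have hS : {i : Fin n | i.1 < n} = univ := eq_univ_of_forall fun i => i.2
  rw [prefixRk, setRk, hS, image_univ]
  congr 1
  exact (σ.surjective.range_comp _).trans Subtype.range_coe

/-- Matroids with the same `𝒢`-invariant have the same rank. -/
theorem rk_ground_eq_of_gInvariant_eq (h : M.gInvariant = N.gInvariant) :
    M.rk M.E = N.rk N.E := by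
  obtain ⟨e, he⟩ := exists_equiv_prefixRk h rfl
  obtain ⟨σ⟩ := M.exists_enumeration
  rw [← M.prefixRk_length σ, ← N.prefixRk_length (e σ), he]

/-- A matroid with the same `𝒢`-invariant as a loopless matroid is loopless. -/
theorem loopless_of_gInvariant_eq [M.Loopless] (h : M.gInvariant = N.gInvariant) :
    N.Loopless := by
  obtain ⟨e, he⟩ := exists_equiv_prefixRk h rfl
  rw [loopless_iff_forall_isNonloop]
  intro y hy
  obtain ⟨σ⟩ := M.exists_enumeration
  obtain ⟨i, hi⟩ := (e σ).surjective ⟨y, hy⟩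
  let z : Fin M.E.ncard := ⟨0, i.pos⟩
  -- An enumeration of `N` that starts with `y`; its first prefix rank is that of some enumeration
  -- of the loopless `M`, namely one.
  let τ : Fin M.E.ncard ≃ N.E := (Equiv.swap z i).trans (e σ)
  have hS : {j : Fin M.E.ncard | j.1 < 1} = {z} := by
    ext j
    simp [z, Fin.ext_iff]
  have hτ : N.prefixRk τ 1 = N.rk {y} := by
    rw [prefixRk, setRk, hS, image_singleton]
    simp [τ, hi]
  rw [← e.apply_symm_apply τ, he, prefixRk, setRk, hS, image_singleton,
    rk_singleton (Subtype.coe_prop _)] at hτ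
  rw [← eRk_singleton_eq_one_iff, ← cast_rk, ← hτ, Nat.cast_one]

end Consequences

end Matroid

theorem mainTheorem10 (m : ℕ) (hm : 0 < m) {α : Type u} (M : Matroid α) [M.Finite]
    [M.Loopless] (hr : 2 < M.eRank) :
    Matroid.ConfigurationUnique.{u, w} (M.freeCone m) ∧
      ∀ (β : Type v) (N : Matroid β) [N.Finite],
        M.gInvariant = N.gInvariant → ¬ M.IsIsomorphic N →
          Matroid.ConfigurationUnique.{v, w} (N.freeCone m) ∧
          (M.freeCone m).gInvariant = (N.freeCone m).gInvariant ∧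
          ¬ (M.freeCone m).IsIsomorphic (N.freeCone m) := by
  have hrk : 2 < M.rk M.E := by
    rw [← Matroid.eRk_ground, ← Matroid.cast_rk] at hr
    exact_mod_cast hr
  refine ⟨Matroid.configurationUnique_freeCone hm hrk, fun β N _ h hMN => ?_⟩
  have := Matroid.loopless_of_gInvariant_eq h
  exact ⟨Matroid.configurationUnique_freeCone hm (Matroid.rk_ground_eq_of_gInvariant_eq h ▸ hrk),
    Matroid.gInvariant_freeCone_eq h,
    fun hQ => hMN (Matroid.isIsomorphic_of_freeCone hm (by omega) hQ)⟩
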